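/- Computational model. Algorithms are programs of a deterministic random access machine over the rationals. The machine has named variables and arrays that hold rational numbers (arrays are indexed by natural numbers), it supports branching and loops, and its elementary operations, each of cost one, are $+,-,\times,\div$, $\lfloor\cdot\rfloor$, reading off the numerator or denominator, loading a constant, reading or writing an array cell, comparing two numbers, and evaluating one of the input functions $f_j$ at a rational point. The encoding length of a rational $p/q$ in lowest terms is $\lceil\log_2(|p|+1)\rceil+\lceil\log_2(q+1)\rceil$; an operation is "on $B$-bit numbers" if the numbers involved have encoding length at most $B$. Theorem. There are a single program ROUND\_ROBP (the same for all inputs) and an absolute constant $C>0$ such that the following holds for all integers $n\ge 1$, $u\ge 2$, all rationals $b$ and $\delta>0$, and all nondecreasing functions $f_1,\dots,f_n:\mathbb{R}\to\mathbb{R}_{\ge 0}$ that take rational values at rational points. Let $$Z(f,b,u)=\Big\{x\in\{0,1,\dots,u-1\}^n:\ \sum_{j=1}^n f_j(x_j)\le b\Big\},$$ and let $L$ be a bound on the input encoding lengths: $b$ and $\delta$ have encoding length at most $L$, and for each $j$ and each $x\in\{0,\dots,u-1\}$ the value $f_j(x)$ has encoding length at most $L\cdot L_x$, where $L_x$ is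 the encoding length of $x$. Given $n,u,b,\delta$ and access to evaluations of $f_1,\dots,f_n$, the program halts and outputs, as a pair of integers $(m,e)$, a number $Z'=m\,2^{e}$ with $$|Z(f,b,u)|\ \le\ Z'\ \le\ (1+\delta)\,|Z(f,b,u)|,$$ after at most $$C\cdot\frac{n^5(\log_2 u)^3(L+\log_2 n)}{\min(\delta,1)^2}$$ elementary operations, all on numbers of encoding length at most $C\,(L\log_2 u+\log_2 n)$. -/

import Mathlib

/-- The encoding length `⌈log₂(|p| + 1)⌉ + ⌈log₂(q + 1)⌉` of a rational number `p / q` in lowest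
terms. -/
def encLen (r : ℚ) : ℕ :=
  Nat.clog 2 (r.num.natAbs + 1) + Nat.clog 2 (r.den + 1)

/-- The set `Z(f, b, u)` of all points `x ∈ {0, …, u - 1}ⁿ` with `∑ j, f j (x j) ≤ b`. -/
def solutionSet {n : ℕ} (f : Fin n → ℝ → ℝ) (b : ℚ) (u : ℕ) : Set (Fin n → Fin u) :=
  {x | ∑ j, f j (((x j : ℕ) : ℝ)) ≤ (b : ℝ)}

/-! A random access machine over the rational numbers, programmed in a small imperative language.
A program is a fixed finite object that does not depend on the input; it has named variables and
named one-dimensional arrays, all holding rational numbers, and it may evaluate the functions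
`f j` at rational points. -/

namespace RatRAM

/-- The memory: the value of each variable, and the contents of each array. -/
structure State where
  var : ℕ → ℚ
  arr : ℕ → ℕ → ℚ

/-- Assign the value `v` to the variable `d`. -/
def State.setVar (σ : State) (d : ℕ) (v : ℚ) : State :=
  { σ with var := Function.update σ.var d v }

/-- Write the value `v` into cell `k` of the array `a`. -/
def State.setArr (σ : State) (a k : ℕ) (v : ℚ) : State :=
  { σ with arr := Function.update σ.arr a (Function.update (σ.arr a) k v) }

/-- Binary arithmetic operations (division by zero returns zero). -/
inductive BinOp where
  | add | sub | mul | div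

def BinOp.eval : BinOp → ℚ → ℚ → ℚ
  | .add, x, y => x + y
  | .sub, x, y => x - y
  | .mul, x, y => x * y
  | .div, x, y => x / y

/-- Unary operations: rounding down, and reading off the numerator or the denominator of a number
that is stored as a reduced fraction. -/
inductive UnOp where
  | floor | num | den

def UnOp.eval : UnOp → ℚ → ℚ
  | .floor, x => (⌊x⌋ : ℤ)
  | .num, x => x.num
  | .den, x => x.den

/-- Comparisons of two variables. -/
inductive Test where
  | le (x y : ℕ)
  | lt (x y : ℕ)

def Test.Holds (σ : State) : Test → Prop
  | .le x y => σ.var x ≤ σ.var y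
  | .lt x y => σ.var x < σ.var y

/-- Programs. All arguments of type `ℕ` are names of variables, except the first argument of
`store` and the second argument of `load`, which are names of arrays. -/
inductive Prog where
  | skip
  | const (d : ℕ) (q : ℚ)
  | unop (d : ℕ) (o : UnOp) (x : ℕ)
  | binop (d : ℕ) (o : BinOp) (x y : ℕ)
  | load (d a i : ℕ)
  | store (a i x : ℕ)
  | query (d j x : ℕ)
  | seq (P Q : Prog)
  | ite (c : Test) (P Q : Prog)
  | while (c : Test) (P : Prog)

/-- `Exec f B P σ τ t` : the program `P`, with access to the functions `f 0, …, f (n - 1)`, run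
from the memory `σ`, halts with the memory `τ` after exactly `t` elementary operations, and every
number that it produces on the way has encoding length at most `B`.
Every arithmetic operation, assignment of a constant, array access, function evaluation and
comparison is one elementary operation. There is no rule for an array access whose index is not a
natural number, nor for an evaluation of `f j` where `j` is not one of `0, …, n - 1` or the value
is not rational: there the program does not halt. -/
inductive Exec {n : ℕ} (f : Fin n → ℝ → ℝ) (B : ℝ) : Prog → State → State → ℕ → Prop where
  | skip (σ : State) : Exec f B .skip σ σ 0
  | const (σ : State) (d : ℕ) (q : ℚ) (hB : (encLen q : ℝ) ≤ B) :
      Exec f B (.const d q) σ (σ.setVar d q) 1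
  | unop (σ : State) (d : ℕ) (o : UnOp) (x : ℕ) (hB : (encLen (o.eval (σ.var x)) : ℝ) ≤ B) :
      Exec f B (.unop d o x) σ (σ.setVar d (o.eval (σ.var x))) 1
  | binop (σ : State) (d : ℕ) (o : BinOp) (x y : ℕ)
      (hB : (encLen (o.eval (σ.var x) (σ.var y)) : ℝ) ≤ B) :
      Exec f B (.binop d o x y) σ (σ.setVar d (o.eval (σ.var x) (σ.var y))) 1
  | load (σ : State) (d a i k : ℕ) (hk : σ.var i = (k : ℚ))
      (hB : (encLen (σ.arr a k) : ℝ) ≤ B) :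
      Exec f B (.load d a i) σ (σ.setVar d (σ.arr a k)) 1
  | store (σ : State) (a i x k : ℕ) (hk : σ.var i = (k : ℚ))
      (hB : (encLen (σ.var x) : ℝ) ≤ B) :
      Exec f B (.store a i x) σ (σ.setArr a k (σ.var x)) 1
  | query (σ : State) (d j x : ℕ) (k : Fin n) (v : ℚ) (hk : σ.var j = ((k : ℕ) : ℚ))
      (hv : f k ((σ.var x : ℚ) : ℝ) = (v : ℝ)) (hB : (encLen v : ℝ) ≤ B) :
      Exec f B (.query d j x) σ (σ.setVar d v) 1
  | seq {P Q : Prog} {σ τ ρ : State} {s t : ℕ} (hP : Exec f B P σ τ s) (hQ : Exec f B Q τ ρ t) :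
      Exec f B (.seq P Q) σ ρ (s + t)
  | ite_true {c : Test} {P Q : Prog} {σ τ : State} {t : ℕ} (hc : c.Holds σ)
      (hP : Exec f B P σ τ t) : Exec f B (.ite c P Q) σ τ (t + 1)
  | ite_false {c : Test} {P Q : Prog} {σ τ : State} {t : ℕ} (hc : ¬ c.Holds σ)
      (hQ : Exec f B Q σ τ t) : Exec f B (.ite c P Q) σ τ (t + 1)
  | while_true {c : Test} {P : Prog} {σ τ ρ : State} {s t : ℕ} (hc : c.Holds σ)
      (hP : Exec f B P σ τ s) (hW : Exec f B (.while c P) τ ρ t) :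
      Exec f B (.while c P) σ ρ (s + t + 1)
  | while_false {c : Test} {P : Prog} {σ : State} (hc : ¬ c.Holds σ) :
      Exec f B (.while c P) σ σ 1

/-- The initial memory: variables `0, 1, 2, 3` hold the input numbers `n, u, b, δ`; everything
else is zero. -/
def initial (n u : ℕ) (b δ : ℚ) : State where
  var := fun i => if i = 0 then (n : ℚ) else if i = 1 then (u : ℚ) else if i = 2 then b
    else if i = 3 then δ else 0
  arr := fun _ _ => 0

/-- The real number `z` is the output in the memory `τ`, in floating-point form: `z = m * 2 ^ e`
for the integers `m` and `e` in the variables `0` and `1`. -/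
def Outputs (τ : State) (z : ℝ) : Prop :=
  ∃ m e : ℤ, τ.var 0 = (m : ℚ) ∧ τ.var 1 = (e : ℚ) ∧ z = (m : ℝ) * (2 : ℝ) ^ e

end RatRAM

/-! Dynamic programming over the coordinates. Write Z_j(c) for the number of points in the first j
coordinates whose value is at most c. Then Z_{j+1}(c) is the sum over x of Z_j(c - f_j(x)), with j
counted from 0. Both the range of x and the step function Z_j are too large, so each is thinned out
at the price of a factor 1 + 1/E.

Arguments: {0, …, u - 1} is cut into blocks whose ends grow geometrically, about E log u of them,
and every x is replaced by the first point of its block. Since f_j is nondecreasing, Z_j(c - f_j(x))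
is antitone in x. The sum therefore only grows, and by at most 1 + 1/E (`Blocks.sum_le`,
`Blocks.le_sum`). Over n coordinates this gives (1 + 1/E)^n (`Blocks.cnt_le`, `Blocks.le_cnt`).

Step function: it is kept as a list of entries (value, weight). A layer forms all sums of an entry
value and a block value, sorts them, and merges consecutive ones into groups within which the
accumulated weight grows at most by 1 + 1/E. A group is booked at its smallest value, so again the
function only grows (`Grouping.new`, `Grouping.same`). The total weight is at most u^n and (1 +
1/E)^E ≥ 2, so at most E n log u + 1 groups arise (`le_mul_of_pow_le`). The layers cost another (1 +
1/E)^n (`Approximates.succ`), and rounding the result to a short mantissa one more factor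
(`run_output`). With E about 6n / min(δ, 1) the product (1 + 1/E)^(2n + 1) is at most 1 + δ
(`one_add_inv_pow_le`).

Word length: values, sums and weights have about n times more bits than a machine word may have.
They are stored as rows of K binary digits in arrays and handled by one routine for linear
combinations, whose carry also decides comparisons (`run_lincomb`). Values are rounded down to
multiples of a fixed power of 1/2. If that power is fine compared with the product of the
denominators, a sum that exceeds b exceeds it by more than all rounding errors together, and the
count does not change at all (`blockCnt_floor`).

Cost: n layers, each handling (E n log u)(E log u) pairs with O(K) operations per pair, where K is
about n (L log u + log n). Radix sort keeps the sorting within this bound. The product is n^5 (log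
u)^3 (L + log n) / min(δ, 1)^2 up to a constant (`total_time_le`, `time_le`). -/

namespace RatRAM

/-! ### Frame conditions, number sizes and program rules. -/

/-- The memory `τ` agrees with `σ` outside the variables `vs` and the arrays `as`. -/
def Agree (vs as : List ℕ) (σ τ : State) : Prop :=
  (∀ v, v ∉ vs → τ.var v = σ.var v) ∧ ∀ a, a ∉ as → τ.arr a = σ.arr a

/-- The variables that a program may change. -/
def Prog.wvars : Prog → List ℕ
  | .skip => []
  | .const d _ => [d]
  | .unop d _ _ => [d]
  | .binop d _ _ _ => [d]
  | .load d _ _ => [d]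
  | .store _ _ _ => []
  | .query d _ _ => [d]
  | .seq P Q => P.wvars ++ Q.wvars
  | .ite _ P Q => P.wvars ++ Q.wvars
  | .while _ P => P.wvars

/-- The arrays that a program may change. -/
def Prog.warrs : Prog → List ℕ
  | .skip => []
  | .const _ _ => []
  | .unop _ _ _ => []
  | .binop _ _ _ _ => []
  | .load _ _ _ => []
  | .store a _ _ => [a]
  | .query _ _ _ => []
  | .seq P Q => P.warrs ++ Q.warrs
  | .ite _ P Q => P.warrs ++ Q.warrs
  | .while _ P => P.warrs

/-- The memory `τ` differs from `σ` only where the program `P` may write. -/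
abbrev Frame (P : Prog) (σ τ : State) : Prop := Agree P.wvars P.warrs σ τ

@[simp] theorem setVar_var (σ : State) (d x : ℕ) (v : ℚ) :
    (σ.setVar d v).var x = if x = d then v else σ.var x := by
  simp [State.setVar, Function.update_apply]

@[simp] theorem setVar_arr (σ : State) (d : ℕ) (v : ℚ) : (σ.setVar d v).arr = σ.arr := rfl

@[simp] theorem setArr_var (σ : State) (a k : ℕ) (v : ℚ) : (σ.setArr a k v).var = σ.var := rfl

theorem setArr_arr (σ : State) (a k a' : ℕ) (v : ℚ) :
    (σ.setArr a k v).arr a' =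
      if a' = a then Function.update (σ.arr a) k v else σ.arr a' := by
  simp only [State.setArr, Function.update_apply]

theorem setArr_apply (σ : State) (a k a' k' : ℕ) (v : ℚ) :
    (σ.setArr a k v).arr a' k' = if a' = a ∧ k' = k then v else σ.arr a' k' := by
  rw [setArr_arr]
  by_cases h : a' = a <;> simp [h, Function.update_apply]

theorem Agree.refl (vs as : List ℕ) (σ : State) : Agree vs as σ σ :=
  ⟨fun _ _ => rfl, fun _ _ => rfl⟩

theorem Agree.trans {vs as : List ℕ} {σ τ ρ : State} (h : Agree vs as σ τ)
    (h' : Agree vs as τ ρ) : Agree vs as σ ρ :=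
  ⟨fun v hv => (h'.1 v hv).trans (h.1 v hv), fun a ha => (h'.2 a ha).trans (h.2 a ha)⟩

theorem Agree.mono {vs as vs' as' : List ℕ} {σ τ : State} (h : Agree vs as σ τ)
    (hv : vs ⊆ vs') (ha : as ⊆ as') : Agree vs' as' σ τ :=
  ⟨fun v h' => h.1 v fun h'' => h' (hv h''), fun a h' => h.2 a fun h'' => h' (ha h'')⟩

theorem Agree.setVar {vs as : List ℕ} {σ : State} {d : ℕ} (v : ℚ) (hd : d ∈ vs) :
    Agree vs as σ (σ.setVar d v) := by
  refine ⟨fun x hx => ?_, fun _ _ => rfl⟩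
  have : x ≠ d := fun h => hx (h ▸ hd)
  simp [this]

variable {n : ℕ} {f : Fin n → ℝ → ℝ} {B : ℝ} {Ω : ℕ}

/-- What a program leaves unchanged can be read off its text. For the concrete programs below the
non-membership is settled by `decide`, and this carries variables and arrays across subprograms. -/
theorem Exec.frame {P : Prog} {σ τ : State} {t : ℕ} (h : Exec f B P σ τ t) : Frame P σ τ := by
  induction h with
  | skip σ => exact Agree.refl _ _ _
  | const σ d q _ => exact Agree.setVar _ (by simp [Prog.wvars])
  | unop σ d o x _ => exact Agree.setVar _ (by simp [Prog.wvars])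
  | binop σ d o x y _ => exact Agree.setVar _ (by simp [Prog.wvars])
  | load σ d a i k _ _ => exact Agree.setVar _ (by simp [Prog.wvars])
  | store σ a i x k _ _ =>
    refine ⟨fun _ _ => rfl, fun a' ha' => ?_⟩
    have : a' ≠ a := by simpa [Prog.warrs] using ha'
    simp [setArr_arr, this]
  | query σ d j x k v _ _ _ => exact Agree.setVar _ (by simp [Prog.wvars])
  | seq _ _ ih1 ih2 =>
    exact (Agree.mono ih1 (by simp [Prog.wvars]) (by simp [Prog.warrs])).trans
      (Agree.mono ih2 (by simp [Prog.wvars]) (by simp [Prog.warrs]))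
  | ite_true _ _ ih => exact Agree.mono ih (by simp [Prog.wvars]) (by simp [Prog.warrs])
  | ite_false _ _ ih => exact Agree.mono ih (by simp [Prog.wvars]) (by simp [Prog.warrs])
  | while_true _ _ _ ih1 ih2 => exact Agree.trans ih1 ih2
  | while_false _ => exact Agree.refl _ _ _

theorem Exec.mono {B' : ℝ} (hB : B ≤ B') {P : Prog} {σ τ : State} {t : ℕ}
    (h : Exec f B P σ τ t) : Exec f B' P σ τ t := by
  induction h with
  | skip σ => exact .skip σ
  | const σ d q h => exact .const σ d q (h.trans hB)
  | unop σ d o x h => exact .unop σ d o x (h.trans hB)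
  | binop σ d o x y h => exact .binop σ d o x y (h.trans hB)
  | load σ d a i k hk h => exact .load σ d a i k hk (h.trans hB)
  | store σ a i x k hk h => exact .store σ a i x k hk (h.trans hB)
  | query σ d j x k v hk hv h => exact .query σ d j x k v hk hv (h.trans hB)
  | seq _ _ ih1 ih2 => exact .seq ih1 ih2
  | ite_true hc _ ih => exact .ite_true hc ih
  | ite_false hc _ ih => exact .ite_false hc ih
  | while_true hc _ _ ih1 ih2 => exact .while_true hc ih1 ih2
  | while_false hc => exact .while_false hc

/-- The numerator and the denominator of `q` are at most `Ω`. -/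
def Fit (Ω : ℕ) (q : ℚ) : Prop := q.num.natAbs ≤ Ω ∧ q.den ≤ Ω

/-- One natural bound on numerators and denominators turns most size conditions into inequalities
for `omega`; the logarithm is taken only here. -/
theorem Fit.encLen_le {q : ℚ} (h : Fit Ω q) : encLen q ≤ 2 * Nat.clog 2 (Ω + 1) := by
  have h1 : Nat.clog 2 (q.num.natAbs + 1) ≤ Nat.clog 2 (Ω + 1) :=
    Nat.clog_mono_right 2 (Nat.succ_le_succ h.1)
  have h2 : Nat.clog 2 (q.den + 1) ≤ Nat.clog 2 (Ω + 1) :=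
    Nat.clog_mono_right 2 (Nat.succ_le_succ h.2)
  unfold encLen
  omega

theorem fit_int {z : ℤ} (h : |z| ≤ Ω) (h1 : 1 ≤ Ω) : Fit Ω (z : ℚ) := by
  refine ⟨?_, by simpa using h1⟩
  simp only [Rat.num_intCast]
  zify
  exact h

theorem fit_nat {k : ℕ} (h : k ≤ Ω) (h1 : 1 ≤ Ω) : Fit Ω (k : ℚ) := by
  refine ⟨?_, by simpa using h1⟩
  simpa using h

/-- The fraction need not be reduced: the reduced numerator and denominator divide `z` and `d`. -/
theorem fit_div {q : ℚ} {z : ℤ} {d : ℕ} (hd : 0 < d) (hq : q = z / d) (hz : |z| ≤ Ω)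
    (hdΩ : d ≤ Ω) : Fit Ω q := by
  subst hq
  have hd' : (d : ℤ) ≠ 0 := by exact_mod_cast hd.ne'
  have e : ((z : ℚ) / (d : ℚ)) = (z : ℚ) / ((d : ℤ) : ℚ) := by simp
  constructor
  · rw [e]
    have h := Rat.num_dvd z hd'
    rw [Rat.divInt_eq_div] at h
    rcases eq_or_ne z 0 with rfl | hz0
    · simp
    · have := Int.natAbs_le_of_dvd_ne_zero h hz0
      refine this.trans ?_
      zify
      exact hz
  · rw [e]
    have h := Rat.den_dvd z (d : ℤ)
    rw [Rat.divInt_eq_div] at h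
    have := Int.le_of_dvd (by exact_mod_cast hd) h
    have h2 : ((z : ℚ) / ((d : ℤ) : ℚ)).den ≤ d := by exact_mod_cast this
    exact h2.trans hdΩ

/-- The program `P`, started in the memory `σ`, halts after at most `t` operations, all on numbers
whose numerators and denominators are at most `Ω`, in a memory that satisfies `Q`. -/
def Run (f : Fin n → ℝ → ℝ) (Ω : ℕ) (P : Prog) (σ : State) (t : ℕ) (Q : State → Prop) : Prop :=
  ∃ τ s, Exec f ((2 * Nat.clog 2 (Ω + 1) : ℕ) : ℝ) P σ τ s ∧ s ≤ t ∧ Q τ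

theorem Run.mono {P : Prog} {σ : State} {s t : ℕ} {Q R : State → Prop} (h : Run f Ω P σ s Q)
    (hst : s ≤ t) (hQR : ∀ τ, Frame P σ τ → Q τ → R τ) : Run f Ω P σ t R := by
  obtain ⟨τ, s', h1, h2, h3⟩ := h
  exact ⟨τ, s', h1, h2.trans hst, hQR τ h1.frame h3⟩

theorem Run.seq {P P' : Prog} {σ : State} {t : ℕ} {R : State → Prop}
    (h : Run f Ω P σ 1 (fun τ => Run f Ω P' τ t R)) : Run f Ω (.seq P P') σ (t + 1) R := by
  obtain ⟨τ, s', h1, h2, ρ, t', h3, h4, h5⟩ := h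
  exact ⟨ρ, s' + t', .seq h1 h3, by omega, h5⟩

/-- The rule of composition, with a description of the memory in between. -/
theorem Run.comp {P P' : Prog} {σ : State} {s t T : ℕ} {Q R : State → Prop}
    (h : Run f Ω P σ s Q) (h' : ∀ τ, Frame P σ τ → Q τ → Run f Ω P' τ t R) (hT : s + t ≤ T) :
    Run f Ω (.seq P P') σ T R := by
  obtain ⟨τ, s', h1, h2, h3⟩ := h
  obtain ⟨ρ, t', h3, h4, h5⟩ := h' τ h1.frame h3
  exact ⟨ρ, s' + t', .seq h1 h3, by omega, h5⟩

theorem Run.skip {σ : State} {t : ℕ} {Q : State → Prop} (h : Q σ) : Run f Ω .skip σ t Q :=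
  ⟨σ, 0, .skip σ, Nat.zero_le _, h⟩

theorem Run.const {σ : State} {d : ℕ} {q : ℚ} {Q : State → Prop} (hq : Fit Ω q)
    (h : Q (σ.setVar d q)) : Run f Ω (.const d q) σ 1 Q :=
  ⟨_, 1, .const σ d q (by exact_mod_cast hq.encLen_le), le_rfl, h⟩

theorem Run.unop {σ : State} {d x : ℕ} {o : UnOp} {Q : State → Prop} (v : ℚ)
    (hv : o.eval (σ.var x) = v) (hF : Fit Ω v)
    (h : Q (σ.setVar d v)) : Run f Ω (.unop d o x) σ 1 Q := by
  subst hv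
  exact ⟨_, 1, .unop σ d o x (by exact_mod_cast hF.encLen_le), le_rfl, h⟩

theorem Run.binop {σ : State} {d x y : ℕ} {o : BinOp} {Q : State → Prop} (v : ℚ)
    (hv : o.eval (σ.var x) (σ.var y) = v) (hF : Fit Ω v)
    (h : Q (σ.setVar d v)) : Run f Ω (.binop d o x y) σ 1 Q := by
  subst hv
  exact ⟨_, 1, .binop σ d o x y (by exact_mod_cast hF.encLen_le), le_rfl, h⟩

theorem Run.load {σ : State} {d a i : ℕ} {Q : State → Prop} (k : ℕ) (v : ℚ)
    (hk : σ.var i = k) (hv : σ.arr a k = v) (hF : Fit Ω v)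
    (h : Q (σ.setVar d v)) : Run f Ω (.load d a i) σ 1 Q := by
  subst hv
  exact ⟨_, 1, .load σ d a i k hk (by exact_mod_cast hF.encLen_le), le_rfl, h⟩

theorem Run.store {σ : State} {a i x : ℕ} {Q : State → Prop} (k : ℕ) (v : ℚ)
    (hk : σ.var i = k) (hv : σ.var x = v) (hF : Fit Ω v)
    (h : Q (σ.setArr a k v)) : Run f Ω (.store a i x) σ 1 Q := by
  subst hv
  exact ⟨_, 1, .store σ a i x k hk (by exact_mod_cast hF.encLen_le), le_rfl, h⟩

theorem Run.query {σ : State} {d j x : ℕ} {Q : State → Prop} (k : Fin n) (v : ℚ)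
    (hk : σ.var j = ((k : ℕ) : ℚ)) (hv : f k ((σ.var x : ℚ) : ℝ) = (v : ℝ)) (hF : Fit Ω v)
    (h : Q (σ.setVar d v)) : Run f Ω (.query d j x) σ 1 Q :=
  ⟨_, 1, .query σ d j x k v hk hv (by exact_mod_cast hF.encLen_le), le_rfl, h⟩

theorem Run.ite {c : Test} {P P' : Prog} {σ : State} {t : ℕ} {Q : State → Prop}
    (h : c.Holds σ → Run f Ω P σ t Q) (h' : ¬ c.Holds σ → Run f Ω P' σ t Q) :
    Run f Ω (.ite c P P') σ (t + 1) Q := by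
  by_cases hc : c.Holds σ
  · obtain ⟨τ, s, h1, h2, h3⟩ := h hc
    exact ⟨τ, s + 1, .ite_true hc h1, by omega, h3⟩
  · obtain ⟨τ, s, h1, h2, h3⟩ := h' hc
    exact ⟨τ, s + 1, .ite_false hc h1, by omega, h3⟩

/-- The rule for a loop that runs exactly `N` times, with the invariant `I`. -/
theorem Run.while {c : Test} {P : Prog} {σ : State} {t : ℕ} (N : ℕ) (I : ℕ → State → Prop)
    (h0 : I 0 σ)
    (hstep : ∀ k < N, ∀ τ, Frame P σ τ → I k τ → c.Holds τ ∧ Run f Ω P τ t (I (k + 1)))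
    (hend : ∀ τ, Frame P σ τ → I N τ → ¬ c.Holds τ) :
    Run f Ω (.while c P) σ (N * (t + 1) + 1) (I N) := by
  -- Induction on the number `d` of rounds still to come, so that leaving the loop is the base case.
  have key : ∀ d k, k + d = N → ∀ τ, Frame P σ τ → I k τ →
      Run f Ω (.while c P) τ (d * (t + 1) + 1) (I N) := by
    intro d
    induction d with
    | zero =>
      intro k hk τ hτ hI
      obtain rfl : k = N := by omega
      exact ⟨τ, 1, .while_false (hend τ hτ hI), by omega, hI⟩
    | succ d ih =>
      intro k hk τ hτ hI
      obtain ⟨hc, ρ, s, h1, h2, h3⟩ := hstep k (by omega) τ hτ hI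
      obtain ⟨ρ', s', h4, h5, h6⟩ := ih (k + 1) (by omega) ρ (hτ.trans h1.frame) h3
      refine ⟨ρ', s + s' + 1, .while_true hc h1 h4, ?_, h6⟩
      rw [Nat.succ_mul]
      omega
  exact key N 0 (by omega) σ (Agree.refl _ _ _) h0

/-- The loop `for i = 0, …, N - 1`, where the variable `N` holds the bound and the variable `one`
holds `1`. -/
def Prog.for (one i N : ℕ) (P : Prog) : Prog :=
  .seq (.const i 0) (.while (.lt i N) (.seq P (.binop i .add i one)))

theorem Prog.wvars_for (one i N : ℕ) (P : Prog) :
    (Prog.for one i N P).wvars = i :: (P.wvars ++ [i]) := rfl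

theorem Prog.warrs_for (one i N : ℕ) (P : Prog) :
    (Prog.for one i N P).warrs = P.warrs ++ [] := rfl

/-- The rule for `Prog.for`, with the invariant `I`. -/
theorem Run.for {one i N : ℕ} {P : Prog} {σ : State} (t M : ℕ) (I : ℕ → State → Prop)
    (hM : σ.var N = M) (h1 : σ.var one = 1) (hMΩ : M ≤ Ω) (hΩ : 1 ≤ Ω)
    (hi : i ∉ P.wvars ∧ i ≠ N ∧ i ≠ one ∧ N ∉ P.wvars ∧ one ∉ P.wvars)
    (h0 : I 0 (σ.setVar i 0))
    (hstep : ∀ k < M, ∀ τ, Frame (.for one i N P) σ τ → τ.var i = k → I k τ →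
      Run f Ω P τ t (fun ρ => Frame P τ ρ → I (k + 1) (ρ.setVar i ((k + 1 : ℕ) : ℚ)))) :
    Run f Ω (.for one i N P) σ (M * (t + 2) + 2) (I M) := by
  obtain ⟨hi1, hi2, hi3, hi4, hi5⟩ := hi
  have hfr : ∀ τ, Frame (.seq P (.binop i .add i one)) (σ.setVar i 0) τ →
      Frame (.for one i N P) σ τ := by
    intro τ hτ
    refine (Agree.setVar (0 : ℚ) (by simp [Prog.wvars_for])).trans (hτ.mono ?_ ?_)
    · simp [Prog.wvars_for, Prog.wvars]
    · simp [Prog.warrs_for, Prog.warrs]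
  refine Run.seq (Run.const (by simpa using fit_nat (k := 0) (Nat.zero_le _) hΩ) ?_)
  -- Each round pays for the body, the increment and the test; the initialisation and the last test
  -- make up the remaining 2.
  refine Run.mono (s := M * (t + 1 + 1) + 1) (Q := fun τ => τ.var i = (M : ℕ) ∧ I M τ) ?_ le_rfl
    (fun τ _ h => h.2)
  refine Run.while M (fun k τ => τ.var i = (k : ℕ) ∧ I k τ) ⟨by simp, h0⟩ ?_ ?_
  · rintro k hk τ hτ ⟨hki, hI⟩
    have hτ' := hfr τ hτ
    have hN : τ.var N = M := by
      rw [hτ'.1 N (by simp [Prog.wvars_for, hi4, hi2.symm]), hM]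
    have hone : τ.var one = 1 := by
      rw [hτ'.1 one (by simp [Prog.wvars_for, hi5, hi3.symm]), h1]
    refine ⟨?_, ?_⟩
    · show τ.var i < τ.var N
      rw [hki, hN]
      exact_mod_cast hk
    · refine Run.comp (s := t) (t := 1) (hstep k hk τ hτ' hki hI) (fun ρ hρ hR => ?_) le_rfl
      refine Run.binop (((k + 1 : ℕ) : ℚ)) ?_ (fit_nat (by omega) hΩ) ⟨by simp, hR hρ⟩
      simp only [BinOp.eval]
      rw [hρ.1 i hi1, hρ.1 one hi5, hki, hone]
      push_cast
      ring
  · rintro τ hτ ⟨hki, hI⟩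
    have hτ' := hfr τ hτ
    have hN : τ.var N = M := by
      rw [hτ'.1 N (by simp [Prog.wvars_for, hi4, hi2.symm]), hM]
    show ¬ τ.var i < τ.var N
    rw [hki, hN]
    exact lt_irrefl _

end RatRAM

/-! ### Long numbers as rows of binary digits. -/

namespace RatRAM

/-- Splits off the binary digit `t`; both the carry recursion and the radix sort rest on it. -/
theorem emod_two_pow_succ (x : ℤ) (t : ℕ) :
    x % 2 ^ (t + 1) = x % 2 ^ t + 2 ^ t * (x / 2 ^ t % 2) := by
  have h1 := Int.emod_add_mul_ediv x (2 ^ (t + 1))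
  have h2 := Int.emod_add_mul_ediv x (2 ^ t)
  have h3 := Int.emod_add_mul_ediv (x / 2 ^ t) 2
  have h4 : x / 2 ^ (t + 1) = x / 2 ^ t / 2 := by
    rw [pow_succ, Int.ediv_ediv_of_nonneg (by positivity)]
  rw [← h4] at h3
  linear_combination h1 - h2 - (2 : ℤ) ^ t * h3

/-- The cells `o, …, o + K - 1` of an array hold the `K` lowest binary digits of `x`, starting with
the lowest one. -/
def Rep (A : ℕ → ℚ) (o K : ℕ) (x : ℤ) : Prop :=
  ∀ t < K, A (o + t) = ((x / 2 ^ t % 2 : ℤ) : ℚ)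

theorem Rep.congr {A A' : ℕ → ℚ} {o K : ℕ} {x : ℤ} (h : Rep A o K x)
    (hA : ∀ i, o ≤ i → i < o + K → A' i = A i) : Rep A' o K x := by
  intro t ht
  rw [hA _ (by omega) (by omega), h t ht]

theorem rep_zero {A : ℕ → ℚ} {o K : ℕ} (h : ∀ i, o ≤ i → i < o + K → A i = 0) :
    Rep A o K 0 := by
  intro t ht
  rw [h _ (by omega) (by omega)]
  simp

/-- Writing row `o'` of the array `a'` from left to right while reading row `o` of the array `a`
does not destroy any cell before it is read. -/
def NoClash (a o a' o' K : ℕ) : Prop := a ≠ a' ∨ o = o' ∨ o + K ≤ o' ∨ o' + K ≤ o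

variable {n : ℕ} {f : Fin n → ℝ → ℝ} {Ω : ℕ}

/-- The linear combination of two rows of binary digits, at the offsets in the variables 20 and 21
of the arrays `a₁` and `a₂`, with the coefficients in the variables 23 and 24, is written to the row
at the offset in the variable 22 of the array `a₃`. The variable 26 receives the carry. -/
def lincomb (a₁ a₂ a₃ : ℕ) : Prog :=
  .seq (.const 26 0) <|
  .for 5 25 14 <|
  .seq (.binop 27 .add 20 25) <|
  .seq (.load 27 a₁ 27) <|
  .seq (.binop 27 .mul 23 27) <|
  .seq (.binop 26 .add 26 27) <|
  .seq (.binop 27 .add 21 25) <|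
  .seq (.load 27 a₂ 27) <|
  .seq (.binop 27 .mul 24 27) <|
  .seq (.binop 26 .add 26 27) <|
  .seq (.binop 27 .div 26 6) <|
  .seq (.unop 27 .floor 27) <|
  .seq (.binop 28 .mul 6 27) <|
  .seq (.binop 28 .sub 26 28) <|
  -- A copy: variable 4 always holds 0. The same idiom is used for all copies between variables.
  .seq (.binop 26 .add 27 4) <|
  .seq (.binop 27 .add 22 25) <|
  .store a₃ 27 28

theorem wvars_lincomb (a₁ a₂ a₃ : ℕ) : (lincomb a₁ a₂ a₃).wvars =
    [26, 25, 27, 27, 27, 26, 27, 27, 27, 26, 27, 27, 28, 28, 26, 27, 25] := rfl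

theorem warrs_lincomb (a₁ a₂ a₃ : ℕ) : (lincomb a₁ a₂ a₃).warrs = [a₃] := rfl

theorem floor_int_div_two (s : ℤ) : ⌊(s : ℚ) / 2⌋ = s / 2 := by
  have := Rat.floor_intCast_div_natCast s 2
  simpa using this

/-- Digit `t` of the combination is the parity of carry plus `w₁ * d₁ + w₂ * d₂`, and half of that
number, rounded down, is the next carry. In closed form the carry before round `t` is `T t / 2 ^ t`,
where `T t` is the combination of the operands cut to `t` digits. It never exceeds `|w₁| + |w₂|`, so
machine words stay short however long the rows are. Coefficients may be negative: the row then holds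
a residue modulo `2 ^ K`, and the sign of the final carry is the sign test used for comparisons. -/
theorem run_lincomb {a₁ a₂ a₃ : ℕ} {σ : State} {K o₁ o₂ o₃ : ℕ} {w₁ w₂ x₁ x₂ : ℤ}
    (h4 : σ.var 4 = 0) (h5 : σ.var 5 = 1) (h6 : σ.var 6 = 2) (h14 : σ.var 14 = K)
    (h20 : σ.var 20 = o₁) (h21 : σ.var 21 = o₂) (h22 : σ.var 22 = o₃)
    (h23 : σ.var 23 = w₁) (h24 : σ.var 24 = w₂)
    (b₁ : o₁ + K ≤ Ω) (b₂ : o₂ + K ≤ Ω) (b₃ : o₃ + K ≤ Ω)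
    (bw : 4 * (|w₁| + |w₂|) ≤ (Ω : ℤ)) (hΩ : 4 ≤ Ω)
    (hx₁ : Rep (σ.arr a₁) o₁ K x₁) (hx₂ : Rep (σ.arr a₂) o₂ K x₂)
    (hc₁ : NoClash a₃ o₃ a₁ o₁ K) (hc₂ : NoClash a₃ o₃ a₂ o₂ K) :
    Run f Ω (lincomb a₁ a₂ a₃) σ (K * 17 + 3) (fun τ =>
      Rep (τ.arr a₃) o₃ K (w₁ * x₁ + w₂ * x₂) ∧
      τ.var 26 = (((w₁ * (x₁ % 2 ^ K) + w₂ * (x₂ % 2 ^ K)) / 2 ^ K : ℤ) : ℚ) ∧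
      ∀ i, i < o₃ ∨ o₃ + K ≤ i → τ.arr a₃ i = σ.arr a₃ i) := by
  have hΩ1 : 1 ≤ Ω := by omega
  set T : ℕ → ℤ := fun t => w₁ * (x₁ % 2 ^ t) + w₂ * (x₂ % 2 ^ t) with hT
  refine Run.seq (Run.const (by simpa using fit_nat (k := 0) (Nat.zero_le _) hΩ1) ?_)
  refine Run.mono (Run.for (t := 15) (M := K) (fun t τ =>
    (∀ s < t, τ.arr a₃ (o₃ + s) = (((w₁ * x₁ + w₂ * x₂) / 2 ^ s % 2 : ℤ) : ℚ)) ∧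
    τ.var 26 = ((T t / 2 ^ t : ℤ) : ℚ) ∧
    ∀ i, i < o₃ ∨ o₃ + t ≤ i → τ.arr a₃ i = σ.arr a₃ i) (by simpa using h14) (by simpa using h5)
    (by omega) hΩ1 (by simp [Prog.wvars]) ?_ ?_) le_rfl ?_
  · simp [hT]
  · rintro t ht τ hτ hti ⟨hI1, hI2, hI3⟩
    simp only [Prog.wvars_for, Prog.warrs_for, Prog.wvars, Prog.warrs, Agree, List.nil_append,
      List.cons_append, List.append_nil, List.mem_cons, List.not_mem_nil, or_false] at hτ
    obtain ⟨hv, ha⟩ := hτ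
    have e4 : τ.var 4 = 0 := by rw [hv 4 (by simp)]; simpa using h4
    have e6 : τ.var 6 = 2 := by rw [hv 6 (by simp)]; simpa using h6
    have e20 : τ.var 20 = o₁ := by rw [hv 20 (by simp)]; simpa using h20
    have e21 : τ.var 21 = o₂ := by rw [hv 21 (by simp)]; simpa using h21
    have e22 : τ.var 22 = o₃ := by rw [hv 22 (by simp)]; simpa using h22
    have e23 : τ.var 23 = w₁ := by rw [hv 23 (by simp)]; simpa using h23
    have e24 : τ.var 24 = w₂ := by rw [hv 24 (by simp)]; simpa using h24
    -- The cells read in round `t` still have their original contents: either they are never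
    -- written, or the row is overwritten in place and only cells further left have changed.
    have cell : ∀ a o, NoClash a₃ o₃ a o K → τ.arr a (o + t) = σ.arr a (o + t) := by
      intro a o hc
      by_cases haa : a = a₃
      · subst haa
        refine hI3 _ ?_
        rcases hc with h | h | h | h
        · exact absurd rfl h
        all_goals omega
      · rw [ha a (by simpa using haa)]
        simp
    have c₁ : τ.arr a₁ (o₁ + t) = ((x₁ / 2 ^ t % 2 : ℤ) : ℚ) := by rw [cell a₁ o₁ hc₁, hx₁ t ht]
    have c₂ : τ.arr a₂ (o₂ + t) = ((x₂ / 2 ^ t % 2 : ℤ) : ℚ) := by rw [cell a₂ o₂ hc₂, hx₂ t ht]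
    set d₁ : ℤ := x₁ / 2 ^ t % 2 with hd₁
    set d₂ : ℤ := x₂ / 2 ^ t % 2 with hd₂
    have hd₁' : 0 ≤ d₁ ∧ d₁ ≤ 1 := by omega
    have hd₂' : 0 ≤ d₂ ∧ d₂ ≤ 1 := by omega
    have ad₁ : |w₁ * d₁| ≤ |w₁| := by
      rw [abs_mul, abs_of_nonneg hd₁'.1]
      nlinarith [abs_nonneg w₁]
    have ad₂ : |w₂ * d₂| ≤ |w₂| := by
      rw [abs_mul, abs_of_nonneg hd₂'.1]
      nlinarith [abs_nonneg w₂]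
    -- Both truncated operands lie in `[0, 2 ^ t)`, so `T t` is at most `(|w₁| + |w₂|) * 2 ^ t` in
    -- absolute value.
    have hcar : |T t / 2 ^ t| ≤ |w₁| + |w₂| := by
      have h2 : (0 : ℤ) < 2 ^ t := by positivity
      have hm₁ := Int.emod_nonneg x₁ h2.ne'
      have hm₁' := Int.emod_lt_of_pos x₁ h2
      have hm₂ := Int.emod_nonneg x₂ h2.ne'
      have hm₂' := Int.emod_lt_of_pos x₂ h2
      have l₁ := mul_le_mul_of_nonneg_right (le_abs_self w₁) hm₁
      have l₁' := mul_le_mul_of_nonneg_right (neg_abs_le w₁) hm₁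
      have l₂ := mul_le_mul_of_nonneg_right (le_abs_self w₂) hm₂
      have l₂' := mul_le_mul_of_nonneg_right (neg_abs_le w₂) hm₂
      have k₁ := mul_le_mul_of_nonneg_left hm₁'.le (abs_nonneg w₁)
      have k₂ := mul_le_mul_of_nonneg_left hm₂'.le (abs_nonneg w₂)
      rw [abs_le]
      constructor
      · rw [Int.le_ediv_iff_mul_le h2]
        simp only [hT]
        nlinarith
      · refine Int.ediv_le_of_le_mul h2 ?_
        simp only [hT]
        nlinarith
    set c : ℤ := T t / 2 ^ t with hc
    set s : ℤ := c + w₁ * d₁ + w₂ * d₂ with hs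
    have hsabs : |s| ≤ 2 * (|w₁| + |w₂|) := by
      have := abs_add_three c (w₁ * d₁) (w₂ * d₂)
      rw [hs]
      omega
    have hTs : T (t + 1) = T t + 2 ^ t * (w₁ * d₁ + w₂ * d₂) := by
      simp only [hT, hd₁, hd₂, emod_two_pow_succ]
      ring
    have hsT : s = T (t + 1) / 2 ^ t := by
      rw [hTs, Int.add_mul_ediv_left _ _ (by positivity : (2 : ℤ) ^ t ≠ 0), hs, hc]
      ring
    have hs2 : s / 2 = T (t + 1) / 2 ^ (t + 1) := by
      rw [hsT, pow_succ, Int.ediv_ediv_of_nonneg (by positivity)]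
    have hbit : s % 2 = (w₁ * x₁ + w₂ * x₂) / 2 ^ t % 2 := by
      -- The operand digits from `t + 1` on contribute a multiple of `2 ^ (t + 1)`, which does not
      -- affect digit `t`.
      have e : w₁ * x₁ + w₂ * x₂ =
          T (t + 1) + 2 ^ t * (2 * (w₁ * (x₁ / 2 ^ (t + 1)) + w₂ * (x₂ / 2 ^ (t + 1)))) := by
        have h1 := Int.emod_add_mul_ediv x₁ (2 ^ (t + 1))
        have h2 := Int.emod_add_mul_ediv x₂ (2 ^ (t + 1))
        have h5 : (2 : ℤ) ^ (t + 1) = 2 ^ t * 2 := pow_succ _ _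
        simp only [hT]
        linear_combination -w₁ * h1 - w₂ * h2 + (w₁ * (x₁ / 2 ^ (t + 1)) +
          w₂ * (x₂ / 2 ^ (t + 1))) * h5
      rw [e, Int.add_mul_ediv_left _ _ (by positivity : (2 : ℤ) ^ t ≠ 0), ← hsT]
      omega
    have hemod := Int.emod_add_mul_ediv s 2
    have ab₁ := abs_nonneg w₁
    have ab₂ := abs_nonneg w₂
    refine Run.seq (Run.binop ((o₁ + t : ℕ) : ℚ) (by simp [BinOp.eval, e20, hti])
      (fit_nat (by omega) hΩ1) ?_)
    refine Run.seq (Run.load (o₁ + t) d₁ (by simp) (by simpa using c₁)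
      (fit_int (by rw [abs_le]; omega) hΩ1) ?_)
    refine Run.seq (Run.binop ((w₁ * d₁ : ℤ) : ℚ) (by simp [BinOp.eval, e23])
      (fit_int (by omega) hΩ1) ?_)
    refine Run.seq (Run.binop ((c + w₁ * d₁ : ℤ) : ℚ) (by simp [BinOp.eval, hI2])
      (fit_int (by have := abs_add_le c (w₁ * d₁); omega) hΩ1) ?_)
    refine Run.seq (Run.binop ((o₂ + t : ℕ) : ℚ) (by simp [BinOp.eval, e21, hti])
      (fit_nat (by omega) hΩ1) ?_)
    refine Run.seq (Run.load (o₂ + t) d₂ (by simp) (by simpa using c₂)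
      (fit_int (by rw [abs_le]; omega) hΩ1) ?_)
    refine Run.seq (Run.binop ((w₂ * d₂ : ℤ) : ℚ) (by simp [BinOp.eval, e24])
      (fit_int (by omega) hΩ1) ?_)
    refine Run.seq (Run.binop ((s : ℤ) : ℚ) (by simp [BinOp.eval, hs])
      (fit_int (by omega) hΩ1) ?_)
    refine Run.seq (Run.binop ((s : ℤ) / 2 : ℚ) (by simp [BinOp.eval, e6])
      (fit_div (z := s) (d := 2) (by norm_num) (by simp) (by omega) (by omega)) ?_)
    have hhalf : |s / 2| ≤ Ω := by
      rw [abs_le] at hsabs ⊢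
      omega
    refine Run.seq (Run.unop ((s / 2 : ℤ) : ℚ) (by simp [UnOp.eval, floor_int_div_two])
      (fit_int hhalf hΩ1) ?_)
    have hdbl : |2 * (s / 2)| ≤ Ω := by
      rw [abs_le] at hsabs ⊢
      omega
    refine Run.seq (Run.binop ((2 * (s / 2) : ℤ) : ℚ) (by simp [BinOp.eval, e6])
      (fit_int hdbl hΩ1) ?_)
    refine Run.seq (Run.binop ((s % 2 : ℤ) : ℚ) ?_
      (fit_int (by rw [abs_le]; omega) hΩ1) ?_)
    · simp [BinOp.eval]
      rw [sub_eq_iff_eq_add]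
      have : ((s % 2 + 2 * (s / 2) : ℤ) : ℚ) = s := by rw [hemod]
      push_cast at this
      exact this.symm
    refine Run.seq (Run.binop ((s / 2 : ℤ) : ℚ) (by simp [BinOp.eval, e4]) (fit_int hhalf hΩ1) ?_)
    refine Run.seq (Run.binop ((o₃ + t : ℕ) : ℚ) (by simp [BinOp.eval, e22, hti])
      (fit_nat (by omega) hΩ1) ?_)
    refine Run.store (o₃ + t) ((s % 2 : ℤ) : ℚ) (by simp) (by simp)
      (fit_int (by rw [abs_le]; omega) hΩ1) ?_
    intro _
    refine ⟨?_, ?_, ?_⟩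
    · intro r hr
      rw [setVar_arr, setArr_apply]
      rcases Nat.lt_succ_iff_lt_or_eq.mp hr with h | rfl
      · rw [if_neg (by omega)]
        simpa using hI1 r h
      · simp [hbit]
    · simp [hs2]
    · intro i hi
      rw [setVar_arr, setArr_apply, if_neg (by omega)]
      simpa using hI3 i (by omega)
  · rintro τ _ ⟨h1, h2, h3⟩
    exact ⟨h1, h2, h3⟩


/-- The first binary digits of the number in the variable 30, divided by the number in the
variable 13, are written to the row at the offset in the variable 31 of the array `a`. -/
def digits (a : ℕ) : Prog :=
  .seq (.binop 30 .div 30 13) <|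
  .for 5 32 14 <|
  .seq (.binop 30 .mul 30 6) <|
  .seq (.unop 33 .floor 30) <|
  .seq (.binop 30 .sub 30 33) <|
  .seq (.binop 34 .add 31 14) <|
  .seq (.binop 34 .sub 34 32) <|
  .seq (.binop 34 .sub 34 5) <|
  .store a 34 33

theorem warrs_digits (a : ℕ) : (digits a).warrs = [a] := rfl

theorem floor_two_mul_sub (y : ℚ) : ⌊2 * Int.fract y⌋ = ⌊2 * y⌋ % 2 := by
  have h : (2 : ℚ) * Int.fract y = 2 * y - ((2 * ⌊y⌋ : ℤ) : ℚ) := by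
    rw [Int.fract]; push_cast; ring
  have h0 : 0 ≤ ⌊2 * Int.fract y⌋ := Int.floor_nonneg.2 (by have := Int.fract_nonneg y; linarith)
  have h1 : ⌊2 * Int.fract y⌋ < 2 := Int.floor_lt.2 (by have := Int.fract_lt_one y; push_cast; linarith)
  rw [h, Int.floor_sub_intCast] at *
  omega

theorem floor_ediv_two_pow (y : ℚ) (i : ℕ) : ⌊y⌋ / 2 ^ i = ⌊y / 2 ^ i⌋ := by
  exact_mod_cast (Int.floor_div_natCast y (2 ^ i)).symm

/-- Doubling a fractional part and rounding down yields the digits from the highest to the lowest.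
All the fractional parts are multiples of `1 / (v.den * X)`, so the denominators stay bounded during
the `K` rounds. -/
theorem run_digits {a : ℕ} {σ : State} {K o X : ℕ} {v : ℚ}
    (h5 : σ.var 5 = 1) (h6 : σ.var 6 = 2) (h13 : σ.var 13 = X) (h14 : σ.var 14 = K)
    (h30 : σ.var 30 = v) (h31 : σ.var 31 = o) (hX : 0 < X)
    (hv0 : 0 ≤ v) (hvX : v < X) (hden : 2 * (v.den * X) ≤ Ω) (ho : o + K ≤ Ω) :
    Run f Ω (digits a) σ (K * 9 + 3) (fun τ =>
      Rep (τ.arr a) o K ⌊v / X * 2 ^ K⌋ ∧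
      ∀ i, i < o ∨ o + K ≤ i → τ.arr a i = σ.arr a i) := by
  have hD : 0 < v.den * X := Nat.mul_pos v.den_pos hX
  have hΩ1 : 1 ≤ Ω := by omega
  set w : ℚ := v / X with hw
  set D : ℕ := v.den * X with hDd
  have hX' : (0 : ℚ) < X := by exact_mod_cast hX
  have hD' : (0 : ℚ) < D := by exact_mod_cast hD
  have hwD : w = (v.num : ℚ) / D := by
    rw [hw, hDd]
    push_cast
    rw [← div_div, Rat.num_div_den]
  have hw0 : 0 ≤ w := by positivity
  have hw1 : w < 1 := by rw [hw, div_lt_one hX']; exact hvX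
  have fitD : ∀ (q : ℚ) (z : ℤ), q = z / D → 0 ≤ q → q ≤ 2 → Fit Ω q := by
    intro q z hq h0 h1
    refine fit_div hD hq ?_ (by omega)
    rw [hq, le_div_iff₀ hD'] at h0
    rw [hq, div_le_iff₀ hD'] at h1
    have h0' : 0 ≤ z := by exact_mod_cast (by simpa using h0 : (0 : ℚ) ≤ z)
    have h1' : z ≤ 2 * D := by exact_mod_cast h1
    rw [abs_of_nonneg h0']
    have : ((2 * D : ℕ) : ℤ) ≤ Ω := by exact_mod_cast hden
    push_cast at this
    omega
  have hfr : ∀ t : ℕ, Int.fract (w * 2 ^ t) =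
      ((v.num * 2 ^ t - ⌊w * 2 ^ t⌋ * D : ℤ) : ℚ) / D := by
    intro t
    rw [Int.fract]
    push_cast
    conv_lhs => arg 1; rw [hwD]
    field_simp
  refine Run.seq (Run.binop w (by simp [BinOp.eval, h30, h13, hw])
    (fitD w v.num hwD hw0 (by linarith)) ?_)
  refine Run.mono (Run.for (t := 7) (M := K) (fun t τ =>
    τ.var 30 = Int.fract (w * 2 ^ t) ∧
    (∀ s < t, τ.arr a (o + (K - 1 - s)) = ((⌊w * 2 ^ (s + 1)⌋ % 2 : ℤ) : ℚ)) ∧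
    ∀ i, i < o + (K - t) ∨ o + K ≤ i → τ.arr a i = σ.arr a i) (by simpa using h14)
    (by simpa using h5) (by omega) hΩ1 (by simp [Prog.wvars]) ?_ ?_) le_rfl ?_
  · simp [Int.fract_eq_self.2 ⟨hw0, hw1⟩]
  · rintro t ht τ hτ hti ⟨hI1, hI2, hI3⟩
    simp only [Prog.wvars_for, Prog.warrs_for, Prog.wvars, Prog.warrs, Agree, List.nil_append,
      List.cons_append, List.append_nil, List.mem_cons, List.not_mem_nil, or_false] at hτ
    obtain ⟨hv, ha⟩ := hτ
    have e5 : τ.var 5 = 1 := by rw [hv 5 (by simp)]; simpa using h5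
    have e6 : τ.var 6 = 2 := by rw [hv 6 (by simp)]; simpa using h6
    have e14 : τ.var 14 = K := by rw [hv 14 (by simp)]; simpa using h14
    have e31 : τ.var 31 = o := by rw [hv 31 (by simp)]; simpa using h31
    set y : ℚ := w * 2 ^ t with hy
    have hy2 : 2 * y = w * 2 ^ (t + 1) := by rw [hy, pow_succ]; ring
    have hf0 := Int.fract_nonneg y
    have hf1 := Int.fract_lt_one y
    have hbit : ⌊2 * Int.fract y⌋ = ⌊w * 2 ^ (t + 1)⌋ % 2 := by rw [floor_two_mul_sub, hy2]
    have hnew : 2 * Int.fract y - ((⌊w * 2 ^ (t + 1)⌋ % 2 : ℤ) : ℚ) =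
        Int.fract (w * 2 ^ (t + 1)) := by
      rw [← hbit, ← Int.fract, ← hy2]
      rw [Int.fract_eq_fract]
      exact ⟨-(2 * ⌊y⌋), by rw [Int.fract]; push_cast; ring⟩
    refine Run.seq (Run.binop (2 * Int.fract y) (by simp [BinOp.eval, hI1, e6, mul_comm])
      (fitD _ (2 * (v.num * 2 ^ t - ⌊y⌋ * D)) ?_ (by linarith) (by linarith)) ?_)
    · rw [hy, hfr]
      push_cast
      ring
    refine Run.seq (Run.unop ((⌊w * 2 ^ (t + 1)⌋ % 2 : ℤ) : ℚ)
      (by simp only [UnOp.eval, setVar_var, if_true, hbit])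
      (fit_int (by rw [abs_le]; omega) hΩ1) ?_)
    refine Run.seq (Run.binop (Int.fract (w * 2 ^ (t + 1)))
      (by rw [← hnew]; simp [BinOp.eval])
      (fitD _ _ (hfr (t + 1)) (Int.fract_nonneg _) (by
        have := Int.fract_lt_one (w * 2 ^ (t + 1)); linarith)) ?_)
    refine Run.seq (Run.binop ((o + K : ℕ) : ℚ) (by simp [BinOp.eval, e31, e14])
      (fit_nat (by omega) hΩ1) ?_)
    refine Run.seq (Run.binop ((o + (K - t) : ℕ) : ℚ)
      (by simp [BinOp.eval, hti, Nat.cast_sub ht.le]; ring) (fit_nat (by omega) hΩ1) ?_)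
    refine Run.seq (Run.binop ((o + (K - 1 - t) : ℕ) : ℚ)
      (by
        have : K - t = K - 1 - t + 1 := by omega
        simp [BinOp.eval, e5, this]; ring) (fit_nat (by omega) hΩ1) ?_)
    refine Run.store (o + (K - 1 - t)) ((⌊w * 2 ^ (t + 1)⌋ % 2 : ℤ) : ℚ) (by simp) (by simp)
      (fit_int (by rw [abs_le]; omega) hΩ1) ?_
    intro _
    refine ⟨by simp, ?_, ?_⟩
    · intro r hr
      rw [setVar_arr, setArr_apply]
      rcases Nat.lt_succ_iff_lt_or_eq.mp hr with h | rfl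
      · rw [if_neg (by omega)]
        simpa using hI2 r h
      · simp
    · intro i hi
      rw [setVar_arr, setArr_apply, if_neg (by omega)]
      simpa using hI3 i (by omega)
  · rintro τ _ ⟨_, h2, h3⟩
    -- `Rep` counts digits from the lowest, the loop from the highest: cell `i` was written in round
    -- `K - 1 - i`.
    refine ⟨fun i hi => ?_, fun i hi => h3 i (by omega)⟩
    have := h2 (K - 1 - i) (by omega)
    rw [show K - 1 - (K - 1 - i) = i by omega, show K - 1 - i + 1 = K - i by omega] at this
    have hp : w * 2 ^ K / 2 ^ i = w * 2 ^ (K - i) := by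
      rw [div_eq_iff (by positivity), mul_assoc, ← pow_add, show K - i + i = K by omega]
    rw [this, floor_ediv_two_pow, hp]


/-- `lincomb` with arguments in the variables `r₁, r₂, r₃` (offsets) and `c₁, c₂` (coefficients). -/
def call (a₁ a₂ a₃ r₁ r₂ r₃ c₁ c₂ : ℕ) : Prog :=
  .seq (.binop 20 .add r₁ 4) <|
  .seq (.binop 21 .add r₂ 4) <|
  .seq (.binop 22 .add r₃ 4) <|
  .seq (.binop 23 .add c₁ 4) <|
  .seq (.binop 24 .add c₂ 4) <|
  lincomb a₁ a₂ a₃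

theorem run_call {a₁ a₂ a₃ r₁ r₂ r₃ c₁ c₂ : ℕ} {σ : State} {K : ℕ} {R : State → Prop}
    (o₁ o₂ o₃ : ℕ) (w₁ w₂ x₁ x₂ : ℤ)
    (hr : r₁ ∉ [20, 21, 22, 23, 24] ∧ r₂ ∉ [20, 21, 22, 23, 24] ∧ r₃ ∉ [20, 21, 22, 23, 24] ∧
      c₁ ∉ [20, 21, 22, 23, 24] ∧ c₂ ∉ [20, 21, 22, 23, 24])
    (h4 : σ.var 4 = 0) (h5 : σ.var 5 = 1) (h6 : σ.var 6 = 2) (h14 : σ.var 14 = K)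
    (h₁ : σ.var r₁ = o₁) (h₂ : σ.var r₂ = o₂) (h₃ : σ.var r₃ = o₃)
    (k₁ : σ.var c₁ = w₁) (k₂ : σ.var c₂ = w₂)
    (b₁ : o₁ + K ≤ Ω) (b₂ : o₂ + K ≤ Ω) (b₃ : o₃ + K ≤ Ω)
    (bw : 4 * (|w₁| + |w₂|) ≤ (Ω : ℤ)) (hΩ : 4 ≤ Ω)
    (hx₁ : Rep (σ.arr a₁) o₁ K x₁) (hx₂ : Rep (σ.arr a₂) o₂ K x₂)
    (hc₁ : NoClash a₃ o₃ a₁ o₁ K) (hc₂ : NoClash a₃ o₃ a₂ o₂ K)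
    (hR : ∀ τ, (∀ v, v ∉ [20, 21, 22, 23, 24, 25, 26, 27, 28] → τ.var v = σ.var v) →
      (∀ a, a ≠ a₃ → τ.arr a = σ.arr a) →
      (∀ i, i < o₃ ∨ o₃ + K ≤ i → τ.arr a₃ i = σ.arr a₃ i) →
      Rep (τ.arr a₃) o₃ K (w₁ * x₁ + w₂ * x₂) →
      τ.var 26 = (((w₁ * (x₁ % 2 ^ K) + w₂ * (x₂ % 2 ^ K)) / 2 ^ K : ℤ) : ℚ) → R τ) :
    Run f Ω (call a₁ a₂ a₃ r₁ r₂ r₃ c₁ c₂) σ (K * 17 + 8) R := by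
  have hΩ1 : 1 ≤ Ω := by omega
  simp only [List.mem_cons, List.not_mem_nil, or_false, not_or] at hr
  obtain ⟨hr₁, hr₂, hr₃, hc₁', hc₂'⟩ := hr
  have aw₁ := abs_nonneg w₁
  have aw₂ := abs_nonneg w₂
  refine Run.seq (Run.binop (o₁ : ℚ) (by simp [BinOp.eval, h₁, h4])
    (fit_nat (by omega) hΩ1) ?_)
  refine Run.seq (Run.binop (o₂ : ℚ) (by simp [BinOp.eval, h₂, h4, hr₂])
    (fit_nat (by omega) hΩ1) ?_)
  refine Run.seq (Run.binop (o₃ : ℚ) (by simp [BinOp.eval, h₃, h4, hr₃])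
    (fit_nat (by omega) hΩ1) ?_)
  refine Run.seq (Run.binop (w₁ : ℚ) (by simp [BinOp.eval, k₁, h4, hc₁'])
    (fit_int (by omega) hΩ1) ?_)
  refine Run.seq (Run.binop (w₂ : ℚ) (by simp [BinOp.eval, k₂, h4, hc₂'])
    (fit_int (by omega) hΩ1) ?_)
  refine Run.mono (run_lincomb (K := K) (o₁ := o₁) (o₂ := o₂) (o₃ := o₃) (w₁ := w₁) (w₂ := w₂)
    (x₁ := x₁) (x₂ := x₂) (by simpa using h4) (by simpa using h5) (by simpa using h6)
    (by simpa using h14) (by simp) (by simp) (by simp) (by simp) (by simp) b₁ b₂ b₃ bw hΩ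
    hx₁ hx₂ hc₁ hc₂) le_rfl ?_
  rintro τ ⟨hv, ha⟩ ⟨h1, h2, h3⟩
  refine hR τ ?_ ?_ h3 h1 h2
  · intro v hv'
    rw [hv v]
    · simp only [List.mem_cons, List.not_mem_nil, or_false, not_or] at hv'
      simp [hv']
    · rw [wvars_lincomb]
      simp only [List.mem_cons, List.not_mem_nil, or_false, not_or] at hv' ⊢
      simp [hv']
  · intro a haa
    rw [ha a (by simpa [warrs_lincomb] using haa)]
    rfl

/-! ### The fixed quantities of a run and their bounds. -/

/-- The quantities that stay fixed during the main part of the program. -/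
structure Params where
  (n u E m K X : ℕ)
  p : ℕ → ℕ

/-- The variables and the array that hold the fixed quantities. -/
structure Ctx (c : Params) (σ : State) : Prop where
  h0 : σ.var 0 = c.n
  h4 : σ.var 4 = 0
  h5 : σ.var 5 = 1
  h6 : σ.var 6 = 2
  h7 : σ.var 7 = c.E
  h8 : σ.var 8 = (c.E : ℚ) + 1
  h9 : σ.var 9 = -(c.E : ℚ)
  h10 : σ.var 10 = c.m
  h13 : σ.var 13 = c.X
  h14 : σ.var 14 = c.K
  hp : ∀ k ≤ c.m, σ.arr 0 k = c.p k

theorem Ctx.of_agree {c : Params} {vs as : List ℕ} {σ τ : State} (h : Ctx c σ)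
    (hA : Agree vs as σ τ) (hv : ∀ v ∈ [0, 4, 5, 6, 7, 8, 9, 10, 13, 14], v ∉ vs)
    (ha : 0 ∉ as) : Ctx c τ := by
  obtain ⟨h1, h2⟩ := hA
  constructor
  · rw [h1 _ (hv _ (by decide)), h.h0]
  · rw [h1 _ (hv _ (by decide)), h.h4]
  · rw [h1 _ (hv _ (by decide)), h.h5]
  · rw [h1 _ (hv _ (by decide)), h.h6]
  · rw [h1 _ (hv _ (by decide)), h.h7]
  · rw [h1 _ (hv _ (by decide)), h.h8]
  · rw [h1 _ (hv _ (by decide)), h.h9]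
  · rw [h1 _ (hv _ (by decide)), h.h10]
  · rw [h1 _ (hv _ (by decide)), h.h13]
  · rw [h1 _ (hv _ (by decide)), h.h14]
  · rw [h2 _ ha]
    exact h.hp

theorem Ctx.setVar {c : Params} {σ : State} (h : Ctx c σ) {d : ℕ} {q : ℚ}
    (hd : d ∉ [0, 4, 5, 6, 7, 8, 9, 10, 13, 14]) : Ctx c (σ.setVar d q) :=
  h.of_agree (Agree.setVar (vs := [d]) (as := []) q (by simp))
    (fun v hv => by simpa using fun h' : v = d => hd (h' ▸ hv)) (by simp)

/-- Bounds on the fixed quantities: `N` is the greatest number of pairs that are sorted at a time,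
and `R` is the greatest number of list entries. -/
structure Bounds (c : Params) (N R Ω : ℕ) : Prop where
  hN : (N + 1) * (c.K + 1) ≤ Ω
  hR : (R + 1) * (c.K + 1) ≤ Ω
  hm : (c.m + 1) * (c.K + 1) ≤ Ω
  hE : 4 * (2 * c.E + 1) ≤ Ω
  hu : 4 * (c.u + 2) ≤ Ω
  hn : c.n ≤ Ω
  E_pos : 0 < c.E
  m_pos : 0 < c.m
  p_lt : ∀ k < c.m, c.p k < c.p (k + 1)
  p_le : ∀ k ≤ c.m, c.p k ≤ c.u

theorem add_le_of_lt_of_mul_le {q R K Ω : ℕ} (hR : (R + 1) * (K + 1) ≤ Ω) (hq : q ≤ R) :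
    q * K + K ≤ Ω := by
  nlinarith [Nat.mul_le_mul_right K hq]

/-! ### Radix sort of rows. -/

/-- The first entries of the array `A` from the offset `o` on are the elements of the list `l`. -/
def IsList (A : ℕ → ℚ) (o : ℕ) (l : List ℕ) : Prop :=
  ∀ q (h : q < l.length), A (o + q) = ((l[q] : ℕ) : ℚ)

theorem IsList.congr {A A' : ℕ → ℚ} {o : ℕ} {l : List ℕ} (h : IsList A o l)
    (hA : ∀ i, o ≤ i → i < o + l.length → A' i = A i) : IsList A' o l := by
  intro q hq
  rw [hA _ (by omega) (by omega), h q hq]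

theorem IsList.append {A : ℕ → ℚ} {o : ℕ} {l l' : List ℕ} (h : IsList A o l)
    (h' : IsList A (o + l.length) l') : IsList A o (l ++ l') := by
  intro q hq
  rw [List.getElem_append]
  split_ifs with hql
  · exact h q hql
  · rw [← h' (q - l.length) (by simp at hq; omega)]
    congr 1
    omega

/-- One half of a radix sort pass: the elements `i` of the current order whose digit, in the
variable 46, passes the test `c` are appended to the new order. -/
def radixHalf (c : Test) : Prog :=
  .for 5 44 18 <|
  .seq (.binop 45 .add 42 44) <|
  .seq (.load 45 5 45) <|
  .seq (.binop 46 .mul 45 14) <|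
  .seq (.binop 46 .add 46 41) <|
  .seq (.load 46 4 46) <|
  .ite c (.seq (.store 5 43 45) (.binop 43 .add 43 5)) .skip

/-- Pass `t` reads the order from the segment of array 5 that begins at `t * N'` and writes to the
next segment, so reading and writing never interfere. The predicate `p` and `hT` let the same code
collect the pairs with digit 0 and those with digit 1. -/
theorem run_radixHalf {c : Params} {N R t o N' : ℕ} {σ : State} {T : Test} {l : List ℕ}
    {x : ℕ → ℤ} (p : ℕ → Bool) (hc : Ctx c σ) (hB : Bounds c N R Ω)
    (h18 : σ.var 18 = N') (hN' : N' ≤ N) (h41 : σ.var 41 = t) (ht : t < c.K)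
    (h42 : σ.var 42 = (t * N' : ℕ)) (h43 : σ.var 43 = o) (ho : (t + 1) * N' ≤ o)
    (ho' : o + (l.filter p).length ≤ (t + 2) * N')
    (hl : l.length = N') (hlN : ∀ i ∈ l, i < N')
    (hL : IsList (σ.arr 5) (t * N') l) (hx : ∀ i < N', Rep (σ.arr 4) (i * c.K) c.K (x i))
    (hT : ∀ τ, τ.var 5 = 1 → ∀ i, τ.var 46 = ((x i / 2 ^ t % 2 : ℤ) : ℚ) → (T.Holds τ ↔ p i)) :
    Run f Ω (radixHalf T) σ (N' * 10 + 2) (fun τ =>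
      IsList (τ.arr 5) o (l.filter p) ∧ τ.var 43 = (o + (l.filter p).length : ℕ) ∧
      ∀ i < o, τ.arr 5 i = σ.arr 5 i) := by
  have hΩ1 : 1 ≤ Ω := le_trans (by nlinarith) hB.hN
  have hNΩ : (N' + 1) * (c.K + 1) ≤ Ω :=
    le_trans (Nat.mul_le_mul_right _ (by omega)) hB.hN
  have htN : (t + 2) * N' ≤ Ω := le_trans (by nlinarith) hNΩ
  refine Run.mono (Run.for (t := 8) (M := N') (fun j τ =>
    IsList (τ.arr 5) o ((l.take j).filter p) ∧
    τ.var 43 = (o + ((l.take j).filter p).length : ℕ) ∧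
    ∀ i < o, τ.arr 5 i = σ.arr 5 i) h18 hc.h5
    (by nlinarith) hΩ1 (by simp [Prog.wvars]) ?_ ?_) le_rfl ?_
  · refine ⟨?_, ?_, ?_⟩
    · intro q hq
      simp at hq
    · simpa using h43
    · simp
  · rintro j hj τ hτ hjv ⟨hI1, hI2, hI3⟩
    replace hτ : Agree [44, 45, 45, 46, 46, 46, 43, 44] [5] σ τ := hτ
    have hcτ : Ctx c τ := hc.of_agree hτ (by decide) (by decide)
    have e41 : τ.var 41 = t := by rw [hτ.1 41 (by decide), h41]
    have e42 : τ.var 42 = (t * N' : ℕ) := by rw [hτ.1 42 (by decide), h42]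
    have e4 : τ.arr 4 = σ.arr 4 := hτ.2 4 (by decide)
    have hjl : j < l.length := by omega
    have hexp : (t + 2) * N' = t * N' + N' + N' := by ring
    have hexp' : (t + 1) * N' = t * N' + N' := by ring
    set i : ℕ := l[j] with hi
    have hiN : i < N' := hlN i (List.getElem_mem hjl)
    have hcell : τ.arr 5 (t * N' + j) = i := by
      rw [hI3 _ (by omega), hL j hjl]
    have hbit : τ.arr 4 (i * c.K + t) = ((x i / 2 ^ t % 2 : ℤ) : ℚ) := by
      rw [e4, hx i hiN t ht]
    have hiK : i * c.K + c.K ≤ Ω := add_le_of_lt_of_mul_le hNΩ hiN.le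
    have htake : l.take (j + 1) = l.take j ++ [i] := by
      rw [List.take_add_one, List.getElem?_eq_getElem hjl]
      simp [hi]
    have hlen : ((l.take (j + 1)).filter p).length ≤ (l.filter p).length :=
      ((List.take_sublist (j + 1) l).filter p).length_le
    set o' : ℕ := o + ((l.take j).filter p).length with ho'd
    refine Run.seq (Run.binop ((t * N' + j : ℕ) : ℚ) (by simp [BinOp.eval, e42, hjv])
      (fit_nat (by omega) hΩ1) ?_)
    refine Run.seq (Run.load (t * N' + j) i (by simp) (by simpa using hcell)
      (fit_nat (by omega) hΩ1) ?_)
    refine Run.seq (Run.binop ((i * c.K : ℕ) : ℚ) (by simp [BinOp.eval, hcτ.h14])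
      (fit_nat (by omega) hΩ1) ?_)
    refine Run.seq (Run.binop ((i * c.K + t : ℕ) : ℚ) (by simp [BinOp.eval, e41])
      (fit_nat (by omega) hΩ1) ?_)
    refine Run.seq (Run.load (i * c.K + t) ((x i / 2 ^ t % 2 : ℤ) : ℚ) (by simp)
      (by simpa using hbit) (fit_int (by rw [abs_le]; omega) hΩ1) ?_)
    refine Run.ite (t := 2) (fun hT' => ?_) (fun hT' => ?_)
    · rw [hT _ (by simpa using hcτ.h5) i (by simp)] at hT'
      have hfil : (l.take (j + 1)).filter p = (l.take j).filter p ++ [i] := by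
        rw [htake, List.filter_append, List.filter_singleton, hT']
        simp
      have hlen' : o' + 1 ≤ (t + 2) * N' := by
        rw [hfil, List.length_append, List.length_singleton] at hlen
        omega
      refine Run.seq (Run.store o' i (by simp [hI2]) (by simp) (fit_nat (by omega) hΩ1) ?_)
      refine Run.binop ((o' + 1 : ℕ) : ℚ) (by simp [BinOp.eval, hI2, hcτ.h5])
        (fit_nat (by omega) hΩ1) ?_
      intro _
      rw [hfil]
      refine ⟨IsList.append (hI1.congr fun r hr hr' => ?_) ?_, ?_, fun r hr => ?_⟩
      · rw [setVar_arr, setVar_arr, setArr_apply, if_neg (by omega)]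
        rfl
      · intro q hq
        simp only [List.length_singleton, Nat.lt_one_iff] at hq
        subst hq
        rw [setVar_arr, setVar_arr, setArr_apply, if_pos (by simp [ho'd])]
        simp
      · simp [ho'd]
        ring
      · rw [setVar_arr, setVar_arr, setArr_apply, if_neg (by omega)]
        exact hI3 r hr
    · rw [hT _ (by simpa using hcτ.h5) i (by simp)] at hT'
      have hfil : (l.take (j + 1)).filter p = (l.take j).filter p := by
        rw [htake, List.filter_append, List.filter_singleton]
        simp [hT']
      refine Run.skip ?_
      intro _
      rw [hfil]
      exact ⟨hI1, by simpa [ho'd] using hI2, hI3⟩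
  · rintro τ _ ⟨h1, h2, h3⟩
    rw [← hl, List.take_length] at h1 h2
    exact ⟨h1, h2, h3⟩


/-- Stability: filtering keeps the old order, so inside each half the order by the lower `t` digits
survives, while between the halves digit `t` decides. -/
theorem pairwise_radix {x : ℕ → ℤ} {t : ℕ} {l : List ℕ}
    (h : l.Pairwise fun i j => x i % 2 ^ t ≤ x j % 2 ^ t) :
    (l.filter (fun i => decide (x i / 2 ^ t % 2 < 1)) ++
      l.filter (fun i => decide (1 ≤ x i / 2 ^ t % 2))).Pairwise
      fun i j => x i % 2 ^ (t + 1) ≤ x j % 2 ^ (t + 1) := by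
  have h2 : (0 : ℤ) < 2 ^ t := by positivity
  rw [List.pairwise_append]
  refine ⟨?_, ?_, ?_⟩
  · rw [List.pairwise_filter]
    refine h.imp fun {i j} hij hi hj => ?_
    simp only [decide_eq_true_eq] at hi hj
    rw [emod_two_pow_succ, emod_two_pow_succ, show x i / 2 ^ t % 2 = 0 by omega,
      show x j / 2 ^ t % 2 = 0 by omega]
    simpa using hij
  · rw [List.pairwise_filter]
    refine h.imp fun {i j} hij hi hj => ?_
    simp only [decide_eq_true_eq] at hi hj
    rw [emod_two_pow_succ, emod_two_pow_succ, show x i / 2 ^ t % 2 = 1 by omega,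
      show x j / 2 ^ t % 2 = 1 by omega]
    simpa using hij
  · intro i hi j hj
    simp only [List.mem_filter, decide_eq_true_eq] at hi hj
    rw [emod_two_pow_succ, emod_two_pow_succ, show x i / 2 ^ t % 2 = 0 by omega,
      show x j / 2 ^ t % 2 = 1 by omega]
    have := Int.emod_lt_of_pos (x i) h2
    have := Int.emod_nonneg (x j) h2.ne'
    linarith

theorem perm_radix (x : ℕ → ℤ) (t : ℕ) (l : List ℕ) :
    (l.filter (fun i => decide (x i / 2 ^ t % 2 < 1)) ++
      l.filter (fun i => decide (1 ≤ x i / 2 ^ t % 2))).Perm l := by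
  have := List.filter_append_perm (fun i => decide (x i / 2 ^ t % 2 < 1)) l
  convert this using 3
  funext i
  by_cases h : x i / 2 ^ t % 2 < 1
  · simp [h]
  · simp [h, not_lt.mp h]

/-- The first `N` rows of the array 4, where `N` is in the variable 18, are sorted, the order being
written to the array 5. -/
def radixSort : Prog :=
  .for 5 41 14 <|
  .seq (.binop 42 .mul 41 18) <|
  .seq (.binop 43 .add 42 18) <|
  .seq (radixHalf (.lt 46 5)) (radixHalf (.le 5 46))

/-- After `t` passes the order is right for the lowest `t` digits. The cost is proportional to the
number of pairs times the row length, without the extra logarithm of a comparison sort. -/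
theorem run_radixSort {c : Params} {N R N' : ℕ} {σ : State} {x : ℕ → ℤ} (hc : Ctx c σ)
    (hB : Bounds c N R Ω) (h18 : σ.var 18 = N') (hN' : N' ≤ N)
    (hL : ∀ i < N', σ.arr 5 i = (i : ℚ)) (hx : ∀ i < N', Rep (σ.arr 4) (i * c.K) c.K (x i)) :
    Run f Ω radixSort σ (c.K * (N' * 20 + 8) + 2) (fun τ => ∃ l : List ℕ,
      l.Perm (List.range N') ∧ (l.Pairwise fun i j => x i % 2 ^ c.K ≤ x j % 2 ^ c.K) ∧
      IsList (τ.arr 5) (c.K * N') l) := by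
  have hΩ1 : 1 ≤ Ω := le_trans (by nlinarith) hB.hN
  have hNΩ : (N' + 1) * (c.K + 1) ≤ Ω :=
    le_trans (Nat.mul_le_mul_right _ (by omega)) hB.hN
  refine Run.mono (Run.for (t := N' * 20 + 6) (M := c.K) (fun t τ => ∃ l : List ℕ,
      l.Perm (List.range N') ∧ (l.Pairwise fun i j => x i % 2 ^ t ≤ x j % 2 ^ t) ∧
      IsList (τ.arr 5) (t * N') l) hc.h14 hc.h5
    (by nlinarith) hΩ1 (by decide) ?_ ?_) le_rfl (fun _ _ h => h)
  · refine ⟨List.range N', List.Perm.refl _, List.pairwise_iff_getElem.2 (by simp), fun q hq => ?_⟩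
    simp only [List.length_range] at hq
    simpa using hL q hq
  · rintro t ht τ hτ htv ⟨l, hl1, hl2, hl3⟩
    replace hτ : Agree [41, 42, 43, 44, 45, 45, 46, 46, 46, 43, 44, 44, 45, 45, 46, 46, 46, 43,
      44, 41] [5, 5] σ τ := hτ
    have hcτ : Ctx c τ := hc.of_agree hτ (by decide) (by decide)
    have e18 : τ.var 18 = N' := by rw [hτ.1 18 (by decide), h18]
    have hlen : l.length = N' := by simpa using hl1.length_eq
    have hmem : ∀ i ∈ l, i < N' := fun i hi => by simpa using hl1.mem_iff.1 hi
    have hexp : (t + 2) * N' = t * N' + N' + N' := by ring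
    have hexp' : (t + 1) * N' = t * N' + N' := by ring
    have htN : (t + 1) * N' ≤ Ω := le_trans (by nlinarith) hNΩ
    have hperm := perm_radix x t l
    have hplen := hperm.length_eq
    rw [List.length_append, hlen] at hplen
    set p₀ : ℕ → Bool := fun i => decide (x i / 2 ^ t % 2 < 1) with hp₀
    set p₁ : ℕ → Bool := fun i => decide (1 ≤ x i / 2 ^ t % 2) with hp₁
    refine Run.seq (Run.binop ((t * N' : ℕ) : ℚ) (by simp [BinOp.eval, htv, e18])
      (fit_nat (by omega) hΩ1) ?_)
    refine Run.seq (Run.binop (((t + 1) * N' : ℕ) : ℚ) (by simp [BinOp.eval, e18]; ring)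
      (fit_nat (by omega) hΩ1) ?_)
    refine Run.comp (run_radixHalf (c := c) (N := N) (R := R) (t := t) (o := (t + 1) * N')
      (N' := N') (l := l) (x := x) p₀ ((hcτ.setVar (by decide)).setVar (by decide)) hB
      (by simpa using e18) hN' (by simpa using htv) ht (by simp) (by simp) le_rfl (by omega) hlen
      hmem hl3 (fun i hi => ?_) ?_) ?_ (t := N' * 10 + 2) (by omega)
    · rw [setVar_arr, setVar_arr, hτ.2 4 (by decide)]
      exact hx i hi
    · intro ρ h5 i h46
      simp only [Test.Holds, h5, h46, hp₀, decide_eq_true_eq]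
      exact_mod_cast Iff.rfl
    rintro ρ hρ ⟨hρ1, hρ2, hρ3⟩
    replace hρ : Agree [44, 45, 45, 46, 46, 46, 43, 44] [5] _ ρ := hρ
    refine Run.mono (run_radixHalf (c := c) (N := N) (R := R) (t := t)
      (o := (t + 1) * N' + (l.filter p₀).length)
      (N' := N') (l := l) (x := x) p₁ (Ctx.of_agree ((hcτ.setVar (by decide)).setVar (by decide))
        hρ (by decide) (by decide)) hB
      (by rw [hρ.1 18 (by decide)]; simpa using e18) hN'
      (by rw [hρ.1 41 (by decide)]; simpa using htv) ht (by rw [hρ.1 42 (by decide)]; simp)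
      hρ2 (by omega) (by omega) hlen
      hmem (hl3.congr fun i hi hi' => ?_) (fun i hi => ?_) ?_) le_rfl ?_
    · rw [hρ3 i (by omega)]
      rfl
    · rw [hρ.2 4 (by decide), setVar_arr, setVar_arr, hτ.2 4 (by decide)]
      exact hx i hi
    · intro ρ h5 i h46
      simp only [Test.Holds, h5, h46, hp₁, decide_eq_true_eq]
      exact_mod_cast Iff.rfl
    rintro π _ ⟨hπ1, _, hπ3⟩ _
    refine ⟨_, hperm.trans hl1, pairwise_radix hl2, ?_⟩
    refine IsList.append (hρ1.congr fun i hi hi' => ?_) hπ1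
    exact hπ3 i (by omega)

/-! ### All sums of an entry value and a block value. -/

/-- The index in the variable 45 of a pair is split into the index of a list entry (variable 42)
and of a block (variable 43); the offsets of the row of the entry (variable 49) and of the row of
the pair (variable 46) are computed. -/
def splitThen (P : Prog) : Prog :=
  .seq (.binop 42 .div 45 10) <|
  .seq (.unop 42 .floor 42) <|
  .seq (.binop 43 .mul 42 10) <|
  .seq (.binop 43 .sub 45 43) <|
  .seq (.binop 49 .add 15 42) <|
  .seq (.binop 49 .mul 49 14) <|
  .seq (.binop 46 .mul 45 14) P

/-- Pair `i` stands for entry `i / m` and block `i % m`. The continuation `P` is a parameter because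
`pairSums` and `scan` share this prefix. -/
theorem run_splitThen {c : Params} {N R N' i s : ℕ} {σ : State} {P : Prog} {t : ℕ}
    {Q : State → Prop} (hc : Ctx c σ) (hB : Bounds c N R Ω) (h45 : σ.var 45 = i)
    (h15 : σ.var 15 = s) (hi : i < N') (hN' : N' ≤ N) (hs : s + i / c.m < R)
    (h : ∀ τ, Agree [42, 43, 46, 49] [] σ τ → τ.var 42 = (i / c.m : ℕ) →
      τ.var 43 = (i % c.m : ℕ) → τ.var 49 = ((s + i / c.m) * c.K : ℕ) →
      τ.var 46 = (i * c.K : ℕ) → Run f Ω P τ t Q) :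
    Run f Ω (splitThen P) σ (t + 7) Q := by
  have hm := hB.m_pos
  have hmΩ : c.m ≤ Ω := le_trans (by nlinarith) hB.hm
  have hΩ1 : 1 ≤ Ω := by omega
  have hNΩ : N ≤ Ω := le_trans (by nlinarith) hB.hN
  have hRΩ : R ≤ Ω := le_trans (by nlinarith) hB.hR
  have hdm := Nat.div_add_mod i c.m
  have hle := Nat.div_le_self i c.m
  have hmod := Nat.mod_le i c.m
  have hdm' : i / c.m * c.m ≤ i := Nat.div_mul_le_self i c.m
  have h1 := add_le_of_lt_of_mul_le hB.hR hs.le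
  have h2 := add_le_of_lt_of_mul_le hB.hN (hi.le.trans hN')
  refine Run.seq (Run.binop ((i : ℚ) / c.m) (by simp [BinOp.eval, h45, hc.h10])
    (fit_div (z := i) hm (by simp) (by rw [abs_of_nonneg (by omega)]; omega) hmΩ) ?_)
  refine Run.seq (Run.unop ((i / c.m : ℕ) : ℚ)
    (by
      simp only [UnOp.eval, setVar_var, if_true, Rat.floor_natCast_div_natCast]
      norm_cast) (fit_nat (by omega) hΩ1) ?_)
  refine Run.seq (Run.binop ((i / c.m * c.m : ℕ) : ℚ) (by simp [BinOp.eval, hc.h10])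
    (fit_nat (by omega) hΩ1) ?_)
  refine Run.seq (Run.binop ((i % c.m : ℕ) : ℚ) ?_ (fit_nat (by omega) hΩ1) ?_)
  · simp only [BinOp.eval, setVar_var]
    simp only [h45]
    norm_num
    rw [sub_eq_iff_eq_add, ← Nat.cast_mul, ← Nat.cast_add]
    congr 1
    rw [mul_comm] at hdm
    omega
  refine Run.seq (Run.binop ((s + i / c.m : ℕ) : ℚ) (by simp [BinOp.eval, h15])
    (fit_nat (by omega) hΩ1) ?_)
  refine Run.seq (Run.binop (((s + i / c.m) * c.K : ℕ) : ℚ) (by simp [BinOp.eval, hc.h14])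
    (fit_nat (by omega) hΩ1) ?_)
  refine Run.seq (Run.binop ((i * c.K : ℕ) : ℚ) (by simp [BinOp.eval, hc.h14, h45])
    (fit_nat (by omega) hΩ1) ?_)
  refine h _ ⟨fun v hv => ?_, fun _ _ => rfl⟩ (by simp) (by simp) (by simp) (by simp)
  simp only [List.mem_cons, List.not_mem_nil, or_false, not_or] at hv
  simp [hv]

/-- The sums of the values of all list entries with the values of all blocks are written to the
array 4, and the indices of the pairs to the array 5. -/
def pairSums : Prog :=
  .seq (.binop 18 .sub 16 15) <|
  .seq (.binop 18 .mul 18 10) <|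
  .for 5 41 18 <|
  .seq (.binop 45 .add 41 4) <|
  splitThen <|
  .seq (.binop 48 .mul 43 14) <|
  .seq (call 2 1 4 49 48 46 5 5) <|
  .store 5 41 41

theorem run_pairSums {c : Params} {N R s S : ℕ} {σ : State} {val y : ℕ → ℤ} (hc : Ctx c σ)
    (hB : Bounds c N R Ω) (h15 : σ.var 15 = s) (h16 : σ.var 16 = (s + S : ℕ))
    (hS : S * c.m ≤ N) (hR : s + S ≤ R)
    (hval : ∀ k < S, Rep (σ.arr 2) ((s + k) * c.K) c.K (val k))
    (hy : ∀ l < c.m, Rep (σ.arr 1) (l * c.K) c.K (y l)) :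
    Run f Ω pairSums σ (S * c.m * (c.K * 17 + 20) + 4) (fun τ =>
      τ.var 18 = (S * c.m : ℕ) ∧
      ∀ i < S * c.m, τ.arr 5 i = (i : ℚ) ∧
        Rep (τ.arr 4) (i * c.K) c.K (val (i / c.m) + y (i % c.m))) := by
  have hm := hB.m_pos
  have hΩu := hB.hu
  have hΩ1 : 1 ≤ Ω := by omega
  have hNΩ : N ≤ Ω := le_trans (by nlinarith) hB.hN
  have hRΩ : R ≤ Ω := le_trans (by nlinarith) hB.hR
  have hSm : S ≤ S * c.m := Nat.le_mul_of_pos_right S hm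
  refine Run.seq (Run.binop (S : ℚ) (by simp [BinOp.eval, h15, h16])
    (fit_nat (by omega) hΩ1) ?_)
  refine Run.seq (Run.binop ((S * c.m : ℕ) : ℚ) (by simp [BinOp.eval, hc.h10])
    (fit_nat (by omega) hΩ1) ?_)
  refine Run.mono (Run.for (t := c.K * 17 + 18) (M := S * c.m) (fun j τ =>
      ∀ i < j, τ.arr 5 i = (i : ℚ) ∧
        Rep (τ.arr 4) (i * c.K) c.K (val (i / c.m) + y (i % c.m))) (by simp)
    (by simpa using hc.h5) (by omega) hΩ1 (by decide) (by simp) ?_) le_rfl ?_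
  · rintro j hj τ hτ hjv hI
    replace hτ : Agree [41, 45, 42, 42, 43, 43, 49, 49, 46, 48, 20, 21, 22, 23, 24, 26, 25, 27, 27,
      27, 26, 27, 27, 27, 26, 27, 27, 28, 28, 26, 27, 25, 41] [4, 5] _ τ := hτ
    have hcτ : Ctx c τ := ((hc.setVar (by decide)).setVar (by decide)).of_agree hτ (by decide)
      (by decide)
    have hjm : j / c.m < S := Nat.div_lt_of_lt_mul (by rwa [mul_comm])
    have hjm' : j % c.m < c.m := Nat.mod_lt _ hm
    have hb := add_le_of_lt_of_mul_le hB.hm hjm'.le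
    refine Run.seq (Run.binop (j : ℚ) (by simp [BinOp.eval, hjv, hcτ.h4])
      (fit_nat (by omega) hΩ1) ?_)
    refine run_splitThen (c := c) (t := c.K * 17 + 10) (hcτ.setVar (by decide)) hB (by simp) (s := s)
      (by
        have := hτ.1 15 (by decide)
        simpa [this] using h15) hj hS (by omega) ?_
    intro ρ hρ _ h43 h49 h46
    have hcρ : Ctx c ρ := (hcτ.setVar (by decide)).of_agree hρ (by decide) (by decide)
    have e41 : ρ.var 41 = j := by
      rw [hρ.1 41 (by decide)]
      simpa using hjv
    refine Run.seq (Run.binop ((j % c.m * c.K : ℕ) : ℚ) (by simp [BinOp.eval, h43, hcρ.h14])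
      (fit_nat (by omega) hΩ1) ?_)
    refine Run.comp (s := c.K * 17 + 8) (t := 1)
      (run_call (K := c.K) ((s + j / c.m) * c.K) (j % c.m * c.K) (j * c.K) 1 1
      (val (j / c.m)) (y (j % c.m)) (by decide) (by simpa using hcρ.h4) (by simpa using hcρ.h5)
      (by simpa using hcρ.h6) (by simpa using hcρ.h14) (by simpa using h49) (by simp)
      (by simpa using h46) (by simpa using hcρ.h5) (by simpa using hcρ.h5)
      (add_le_of_lt_of_mul_le hB.hR (by omega)) hb (add_le_of_lt_of_mul_le hB.hN (by omega))
      (by norm_num; omega) (by omega) ?_ ?_ (Or.inl (by decide)) (Or.inl (by decide))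
      (R := fun π => (∀ i < j, π.arr 5 i = (i : ℚ)) ∧ π.var 41 = j ∧
        (∀ i < j + 1, Rep (π.arr 4) (i * c.K) c.K (val (i / c.m) + y (i % c.m)))) ?_) ?_ le_rfl
    · rw [setVar_arr, hρ.2 2 (by decide), setVar_arr, hτ.2 2 (by decide)]
      exact hval _ hjm
    · rw [setVar_arr, hρ.2 1 (by decide), setVar_arr, hτ.2 1 (by decide)]
      exact hy _ hjm'
    · intro π hπ1 hπ2 hπ3 hπ4 _
      refine ⟨fun i hi => ?_, ?_, fun i hi => ?_⟩
      · rw [hπ2 5 (by decide), setVar_arr, hρ.2 5 (by decide), setVar_arr]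
        exact (hI i hi).1
      · rw [hπ1 41 (by decide)]
        simpa using e41
      · rcases Nat.lt_succ_iff_lt_or_eq.mp hi with h | rfl
        · refine ((hI i h).2).congr fun q hq hq' => ?_
          have : i * c.K + c.K ≤ j * c.K := by nlinarith
          rw [hπ3 q (by omega), setVar_arr, hρ.2 4 (by decide), setVar_arr]
        · simpa using hπ4
    · rintro π _ ⟨hπ1, hπ2, hπ3⟩
      refine Run.store j j hπ2 hπ2 (fit_nat (by omega) hΩ1) ?_
      intro _ i hi
      refine ⟨?_, hπ3 i hi⟩
      rw [setVar_arr, setArr_apply]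
      rcases Nat.lt_succ_iff_lt_or_eq.mp hi with h | rfl
      · rw [if_neg (by omega)]
        exact hπ1 i h
      · simp
  · intro τ hτ h
    refine ⟨?_, h⟩
    rw [hτ.1 18 (by decide)]
    simp

end RatRAM

/-! ### Grouping a sorted list of weighted values. -/

open Finset in
/-- The total weight of the first `S` entries whose value is at most `c`. -/
def stepFun (S : ℕ) (val wt : ℕ → ℤ) (c : ℤ) : ℤ :=
  ∑ k ∈ range S, if val k ≤ c then wt k else 0

/-- The total weight of the elements of a list of pairs (value, weight) whose value is at most
`c`. -/
def listFun (L : List (ℤ × ℤ)) (c : ℤ) : ℤ :=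
  (L.map fun a => if a.1 ≤ c then a.2 else 0).sum

theorem listFun_append_singleton (L : List (ℤ × ℤ)) (v w c : ℤ) :
    listFun (L ++ [(v, w)]) c = listFun L c + if v ≤ c then w else 0 := by
  simp [listFun]

theorem listFun_eq_sum {L : List (ℤ × ℤ)} {c : ℤ} (h : ∀ a ∈ L, a.1 ≤ c) :
    listFun L c = (L.map Prod.snd).sum := by
  unfold listFun
  congr 1
  exact List.map_congr_left fun a ha => by simp [h a ha]

theorem stepFun_eq_sum {S : ℕ} {val wt : ℕ → ℤ} {c : ℤ} (h : ∀ k < S, val k ≤ c) :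
    stepFun S val wt c = ∑ k ∈ Finset.range S, wt k :=
  Finset.sum_congr rfl fun k hk => if_pos (h k (Finset.mem_range.1 hk))

theorem stepFun_succ_update {S : ℕ} {val wt : ℕ → ℤ} (v w c : ℤ) :
    stepFun (S + 1) (Function.update val S v) (Function.update wt S w) c =
      stepFun S val wt c + if v ≤ c then w else 0 := by
  unfold stepFun
  rw [Finset.sum_range_succ]
  simp only [Function.update_self]
  congr 1
  refine Finset.sum_congr rfl fun k hk => ?_
  have : k ≠ S := (Finset.mem_range.1 hk).ne
  simp [this]

theorem stepFun_update_last {S : ℕ} {val wt : ℕ → ℤ} (w c : ℤ) :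
    stepFun (S + 1) val (Function.update wt S (wt S + w)) c =
      stepFun (S + 1) val wt c + if val S ≤ c then w else 0 := by
  unfold stepFun
  rw [Finset.sum_range_succ, Finset.sum_range_succ]
  simp only [Function.update_self]
  rw [add_assoc]
  congr 1
  · refine Finset.sum_congr rfl fun k hk => ?_
    have : k ≠ S := (Finset.mem_range.1 hk).ne
    simp [this]
  · split_ifs <;> simp

/-- The result of grouping the elements of a list `L` of pairs (value, weight), sorted by value,
such that the accumulated weight grows within each group at most by the factor `1 + 1 / E`. The
group `k` has the value `val k` and the weight `wt k`, and `S` is the number of groups; `cum` is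
the accumulated weight, and `first` is its value right after the start of the last group. -/
structure Grouping (E : ℕ) (L : List (ℤ × ℤ)) (S : ℕ) (val wt : ℕ → ℤ) (cum first : ℤ) : Prop where
  cum_eq : cum = (L.map Prod.snd).sum
  wt_sum : ∑ k ∈ Finset.range S, wt k = cum
  wt_pos : ∀ k < S, 0 < wt k
  first_nonneg : 0 ≤ first
  first_le_cum : first ≤ cum
  first_zero : S = 0 → first = 0
  val_le : ∀ k < S, val k ≤ val (S - 1)
  val_mem : ∀ k < S, ∃ a ∈ L, val k = a.1
  lower : ∀ c, listFun L c ≤ stepFun S val wt c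
  upper : ∀ c, E * stepFun S val wt c ≤ (E + 1) * listFun L c
  first_le : 0 < S → ∀ c, val (S - 1) ≤ c → first ≤ listFun L c
  count : 0 < S → ((E : ℤ) + 1) ^ (S - 1) ≤ (E : ℤ) ^ (S - 1) * first

theorem Grouping.nil (E : ℕ) (val wt : ℕ → ℤ) : Grouping E [] 0 val wt 0 0 := by
  constructor <;> simp [listFun, stepFun]

/-- For `c ≥ v` both functions count everything and agree; for `c < v` the new pair counts in
neither. The test `hnew` supplies the growth by the factor `1 + 1 / E` that `count` accumulates. -/
theorem Grouping.new {E : ℕ} {L : List (ℤ × ℤ)} {S : ℕ} {val wt : ℕ → ℤ} {cum first v w : ℤ}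
    (h : Grouping E L S val wt cum first) (hL : ∀ a ∈ L, a.1 ≤ v) (hw : 0 < w)
    (hnew : (E + 1) * first < E * (cum + w)) :
    Grouping E (L ++ [(v, w)]) (S + 1) (Function.update val S v) (Function.update wt S w)
      (cum + w) (cum + w) := by
  have hcum : 0 ≤ cum := h.first_nonneg.trans h.first_le_cum
  have hv : ∀ k < S, val k ≤ v := fun k hk => by
    obtain ⟨a, ha, e⟩ := h.val_mem k hk
    rw [e]
    exact hL a ha
  constructor
  · simp [h.cum_eq]
  · rw [Finset.sum_range_succ, Function.update_self, ← h.wt_sum]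
    congr 1
    refine Finset.sum_congr rfl fun k hk => ?_
    have : k ≠ S := (Finset.mem_range.1 hk).ne
    simp [this]
  · intro k hk
    rcases Nat.lt_succ_iff_lt_or_eq.mp hk with hk | rfl
    · simpa [hk.ne] using h.wt_pos k hk
    · simpa using hw
  · omega
  · exact le_rfl
  · intro h
    omega
  · intro k hk
    rcases Nat.lt_succ_iff_lt_or_eq.mp hk with hk | rfl
    · simpa [hk.ne] using hv k hk
    · simp
  · intro k hk
    rcases Nat.lt_succ_iff_lt_or_eq.mp hk with hk | rfl
    · obtain ⟨a, ha, e⟩ := h.val_mem k hk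
      exact ⟨a, by simp [ha], by simpa [hk.ne] using e⟩
    · exact ⟨(v, w), by simp, by simp⟩
  · intro c
    rw [stepFun_succ_update, listFun_append_singleton]
    have := h.lower c
    omega
  · intro c
    rw [stepFun_succ_update, listFun_append_singleton]
    by_cases hvc : v ≤ c
    · rw [stepFun_eq_sum fun k hk => (hv k hk).trans hvc,
        listFun_eq_sum fun a ha => (hL a ha).trans hvc, h.wt_sum, ← h.cum_eq, if_pos hvc]
      nlinarith
    · rw [if_neg hvc]
      simpa using h.upper c
  · intro _ c hc
    simp only [Nat.add_sub_cancel, Function.update_self] at hc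
    rw [listFun_append_singleton, listFun_eq_sum fun a ha => (hL a ha).trans hc, ← h.cum_eq,
      if_pos hc]
  · intro _
    rcases Nat.eq_zero_or_pos S with rfl | hS
    · simp
      omega
    · have h1 := h.count hS
      rw [Nat.add_sub_cancel]
      obtain ⟨s, rfl⟩ : ∃ s, S = s + 1 := ⟨S - 1, by omega⟩
      rw [Nat.add_sub_cancel] at h1
      rw [pow_succ, pow_succ]
      calc ((E : ℤ) + 1) ^ s * (E + 1) ≤ (E : ℤ) ^ s * first * (E + 1) := by gcongr
        _ = (E : ℤ) ^ s * ((E + 1) * first) := by ring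
        _ ≤ (E : ℤ) ^ s * (E * (cum + w)) := by gcongr
        _ = _ := by ring

/-- The weight is booked at `val S ≤ v`, earlier than where it occurs, so the lower bound persists.
From `val S` on the step function equals `cum + w`, which by `hsame` is at most `(1 + 1 / E) *
first`, and the true function has already reached `first` there. Below `val S` the step function is
unchanged. -/
theorem Grouping.same {E : ℕ} {L : List (ℤ × ℤ)} {S : ℕ} {val wt : ℕ → ℤ} {cum first v w : ℤ}
    (h : Grouping E L (S + 1) val wt cum first) (hL : ∀ a ∈ L, a.1 ≤ v) (hw : 0 < w)
    (hsame : ¬ (E + 1) * first < E * (cum + w)) :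
    Grouping E (L ++ [(v, w)]) (S + 1) val (Function.update wt S (wt S + w))
      (cum + w) first := by
  have hcum : 0 ≤ cum := h.first_nonneg.trans h.first_le_cum
  have hv : ∀ k < S + 1, val k ≤ v := fun k hk => by
    obtain ⟨a, ha, e⟩ := h.val_mem k hk
    rw [e]
    exact hL a ha
  have hle : ∀ c, listFun L c ≤ listFun (L ++ [(v, w)]) c := fun c => by
    rw [listFun_append_singleton]
    split_ifs <;> omega
  constructor
  · simp [h.cum_eq]
  · rw [Finset.sum_range_succ, Function.update_self, ← h.wt_sum, Finset.sum_range_succ, add_assoc]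
    congr 1
    refine Finset.sum_congr rfl fun k hk => ?_
    have : k ≠ S := (Finset.mem_range.1 hk).ne
    simp [this]
  · intro k hk
    have := h.wt_pos k hk
    rcases Nat.lt_succ_iff_lt_or_eq.mp hk with hk | rfl
    · simpa [hk.ne] using this
    · simp only [Function.update_self]
      omega
  · exact h.first_nonneg
  · have := h.first_le_cum
    omega
  · exact h.first_zero
  · exact h.val_le
  · intro k hk
    obtain ⟨a, ha, e⟩ := h.val_mem k hk
    exact ⟨a, by simp [ha], e⟩
  · intro c
    rw [stepFun_update_last, listFun_append_singleton]
    have h1 := h.lower c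
    have h2 := hv S (by omega)
    split_ifs <;> omega
  · intro c
    rw [stepFun_update_last]
    by_cases hvc : val S ≤ c
    · rw [if_pos hvc, stepFun_eq_sum fun k hk => (h.val_le k hk).trans hvc, h.wt_sum]
      refine (not_lt.1 hsame).trans ?_
      have h1 := (h.first_le (by omega) c hvc).trans (hle c)
      nlinarith
    · rw [if_neg hvc]
      have := h.upper c
      have := hle c
      nlinarith
  · intro hS
    exact fun c hc => (h.first_le hS c hc).trans (hle c)
  · exact h.count

/-! ### The grouping on the machine. -/

namespace RatRAM
variable {n : ℕ} {f : Fin n → ℝ → ℝ} {Ω : ℕ}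

/-- The effect of a call that writes the binary digits of `V` to row `o` of the array `a`. -/
structure CallPost (a o K : ℕ) (V carry : ℤ) (σ τ : State) : Prop where
  var_eq : ∀ v, v ∉ [20, 21, 22, 23, 24, 25, 26, 27, 28] → τ.var v = σ.var v
  arr_eq : ∀ b, b ≠ a → τ.arr b = σ.arr b
  cell_eq : ∀ i, i < o ∨ o + K ≤ i → τ.arr a i = σ.arr a i
  rep : Rep (τ.arr a) o K V
  carry_eq : τ.var 26 = (carry : ℚ)

theorem CallPost.rep_other {a o K : ℕ} {V carry : ℤ} {σ τ : State}
    (h : CallPost a o K V carry σ τ) {a' o' : ℕ} {x : ℤ} (hx : Rep (σ.arr a') o' K x)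
    (hd : a' ≠ a ∨ o' + K ≤ o ∨ o + K ≤ o') : Rep (τ.arr a') o' K x := by
  by_cases haa : a' = a
  · subst haa
    refine hx.congr fun i hi hi' => h.cell_eq i ?_
    rcases hd with h | h | h
    · exact absurd rfl h
    all_goals omega
  · rw [h.arr_eq a' haa]
    exact hx

theorem CallPost.ctx {a o K : ℕ} {V carry : ℤ} {σ τ : State} {c : Params}
    (h : CallPost a o K V carry σ τ) (hc : Ctx c σ) (ha : a ≠ 0) : Ctx c τ :=
  hc.of_agree (vs := [20, 21, 22, 23, 24, 25, 26, 27, 28]) (as := [a])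
    ⟨h.var_eq, fun b hb => h.arr_eq b (by simpa using hb)⟩ (by decide) (by simpa using ha.symm)

theorem run_call_ctx {a₁ a₂ a₃ r₁ r₂ r₃ c₁ c₂ : ℕ} {σ : State} {c : Params} {N R : ℕ}
    (hc : Ctx c σ) (hB : Bounds c N R Ω)
    (o₁ o₂ o₃ : ℕ) (w₁ w₂ x₁ x₂ : ℤ)
    (hr : r₁ ∉ [20, 21, 22, 23, 24] ∧ r₂ ∉ [20, 21, 22, 23, 24] ∧ r₃ ∉ [20, 21, 22, 23, 24] ∧
      c₁ ∉ [20, 21, 22, 23, 24] ∧ c₂ ∉ [20, 21, 22, 23, 24])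
    (h₁ : σ.var r₁ = o₁) (h₂ : σ.var r₂ = o₂) (h₃ : σ.var r₃ = o₃)
    (k₁ : σ.var c₁ = w₁) (k₂ : σ.var c₂ = w₂)
    (b₁ : o₁ + c.K ≤ Ω) (b₂ : o₂ + c.K ≤ Ω) (b₃ : o₃ + c.K ≤ Ω)
    (bw : 4 * (|w₁| + |w₂|) ≤ (Ω : ℤ))
    (hx₁ : Rep (σ.arr a₁) o₁ c.K x₁) (hx₂ : Rep (σ.arr a₂) o₂ c.K x₂)
    (hc₁ : NoClash a₃ o₃ a₁ o₁ c.K) (hc₂ : NoClash a₃ o₃ a₂ o₂ c.K) :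
    Run f Ω (call a₁ a₂ a₃ r₁ r₂ r₃ c₁ c₂) σ (c.K * 17 + 8) (CallPost a₃ o₃ c.K
      (w₁ * x₁ + w₂ * x₂) ((w₁ * (x₁ % 2 ^ c.K) + w₂ * (x₂ % 2 ^ c.K)) / 2 ^ c.K) σ) :=
  run_call o₁ o₂ o₃ w₁ w₂ x₁ x₂ hr hc.h4 hc.h5 hc.h6 hc.h14 h₁ h₂ h₃ k₁ k₂ b₁ b₂ b₃ bw
    (by have := hB.hu; omega) hx₁ hx₂ hc₁ hc₂ fun _ h1 h2 h3 h4 h5 => ⟨h1, h2, h3, h4, h5⟩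

/-- A new group is started: its value is the one of the pair whose row is at the offset in the
variable 46, its weight is zero. -/
def newGroup : Prog :=
  .seq (.binop 50 .mul 17 14) <|
  .seq (call 4 4 2 46 46 50 5 4) <|
  .seq (call 4 4 3 46 46 50 4 4) <|
  .seq (call 6 6 7 4 4 4 5 4) <|
  .binop 17 .add 17 5

/-- One pair of the sorted order is processed. -/
def scanItem : Prog :=
  .seq (.binop 48 .add 43 5) <|
  .seq (.load 48 0 48) <|
  .seq (.load 43 0 43) <|
  .seq (.binop 48 .sub 48 43) <|
  .seq (call 6 3 6 4 49 4 5 48) <|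
  .seq (call 7 6 8 4 4 4 8 9) <|
  .seq (.ite (.lt 26 4) newGroup .skip) <|
  .seq (.binop 50 .sub 17 5) <|
  .seq (.binop 50 .mul 50 14) <|
  call 3 3 3 50 49 50 5 48

/-- The rows of the array `a` from row `s` on hold the numbers `x 0, …, x (S - 1)`. -/
def Rows (A : ℕ → ℚ) (s K S : ℕ) (x : ℕ → ℤ) : Prop :=
  ∀ k < S, Rep A ((s + k) * K) K (x k)

/-- The memory while a sorted list is being grouped: `L` is the part processed so far. -/
structure ScanInv (c : Params) (L : List (ℤ × ℤ)) (s S : ℕ) (val wt : ℕ → ℤ) (cum first : ℤ)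
    (σ₀ σ : State) : Prop where
  grp : Grouping c.E L S val wt cum first
  h17 : σ.var 17 = (s + S : ℕ)
  hval : Rows (σ.arr 2) s c.K S val
  hwt : Rows (σ.arr 3) s c.K S wt
  hcum : Rep (σ.arr 6) 0 c.K cum
  hfirst : Rep (σ.arr 7) 0 c.K first
  hold : ∀ i < s * c.K, σ.arr 2 i = σ₀.arr 2 i ∧ σ.arr 3 i = σ₀.arr 3 i

theorem mul_add_le_mul_of_lt {a b K : ℕ} (h : a < b) : a * K + K ≤ b * K := by
  nlinarith [Nat.mul_le_mul_right K (Nat.succ_le_of_lt h)]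

theorem Rows.update_last {A A' : ℕ → ℚ} {s K S : ℕ} {x : ℕ → ℤ} {y : ℤ} (h : Rows A s K S x)
    (hA : ∀ i < (s + S) * K, A' i = A i) (hy : Rep A' ((s + S) * K) K y) :
    Rows A' s K (S + 1) (Function.update x S y) := by
  intro k hk
  rcases Nat.lt_succ_iff_lt_or_eq.mp hk with hk | rfl
  · rw [Function.update_of_ne hk.ne]
    refine (h k hk).congr fun i hi hi' => hA i ?_
    have := mul_add_le_mul_of_lt (K := K) (show s + k < s + S by omega)
    omega
  · rwa [Function.update_self]

/-- Rows are copied or cleared by linear combinations with coefficients 1 and 0. Here `cum` already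
includes the current pair. Its weight is added to the zero row only afterwards, by code shared with
the case in which no group starts. -/
theorem run_newGroup {c : Params} {N R s S o : ℕ} {σ : State} {val wt : ℕ → ℤ} {cum x : ℤ}
    (hc : Ctx c σ) (hB : Bounds c N R Ω) (h17 : σ.var 17 = (s + S : ℕ)) (hsS : s + S < R)
    (h46 : σ.var 46 = o) (ho : o + c.K ≤ Ω) (hx : Rep (σ.arr 4) o c.K x)
    (hval : Rows (σ.arr 2) s c.K S val) (hwt : Rows (σ.arr 3) s c.K S wt)
    (hcum : Rep (σ.arr 6) 0 c.K cum) :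
    Run f Ω newGroup σ (c.K * 51 + 26) (fun τ => τ.var 17 = (s + (S + 1) : ℕ) ∧
      Rows (τ.arr 2) s c.K (S + 1) (Function.update val S x) ∧
      Rows (τ.arr 3) s c.K (S + 1) (Function.update wt S 0) ∧ Rep (τ.arr 7) 0 c.K cum ∧
      ∀ i < s * c.K, τ.arr 2 i = σ.arr 2 i ∧ τ.arr 3 i = σ.arr 3 i) := by
  have hΩu := hB.hu
  have hΩ1 : 1 ≤ Ω := by omega
  have hb := add_le_of_lt_of_mul_le hB.hR hsS.le
  have hKΩ : c.K ≤ Ω := by omega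
  have hRΩ : R ≤ Ω := le_trans (by nlinarith) hB.hR
  have hsK : s * c.K ≤ (s + S) * c.K := Nat.mul_le_mul_right _ (by omega)
  refine Run.seq (Run.binop (((s + S) * c.K : ℕ) : ℚ) (by simp [BinOp.eval, h17, hc.h14])
    (fit_nat (by omega) hΩ1) ?_)
  have hc0 : Ctx c (σ.setVar 50 (((s + S) * c.K : ℕ) : ℚ)) := hc.setVar (by decide)
  refine Run.comp (run_call_ctx hc0 hB o o ((s + S) * c.K) 1 0 x x (by decide)
    (by simpa using h46) (by simpa using h46) (by simp) (by simpa using hc0.h5)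
    (by simpa using hc0.h4) ho ho hb (by norm_num; omega) hx hx (Or.inl (by decide))
    (Or.inl (by decide))) ?_ (t := c.K * 34 + 17) (by omega)
  intro σ₁ _ p₁
  have hc1 := p₁.ctx hc0 (by decide)
  have h46₁ : σ₁.var 46 = o := by rw [p₁.var_eq 46 (by decide)]; simpa using h46
  have h50₁ : σ₁.var 50 = ((s + S) * c.K : ℕ) := by rw [p₁.var_eq 50 (by decide)]; simp
  have hx₁ : Rep (σ₁.arr 4) o c.K x := p₁.rep_other hx (Or.inl (by decide))
  refine Run.comp (run_call_ctx hc1 hB o o ((s + S) * c.K) 0 0 x x (by decide)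
    h46₁ h46₁ h50₁ (by simpa using hc1.h4)
    (by simpa using hc1.h4) ho ho hb (by norm_num) hx₁ hx₁ (Or.inl (by decide))
    (Or.inl (by decide))) ?_ (t := c.K * 17 + 9) (by omega)
  intro σ₂ _ p₂
  have hc2 := p₂.ctx hc1 (by decide)
  have hcum₂ : Rep (σ₂.arr 6) 0 c.K cum :=
    p₂.rep_other (p₁.rep_other hcum (Or.inl (by decide))) (Or.inl (by decide))
  refine Run.comp (run_call_ctx hc2 hB 0 0 0 1 0 cum cum (by decide)
    (by simpa using hc2.h4) (by simpa using hc2.h4) (by simpa using hc2.h4) (by simpa using hc2.h5)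
    (by simpa using hc2.h4) (by omega) (by omega) (by omega) (by norm_num; omega) hcum₂ hcum₂
    (Or.inl (by decide)) (Or.inl (by decide))) ?_ (t := 1) (by omega)
  intro σ₃ _ p₃
  have hc3 := p₃.ctx hc2 (by decide)
  have h17₃ : σ₃.var 17 = (s + S : ℕ) := by
    rw [p₃.var_eq 17 (by decide), p₂.var_eq 17 (by decide), p₁.var_eq 17 (by decide)]
    simpa using h17
  have e2 : σ₃.arr 2 = σ₁.arr 2 := by rw [p₃.arr_eq 2 (by decide), p₂.arr_eq 2 (by decide)]
  have e3 : σ₃.arr 3 = σ₂.arr 3 := p₃.arr_eq 3 (by decide)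
  have e2' : ∀ i < (s + S) * c.K, σ₃.arr 2 i = σ.arr 2 i := fun i hi => by
    rw [e2, p₁.cell_eq i (by omega)]
    rfl
  have e3' : ∀ i < (s + S) * c.K, σ₃.arr 3 i = σ.arr 3 i := fun i hi => by
    rw [e3, p₂.cell_eq i (by omega), p₁.arr_eq 3 (by decide)]
    rfl
  refine Run.binop ((s + (S + 1) : ℕ) : ℚ) ?_ (fit_nat (by omega) hΩ1)
    ⟨by simp, ?_, ?_, ?_, fun i hi => ⟨e2' i (by omega), e3' i (by omega)⟩⟩
  · simp [BinOp.eval, h17₃, hc3.h5]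
    ring
  · refine hval.update_last e2' ?_
    rw [setVar_arr, e2]
    simpa using p₁.rep
  · refine hwt.update_last e3' ?_
    rw [setVar_arr, e3]
    simpa using p₂.rep
  · simpa using p₃.rep

theorem ediv_two_pow_neg_iff (z : ℤ) (K : ℕ) : z / 2 ^ K < 0 ↔ z < 0 := by
  rw [Int.ediv_lt_iff_lt_mul (by positivity)]
  simp

/-- The comparison of `(E + 1) * first` with `E * cum` is the sign of the carry of a call whose
digits go to the scratch array 8. By `hcum` the operands fit in `K` digits, so truncation does not
falsify it. `hS'` caps the number of groups, so that a row for a new group exists before it is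
written. -/
theorem run_scanItem {c : Params} {N R s S S' i l ow : ℕ} {σ₀ σ : State} {L : List (ℤ × ℤ)}
    {val wt : ℕ → ℤ} {cum first x v : ℤ} (hc : Ctx c σ) (hB : Bounds c N R Ω)
    (hI : ScanInv c L s S val wt cum first σ₀ σ)
    (h43 : σ.var 43 = l) (h46 : σ.var 46 = (i * c.K : ℕ)) (h49 : σ.var 49 = ow)
    (hl : l < c.m) (hi : i ≤ N) (how : ow + c.K ≤ s * c.K) (hsS : s + S' ≤ R)
    (hx : Rep (σ.arr 4) (i * c.K) c.K x) (hv : Rep (σ.arr 3) ow c.K v) (hv0 : 0 < v)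
    (hL : ∀ a ∈ L, a.1 ≤ x) (hcum : cum + v * ((c.p (l + 1) : ℤ) - c.p l) < 2 ^ c.K)
    (hS' : ∀ S : ℕ, ((c.E : ℤ) + 1) ^ (S - 1) ≤
      (c.E : ℤ) ^ (S - 1) * (cum + v * ((c.p (l + 1) : ℤ) - c.p l)) → S ≤ S') :
    Run f Ω scanItem σ (c.K * 102 + 60) (fun τ => ∃ S val wt cum first,
      ScanInv c (L ++ [(x, v * ((c.p (l + 1) : ℤ) - c.p l))]) s S val wt cum first σ₀ τ) := by
  have hΩu := hB.hu
  have hΩE := hB.hE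
  have hΩ1 : 1 ≤ Ω := by omega
  have hRΩ : R ≤ Ω := le_trans (by nlinarith) hB.hR
  have hmΩ : c.m + 1 ≤ Ω := le_trans (by nlinarith) hB.hm
  have hKΩ : c.K ≤ Ω := le_trans (by nlinarith) hB.hR
  have hiK := add_le_of_lt_of_mul_le hB.hN hi
  have hsKΩ : s * c.K + c.K ≤ Ω := add_le_of_lt_of_mul_le hB.hR (by omega)
  have hp1 := hB.p_lt l hl
  have hp2 := hB.p_le (l + 1) hl
  set d : ℤ := (c.p (l + 1) : ℤ) - c.p l with hd
  have hd0 : 0 < d := by omega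
  have hdu : d ≤ c.u := by omega
  set w : ℤ := v * d with hw
  have hw0 : 0 < w := mul_pos hv0 hd0
  have hcum0 : 0 ≤ cum := hI.grp.first_nonneg.trans hI.grp.first_le_cum
  have hfirst := hI.grp.first_le_cum
  refine Run.seq (Run.binop ((l + 1 : ℕ) : ℚ) (by simp [BinOp.eval, h43, hc.h5])
    (fit_nat (by omega) hΩ1) ?_)
  refine Run.seq (Run.load (l + 1) (c.p (l + 1)) (by simp) (by simpa using hc.hp (l + 1) hl)
    (fit_nat (by omega) hΩ1) ?_)
  refine Run.seq (Run.load l (c.p l) (by simpa using h43) (by simpa using hc.hp l hl.le)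
    (fit_nat (by omega) hΩ1) ?_)
  refine Run.seq (Run.binop (d : ℚ) (by simp [BinOp.eval, hd])
    (fit_int (by rw [abs_le]; omega) hΩ1) ?_)
  set σ' := (((σ.setVar 48 ((l + 1 : ℕ) : ℚ)).setVar 48 (c.p (l + 1))).setVar 43
    (c.p l)).setVar 48 (d : ℚ) with hσ'
  have hc' : Ctx c σ' := (((hc.setVar (by decide)).setVar (by decide)).setVar (by decide)).setVar
    (by decide)
  have a' : σ'.arr = σ.arr := rfl
  -- the accumulated weight
  refine Run.comp (run_call_ctx hc' hB 0 ow 0 1 d cum v (by decide)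
    (by simpa using hc'.h4) (by simpa [hσ'] using h49) (by simpa using hc'.h4)
    (by simpa using hc'.h5) (by simp [hσ']) (by omega) (by omega) (by omega)
    (by rw [abs_of_pos hd0]; norm_num; omega) hI.hcum hv
    (Or.inr (Or.inl rfl)) (Or.inl (by decide))) ?_ (t := c.K * 85 + 48) (by omega)
  intro σ₁ _ p₁
  have hc1 := p₁.ctx hc' (by decide)
  have hcum₁ : Rep (σ₁.arr 6) 0 c.K (cum + w) := by
    have := p₁.rep
    rwa [one_mul, mul_comm d v] at this
  -- the comparison
  refine Run.comp (run_call_ctx hc1 hB 0 0 0 (c.E + 1) (-c.E) first (cum + w) (by decide)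
    (by simpa using hc1.h4) (by simpa using hc1.h4) (by simpa using hc1.h4)
    (by simpa using hc1.h8) (by simpa using hc1.h9) (by omega) (by omega) (by omega)
    (by rw [abs_neg, abs_of_nonneg (by omega), abs_of_nonneg (by omega)]; omega)
    (p₁.rep_other hI.hfirst (Or.inl (by decide))) hcum₁
    (Or.inl (by decide)) (Or.inl (by decide))) ?_ (t := c.K * 68 + 40) (by omega)
  intro σ₂ _ p₂
  have hc2 := p₂.ctx hc1 (by decide)
  have hcarry := p₂.carry_eq
  rw [Int.emod_eq_of_lt hI.grp.first_nonneg (by omega),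
    Int.emod_eq_of_lt (show 0 ≤ cum + w by omega) hcum] at hcarry
  have hv₂ : ∀ q, q ∉ [20, 21, 22, 23, 24, 25, 26, 27, 28] → σ₂.var q = σ'.var q :=
    fun q hq => by rw [p₂.var_eq q hq, p₁.var_eq q hq]
  have ha₂ : ∀ b, b ≠ 6 → b ≠ 8 → σ₂.arr b = σ.arr b :=
    fun b h6 h8 => by rw [p₂.arr_eq b h8, p₁.arr_eq b h6, a']
  have h17₂ : σ₂.var 17 = (s + S : ℕ) := by
    rw [hv₂ 17 (by decide)]
    simpa [hσ'] using hI.h17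
  have hcum₂ : Rep (σ₂.arr 6) 0 c.K (cum + w) := p₂.rep_other hcum₁ (Or.inl (by decide))
  -- the possible start of a new group
  refine Run.comp (s := c.K * 51 + 27) (Q := fun τ => ∃ T val' wt' first',
    Grouping c.E (L ++ [(x, w)]) (T + 1) val' (Function.update wt' T (wt' T + w)) (cum + w) first' ∧
    τ.var 17 = (s + (T + 1) : ℕ) ∧ Rows (τ.arr 2) s c.K (T + 1) val' ∧
    Rows (τ.arr 3) s c.K (T + 1) wt' ∧ Rep (τ.arr 7) 0 c.K first' ∧
    ∀ i < s * c.K, τ.arr 2 i = σ₂.arr 2 i ∧ τ.arr 3 i = σ₂.arr 3 i)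
    (Run.ite (t := c.K * 51 + 26) (fun hT => ?_) (fun hT => ?_)) ?_ (t := c.K * 17 + 10) (by omega)
  · have hnew : ((c.E : ℤ) + 1) * first < c.E * (cum + w) := by
      have h1 : σ₂.var 26 < σ₂.var 4 := hT
      rw [hcarry, hc2.h4] at h1
      have h2 : (((c.E : ℤ) + 1) * first + -c.E * (cum + w)) / 2 ^ c.K < 0 := by exact_mod_cast h1
      rw [ediv_two_pow_neg_iff] at h2
      linarith
    have hG := hI.grp.new hL hw0 hnew
    have hSS : S + 1 ≤ S' := hS' (S + 1) (hG.count (by omega))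
    refine Run.mono (run_newGroup (x := x) (val := val) (wt := wt) (cum := cum + w) (s := s) (S := S)
      (o := i * c.K) hc2 hB h17₂ (by omega) ?_ hiK ?_ ?_ ?_ hcum₂) le_rfl ?_
    · rw [hv₂ 46 (by decide)]
      simpa [hσ'] using h46
    · rwa [ha₂ 4 (by decide) (by decide)]
    · rw [ha₂ 2 (by decide) (by decide)]
      exact hI.hval
    · rw [ha₂ 3 (by decide) (by decide)]
      exact hI.hwt
    · rintro τ _ ⟨q1, q2, q3, q4, q5⟩
      -- The fresh group has weight 0, so adding `w` in the common continuation gives the weight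
      -- demanded by `hG`.
      refine ⟨S, _, _, _, ?_, q1, q2, q3, q4, q5⟩
      simpa using hG
  · have hsame : ¬ ((c.E : ℤ) + 1) * first < c.E * (cum + w) := by
      intro h
      apply hT
      show σ₂.var 26 < σ₂.var 4
      rw [hcarry, hc2.h4]
      have h2 : (((c.E : ℤ) + 1) * first + -c.E * (cum + w)) / 2 ^ c.K < 0 := by
        rw [ediv_two_pow_neg_iff]
        linarith
      exact_mod_cast h2
    -- As long as there is no group, `first = cum = 0` and the test holds because `0 < E * w`; so a
    -- last group exists in this branch.
    have hS0 : S ≠ 0 := by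
      rintro rfl
      have h0 := hI.grp.first_zero rfl
      have h1 : cum = 0 := by simpa using hI.grp.wt_sum.symm
      rw [h0, h1] at hsame
      have : (0 : ℤ) < c.E := by exact_mod_cast hB.E_pos
      exact hsame (by nlinarith)
    obtain ⟨T, rfl⟩ := Nat.exists_eq_succ_of_ne_zero hS0
    refine Run.skip ⟨T, val, wt, first, hI.grp.same hL hw0 hsame, h17₂, ?_, ?_, ?_,
      fun _ _ => ⟨rfl, rfl⟩⟩
    · rw [ha₂ 2 (by decide) (by decide)]
      exact hI.hval
    · rw [ha₂ 3 (by decide) (by decide)]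
      exact hI.hwt
    · rw [ha₂ 7 (by decide) (by decide)]
      exact hI.hfirst
  -- the weight of the last group
  rintro σ₃ f₃ ⟨T, val', wt', first', hG, q17, q2, q3, q7, qo⟩
  replace f₃ : Agree [50, 20, 21, 22, 23, 24, 26, 25, 27, 27, 27, 26, 27, 27, 27, 26, 27, 27, 28,
    28, 26, 27, 25, 20, 21, 22, 23, 24, 26, 25, 27, 27, 27, 26, 27, 27, 27, 26, 27, 27, 28,
    28, 26, 27, 25, 20, 21, 22, 23, 24, 26, 25, 27, 27, 27, 26, 27, 27, 27, 26, 27, 27, 28,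
    28, 26, 27, 25, 17] [2, 3, 7] σ₂ σ₃ := f₃
  have hc3 : Ctx c σ₃ := hc2.of_agree f₃ (by decide) (by decide)
  have hTS : T + 1 ≤ S' := hS' (T + 1) ((hG.count (by omega)).trans
    (mul_le_mul_of_nonneg_left hG.first_le_cum (by positivity)))
  have hTK := add_le_of_lt_of_mul_le hB.hR (show s + T ≤ R by omega)
  have hsT : s * c.K ≤ (s + T) * c.K := Nat.mul_le_mul_right _ (by omega)
  refine Run.seq (Run.binop ((s + T : ℕ) : ℚ) ?_ (fit_nat (by omega) hΩ1) ?_)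
  · simp [BinOp.eval, q17, hc3.h5]
    ring
  refine Run.seq (Run.binop (((s + T) * c.K : ℕ) : ℚ) (by simp [BinOp.eval, hc3.h14])
    (fit_nat (by omega) hΩ1) ?_)
  refine Run.mono (run_call_ctx ((hc3.setVar (by decide)).setVar (by decide)) hB ((s + T) * c.K) ow
    ((s + T) * c.K) 1 d (wt' T) v (by decide)
    (by simp) ?_ (by simp) (by simpa using hc3.h5) ?_ hTK (by omega) hTK
    (by rw [abs_of_pos hd0]; norm_num; omega) (q3 T (by omega)) ?_
    (Or.inr (Or.inl rfl)) (Or.inr (Or.inr (Or.inr (by omega))))) (by omega) ?_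
  · have : σ₃.var 49 = ow := by
      rw [f₃.1 49 (by decide), hv₂ 49 (by decide)]
      simpa [hσ'] using h49
    simpa using this
  · have : σ₃.var 48 = d := by
      rw [f₃.1 48 (by decide), hv₂ 48 (by decide)]
      simp [hσ']
    simpa using this
  · refine hv.congr fun j hj hj' => ?_
    rw [setVar_arr, setVar_arr, (qo j (by omega)).2, ha₂ 3 (by decide) (by decide)]
  · intro τ _ p₄
    refine ⟨T + 1, val', _, cum + w, first', hG, ?_, ?_, ?_, ?_, ?_, ?_⟩
    · rw [p₄.var_eq 17 (by decide)]
      simpa using q17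
    · rw [p₄.arr_eq 2 (by decide)]
      exact q2
    · have q3' : Rows (σ₃.arr 3) s c.K T wt' := fun k hk => q3 k (by omega)
      refine q3'.update_last (fun j hj => ?_) ?_
      · rw [p₄.cell_eq j (by omega)]
        rfl
      · have := p₄.rep
        rwa [one_mul, mul_comm d v] at this
    · rw [p₄.arr_eq 6 (by decide), setVar_arr, setVar_arr, f₃.2 6 (by decide)]
      exact hcum₂
    · rw [p₄.arr_eq 7 (by decide)]
      exact q7
    · intro j hj
      rw [p₄.arr_eq 2 (by decide), p₄.cell_eq j (by omega), setVar_arr, setVar_arr,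
        (qo j hj).1, (qo j hj).2, ha₂ 2 (by decide) (by decide), ha₂ 3 (by decide) (by decide)]
      exact hI.hold j hj


/-- The sorted list of pairs is grouped into a new list of entries. -/
def scan : Prog :=
  .seq (.for 5 41 14 (.seq (.store 6 41 4) (.store 7 41 4))) <|
  .seq (.binop 17 .add 16 4) <|
  .seq (.binop 47 .mul 14 18) <|
  .for 5 41 18 <|
  .seq (.binop 45 .add 47 41) <|
  .seq (.load 45 5 45) <|
  splitThen scanItem

/-- The weight of the pair with the index `i`. -/
def pairWeight (c : Params) (wt : ℕ → ℤ) (i : ℕ) : ℤ :=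
  wt (i / c.m) * ((c.p (i % c.m + 1) : ℤ) - c.p (i % c.m))

theorem sum_map_take_le {l : List ℕ} {g : ℕ → ℤ} (h : ∀ i ∈ l, 0 ≤ g i) (j : ℕ) :
    ((l.take j).map g).sum ≤ (l.map g).sum := by
  conv_rhs => rw [← List.take_append_drop j l]
  rw [List.map_append, List.sum_append]
  have : 0 ≤ ((l.drop j).map g).sum := List.sum_nonneg (by
    intro a ha
    obtain ⟨i, hi, rfl⟩ := List.mem_map.1 ha
    exact h i (List.mem_of_mem_drop hi))
  omega

/-- The size bound and the bound `S'` on the number of groups are assumed for the total weight only;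
the weights are positive, so every prefix inherits them. The new list is written behind the old one,
whose weights must stay readable during the whole scan. -/
theorem run_scan {c : Params} {N R s S S' : ℕ} {σ : State} {x wt : ℕ → ℤ} {l : List ℕ}
    (hc : Ctx c σ) (hB : Bounds c N R Ω) (h15 : σ.var 15 = s) (h16 : σ.var 16 = (s + S : ℕ))
    (h18 : σ.var 18 = (S * c.m : ℕ)) (hN : S * c.m ≤ N) (hR : s + S + S' ≤ R)
    (hl : l.Perm (List.range (S * c.m))) (hsort : l.Pairwise fun i j => x i ≤ x j)
    (hL : IsList (σ.arr 5) (c.K * (S * c.m)) l)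
    (hx : ∀ i < S * c.m, Rep (σ.arr 4) (i * c.K) c.K (x i))
    (hwt : Rows (σ.arr 3) s c.K S wt) (hpos : ∀ k < S, 0 < wt k)
    (htot : (l.map (pairWeight c wt)).sum < 2 ^ c.K)
    (hS' : ∀ T : ℕ, ((c.E : ℤ) + 1) ^ (T - 1) ≤
      (c.E : ℤ) ^ (T - 1) * (l.map (pairWeight c wt)).sum → T ≤ S') :
    Run f Ω scan σ (S * c.m * (c.K * 102 + 71) + c.K * 4 + 6) (fun τ => ∃ T val' wt' cum first,
      ScanInv c (l.map fun i => (x i, pairWeight c wt i)) (s + S) T val' wt' cum first σ τ) := by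
  have hΩu := hB.hu
  have hΩ1 : 1 ≤ Ω := by omega
  have hRΩ : R ≤ Ω := le_trans (by nlinarith) hB.hR
  have hKΩ : c.K ≤ Ω := le_trans (by nlinarith) hB.hR
  have hm := hB.m_pos
  set N' : ℕ := S * c.m with hN'
  have hKN : c.K * N' + N' ≤ Ω := le_trans (by nlinarith) hB.hN
  have hlen : l.length = N' := by simpa using hl.length_eq
  have hmem : ∀ i ∈ l, i < N' := fun i hi => by simpa using hl.mem_iff.1 hi
  have hdiv : ∀ i < N', i / c.m < S := fun i hi =>
    Nat.div_lt_of_lt_mul (by rwa [mul_comm])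
  have hw0 : ∀ i < N', 0 < pairWeight c wt i := fun i hi => by
    have := hB.p_lt _ (Nat.mod_lt i hm)
    exact mul_pos (hpos _ (hdiv i hi)) (by omega)
  -- clearing the two accumulators
  refine Run.comp (Run.for (t := 2) (M := c.K) (fun t τ => ∀ i < t, τ.arr 6 i = 0 ∧ τ.arr 7 i = 0)
    hc.h14 hc.h5 hKΩ hΩ1 (by decide) (by simp) ?_) ?_
    (t := N' * (c.K * 102 + 71) + 4) (by omega)
  · rintro t ht τ hτ htv hI
    have e4 : τ.var 4 = 0 := by rw [hτ.1 4 (by decide), hc.h4]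
    have fit0 : Fit Ω 0 := by simpa using fit_nat (k := 0) (Nat.zero_le _) hΩ1
    refine Run.seq (Run.store t 0 htv e4 fit0 ?_)
    refine Run.store t 0 htv e4 fit0 ?_
    intro _ i hi
    rw [setVar_arr, setArr_apply, setArr_apply, setArr_apply, setArr_apply]
    by_cases hit : i = t
    · simp [hit]
    · simpa [hit] using hI i (by omega)
  intro τ hτ hI
  replace hτ : Agree [41, 41] [6, 7] σ τ := hτ
  have hcτ : Ctx c τ := hc.of_agree hτ (by decide) (by decide)
  refine Run.seq (Run.binop ((s + S : ℕ) : ℚ)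
    (by simp only [BinOp.eval, hcτ.h4]; rw [hτ.1 16 (by decide), h16, add_zero])
    (fit_nat (by omega) hΩ1) ?_)
  refine Run.seq (Run.binop ((c.K * N' : ℕ) : ℚ) ?_ (fit_nat (by omega) hΩ1) ?_)
  · have : τ.var 18 = N' := by rw [hτ.1 18 (by decide), h18]
    simp [BinOp.eval, hcτ.h14, this]
  refine Run.mono (Run.for (t := c.K * 102 + 69) (M := N') (fun j ρ =>
    ∃ T val' wt' cum first, ScanInv c ((l.take j).map fun i => (x i, pairWeight c wt i)) (s + S) T
      val' wt' cum first σ ρ) ?_ (by simpa using hcτ.h5) (by omega) hΩ1 (by decide) ?_ ?_)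
    le_rfl ?_
  · rw [setVar_var, if_neg (by decide), setVar_var, if_neg (by decide), hτ.1 18 (by decide), h18]
  · refine ⟨0, 0, 0, 0, 0, Grouping.nil _ _ _, by simp, fun k hk => absurd hk (by omega),
      fun k hk => absurd hk (by omega), ?_, ?_, fun i hi => ?_⟩
    · exact rep_zero fun i _ hi => by simpa using (hI i (by omega)).1
    · exact rep_zero fun i _ hi => by simpa using (hI i (by omega)).2
    · simp only [setVar_arr, hτ.2 2 (by decide), hτ.2 3 (by decide), and_self]
  · rintro j hj ρ hρ hjv ⟨T, val', wt', cum, first, hInv⟩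
    have hcρ : Ctx c ρ := ((hcτ.setVar (by decide)).setVar (by decide)).of_agree hρ (by decide)
      (by decide)
    have hjl : j < l.length := by omega
    set i : ℕ := l[j] with hi
    have hiN : i < N' := hmem i (List.getElem_mem hjl)
    have hk : i / c.m < S := hdiv i hiN
    have hr : i % c.m < c.m := Nat.mod_lt _ hm
    have e5 : ρ.arr 5 (c.K * N' + j) = i := by
      rw [hρ.2 5 (by decide), setVar_arr, setVar_arr, hτ.2 5 (by decide), hL j hjl]
    have htake : l.take (j + 1) = l.take j ++ [i] := by
      rw [List.take_add_one, List.getElem?_eq_getElem hjl]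
      simp [hi]
    -- The accumulated weight including the current pair is that of a prefix of `l`.
    have hcw : cum + pairWeight c wt i ≤ (l.map (pairWeight c wt)).sum := by
      have h1 := sum_map_take_le (g := pairWeight c wt) (fun i hi => (hw0 i (hmem i hi)).le) (j + 1)
      have h2 := hInv.grp.cum_eq
      rw [htake, List.map_append, List.sum_append] at h1
      rw [List.map_map] at h2
      have h3 : (Prod.snd ∘ fun i => (x i, pairWeight c wt i)) = pairWeight c wt := rfl
      rw [h3] at h2
      simpa [h2] using h1
    refine Run.seq (Run.binop ((c.K * N' + j : ℕ) : ℚ) ?_ (fit_nat (by omega) hΩ1) ?_)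
    · have : ρ.var 47 = (c.K * N' : ℕ) := by rw [hρ.1 47 (by decide)]; simp
      simp [BinOp.eval, this, hjv]
    refine Run.seq (Run.load (c.K * N' + j) i (by simp) (by simpa using e5)
      (fit_nat (by omega) hΩ1) ?_)
    refine run_splitThen (c := c) (i := i) (s := s) (t := c.K * 102 + 60)
      ((hcρ.setVar (by decide)).setVar (by decide)) hB (by simp) ?_ hiN hN (by omega) ?_
    · have : ρ.var 15 = s := by
        rw [hρ.1 15 (by decide), setVar_var, if_neg (by decide), setVar_var, if_neg (by decide),
          hτ.1 15 (by decide), h15]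
      simpa using this
    intro π hπ _ h43 h49 h46
    have hcπ : Ctx c π := ((hcρ.setVar (by decide)).setVar (by decide)).of_agree hπ (by decide)
      (by decide)
    have hInv' : ScanInv c ((l.take j).map fun i => (x i, pairWeight c wt i)) (s + S) T
        val' wt' cum first σ π := by
      have ea : π.arr = ρ.arr := funext fun a => (hπ.2 a (by simp)).trans (by simp)
      refine ⟨hInv.grp, ?_, ?_, ?_, ?_, ?_, ?_⟩
      · rw [hπ.1 17 (by decide)]
        simpa using hInv.h17
      · rw [ea]; exact hInv.hval
      · rw [ea]; exact hInv.hwt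
      · rw [ea]; exact hInv.hcum
      · rw [ea]; exact hInv.hfirst
      · rw [ea]; exact hInv.hold
    have hrow : (s + i / c.m) * c.K + c.K ≤ (s + S) * c.K :=
      mul_add_le_mul_of_lt (by omega)
    refine Run.mono (run_scanItem (S' := S') (i := i) (l := i % c.m) (ow := (s + i / c.m) * c.K)
      (x := x i) (v := wt (i / c.m)) hcπ hB hInv' h43 h46 h49 hr (by omega) hrow hR ?_ ?_
      (hpos _ hk) ?_ ?_ ?_) le_rfl ?_
    · rw [hπ.2 4 (by decide), setVar_arr, setVar_arr, hρ.2 4 (by decide), setVar_arr, setVar_arr,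
        hτ.2 4 (by decide)]
      exact hx i hiN
    · refine (hwt (i / c.m) hk).congr fun q hq hq' => ?_
      rw [(hInv'.hold q (by omega)).2]
    · intro a ha
      obtain ⟨i', hi', rfl⟩ := List.mem_map.1 ha
      have hs : (l.take (j + 1)).Pairwise fun i j => x i ≤ x j :=
        hsort.sublist (List.take_sublist _ _)
      rw [htake, List.pairwise_append] at hs
      exact hs.2.2 i' hi' i (by simp)
    · exact lt_of_le_of_lt hcw htot
    · intro T hT
      exact hS' T (hT.trans (mul_le_mul_of_nonneg_left hcw (by positivity)))
    · rintro τ' _ ⟨S₁, val₁, wt₁, cum₁, first₁, h⟩ _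
      refine ⟨S₁, val₁, wt₁, cum₁, first₁, ?_⟩
      rw [htake, List.map_append]
      exact ⟨h.grp, by simpa using h.h17, h.hval, h.hwt, h.hcum, h.hfirst, h.hold⟩
  · rintro ρ _ h
    rwa [← hlen, List.take_length] at h

/-! ### One layer: the step from one list to the next. -/

/-- The values of the blocks for the function with the index in the variable 19. -/
def leaf : Prog :=
  .for 5 41 10 <|
  .seq (.load 30 0 41) <|
  .seq (.query 30 19 30) <|
  .seq (.binop 31 .mul 41 14) <|
  digits 1

theorem run_leaf {c : Params} {N R : ℕ} {σ : State} {j : Fin n} {g : ℕ → ℚ}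
    (hc : Ctx c σ) (hB : Bounds c N R Ω) (h19 : σ.var 19 = ((j : ℕ) : ℚ))
    (hg : ∀ l < c.m, f j (c.p l : ℝ) = (g l : ℝ)) (hX : 0 < c.X)
    (hg0 : ∀ l < c.m, 0 ≤ g l) (hgX : ∀ l < c.m, g l < c.X)
    (hden : ∀ l < c.m, 2 * ((g l).den * c.X) ≤ Ω) :
    Run f Ω leaf σ (c.m * (c.K * 9 + 8) + 2) (fun τ =>
      ∀ l < c.m, Rep (τ.arr 1) (l * c.K) c.K ⌊g l / c.X * 2 ^ c.K⌋) := by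
  have hΩu := hB.hu
  have hΩ1 : 1 ≤ Ω := by omega
  have hmΩ : c.m + 1 ≤ Ω := le_trans (by nlinarith) hB.hm
  refine Run.mono (Run.for (t := c.K * 9 + 6) (M := c.m) (fun k τ =>
    ∀ l < k, Rep (τ.arr 1) (l * c.K) c.K ⌊g l / c.X * 2 ^ c.K⌋)
    hc.h10 hc.h5 (by omega) hΩ1 (by decide) (by simp) ?_) le_rfl (fun _ _ h => h)
  rintro k hk τ hτ hkv hI
  have hcτ : Ctx c τ := hc.of_agree hτ (by decide) (by decide)
  have e19 : τ.var 19 = ((j : ℕ) : ℚ) := by rw [hτ.1 19 (by decide), h19]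
  have hpu := hB.p_le k hk.le
  have hb := add_le_of_lt_of_mul_le hB.hm hk.le
  have hnum : |(g k).num| ≤ Ω := by
    have h0 := Rat.num_nonneg.2 (hg0 k hk)
    rw [abs_of_nonneg h0]
    -- A bound on the value and one on the denominator together bound the numerator.
    have h1 : ((g k).num : ℚ) < (g k).den * c.X := by
      have := hgX k hk
      rw [← Rat.num_div_den (g k), div_lt_iff₀ (by exact_mod_cast (g k).den_pos)] at this
      rwa [mul_comm] at this
    have h2 : (g k).num < (g k).den * c.X := by exact_mod_cast h1
    have h3 : ((2 * ((g k).den * c.X) : ℕ) : ℤ) ≤ Ω := by exact_mod_cast hden k hk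
    push_cast at h3
    omega
  have hfit : Fit Ω (g k) := by
    refine ⟨by zify; exact hnum, le_trans ?_ (hden k hk)⟩
    nlinarith [(g k).den_pos]
  refine Run.seq (Run.load k (c.p k) hkv (hcτ.hp k hk.le) (fit_nat (by omega) hΩ1) ?_)
  refine Run.seq (Run.query j (g k) (by simpa using e19) (by simpa using hg k hk) hfit ?_)
  refine Run.seq (Run.binop ((k * c.K : ℕ) : ℚ) (by simp [BinOp.eval, hkv, hcτ.h14])
    (fit_nat (by omega) hΩ1) ?_)
  refine Run.mono (run_digits (K := c.K) (o := k * c.K) (X := c.X) (v := g k)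
    (by simpa using hcτ.h5) (by simpa using hcτ.h6) (by simpa using hcτ.h13)
    (by simpa using hcτ.h14) (by simp) (by simp) hX (hg0 k hk) (hgX k hk) (hden k hk) hb) le_rfl ?_
  rintro ρ _ ⟨h1, h2⟩ _ l hl
  rw [setVar_arr]
  rcases Nat.lt_succ_iff_lt_or_eq.mp hl with h | rfl
  · refine (hI l h).congr fun q hq hq' => ?_
    have := mul_add_le_mul_of_lt (K := c.K) h
    rw [h2 q (by omega)]
    rfl
  · exact h1

/-- The list of entries is replaced by the list for one function more. -/
def layer : Prog :=
  .seq leaf <|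
  .seq pairSums <|
  .seq radixSort <|
  .seq scan <|
  .seq (.binop 15 .add 16 4) <|
  .binop 16 .add 17 4

/-- The memory holds a list of `S` entries, beginning with row `s`. -/
structure Entries (c : Params) (s S : ℕ) (val wt : ℕ → ℤ) (σ : State) : Prop where
  h15 : σ.var 15 = s
  h16 : σ.var 16 = (s + S : ℕ)
  hval : Rows (σ.arr 2) s c.K S val
  hwt : Rows (σ.arr 3) s c.K S wt

/-- Moving variables 15 and 16 makes the appended rows the current list; nothing is copied. `hS'` is
the only source of the bound on the new length: it is fed with the growth recorded in
`Grouping.count`. -/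
theorem run_layer {c : Params} {N R s S S' : ℕ} {σ : State} {j : Fin n} {g : ℕ → ℚ}
    {val wt y : ℕ → ℤ}
    (hc : Ctx c σ) (hB : Bounds c N R Ω) (h19 : σ.var 19 = ((j : ℕ) : ℚ))
    (hg : ∀ l < c.m, f j (c.p l : ℝ) = (g l : ℝ)) (hX : 0 < c.X)
    (hg0 : ∀ l < c.m, 0 ≤ g l) (hgX : ∀ l < c.m, g l < c.X)
    (hden : ∀ l < c.m, 2 * ((g l).den * c.X) ≤ Ω)
    (hy : ∀ l < c.m, y l = ⌊g l / c.X * 2 ^ c.K⌋)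
    (hent : Entries c s S val wt σ) (hN : S * c.m ≤ N) (hR : s + S + S' ≤ R)
    (hpos : ∀ k < S, 0 < wt k)
    (hx0 : ∀ k < S, ∀ l < c.m, 0 ≤ val k + y l ∧ val k + y l < 2 ^ c.K)
    (htot : ((List.range (S * c.m)).map (pairWeight c wt)).sum < 2 ^ c.K)
    (hS' : ∀ T : ℕ, ((c.E : ℤ) + 1) ^ (T - 1) ≤
      (c.E : ℤ) ^ (T - 1) * ((List.range (S * c.m)).map (pairWeight c wt)).sum → T ≤ S') :
    Run f Ω layer σ (c.m * (c.K * 9 + 8) + c.K * (S * c.m * 20 + 8) +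
      S * c.m * (c.K * 119 + 91) + c.K * 4 + 16) (fun τ => ∃ (l : List ℕ) (T : ℕ) (val' wt' : ℕ → ℤ)
        (cum first : ℤ), l.Perm (List.range (S * c.m)) ∧
        Grouping c.E (l.map fun i => (val (i / c.m) + y (i % c.m), pairWeight c wt i)) T val' wt'
          cum first ∧ Entries c (s + S) T val' wt' τ ∧ (T ≤ S')) := by
  have hΩu := hB.hu
  have hΩ1 : 1 ≤ Ω := by omega
  have hm := hB.m_pos
  have hRΩ : R ≤ Ω := le_trans (by nlinarith) hB.hR
  have hx : ∀ i < S * c.m, 0 ≤ val (i / c.m) + y (i % c.m) ∧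
      val (i / c.m) + y (i % c.m) < 2 ^ c.K := fun i hi =>
    hx0 _ (Nat.div_lt_of_lt_mul (by rwa [mul_comm])) _ (Nat.mod_lt _ hm)
  refine Run.comp (run_leaf hc hB h19 hg hX hg0 hgX hden) ?_
    (t := c.K * (S * c.m * 20 + 8) + S * c.m * (c.K * 119 + 91) + c.K * 4 + 14) (by omega)
  intro σ₁ f₁ p₁
  have hc1 : Ctx c σ₁ := hc.of_agree f₁ (by decide) (by decide)
  refine Run.comp (run_pairSums (s := s) (S := S) (val := val) (y := y) hc1 hB
    (by rw [f₁.1 15 (by decide), hent.h15]) (by rw [f₁.1 16 (by decide), hent.h16]) hN (by omega)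
    (by rw [f₁.2 2 (by decide)]; exact hent.hval) (fun l hl => by rw [hy l hl]; exact p₁ l hl)) ?_
    (t := c.K * (S * c.m * 20 + 8) + S * c.m * (c.K * 102 + 71) + c.K * 4 + 10) ?_
  swap
  · have : S * c.m * (c.K * 119 + 91) = S * c.m * (c.K * 17 + 20) + S * c.m * (c.K * 102 + 71) := by
      ring
    omega
  rintro σ₂ f₂ ⟨p18, p₂⟩
  have hc2 : Ctx c σ₂ := hc1.of_agree f₂ (by decide) (by decide)
  refine Run.comp (run_radixSort (N' := S * c.m)
    (x := fun i => val (i / c.m) + y (i % c.m)) hc2 hB p18 hN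
    (fun i hi => (p₂ i hi).1) (fun i hi => (p₂ i hi).2)) ?_
    (t := S * c.m * (c.K * 102 + 71) + c.K * 4 + 8) (by omega)
  rintro σ₃ f₃ ⟨l, hl1, hl2, hl3⟩
  have hc3 : Ctx c σ₃ := hc2.of_agree f₃ (by decide) (by decide)
  have hsum : (l.map (pairWeight c wt)).sum =
      ((List.range (S * c.m)).map (pairWeight c wt)).sum := (hl1.map _).sum_eq
  have hmem : ∀ i ∈ l, i < S * c.m := fun i hi => by simpa using hl1.mem_iff.1 hi
  refine Run.comp (run_scan (s := s) (S := S) (S' := S') (wt := wt) (l := l)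
    (x := fun i => val (i / c.m) + y (i % c.m)) hc3 hB
    (by rw [f₃.1 15 (by decide), f₂.1 15 (by decide), f₁.1 15 (by decide), hent.h15])
    (by rw [f₃.1 16 (by decide), f₂.1 16 (by decide), f₁.1 16 (by decide), hent.h16])
    (by rw [f₃.1 18 (by decide), p18]) hN hR hl1
    (hl2.imp_of_mem fun {i j} hi hj h => ?_) hl3
    (fun i hi => by rw [f₃.2 4 (by decide)]; exact (p₂ i hi).2)
    (by rw [f₃.2 3 (by decide), f₂.2 3 (by decide), f₁.2 3 (by decide)]; exact hent.hwt) hpos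
    (by rwa [hsum]) (by rwa [hsum])) ?_ (t := 2) (by omega)
  -- The radix sort orders residues modulo `2 ^ K`; all sums lie in `[0, 2 ^ K)`, so this is the
  -- order of the values.
  · have h1 := hx i (hmem i hi)
    have h2 := hx j (hmem j hj)
    rwa [Int.emod_eq_of_lt h1.1 h1.2, Int.emod_eq_of_lt h2.1 h2.2] at h
  rintro σ₄ f₄ ⟨T, val', wt', cum, first, hInv⟩
  have hc4 : Ctx c σ₄ := hc3.of_agree f₄ (by decide) (by decide)
  have hT : T ≤ S' := by
    rcases Nat.eq_zero_or_pos T with rfl | hT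
    · omega
    · refine hS' T ((hInv.grp.count hT).trans (mul_le_mul_of_nonneg_left ?_ (by positivity)))
      refine hInv.grp.first_le_cum.trans (le_of_eq ?_)
      rw [← hsum, hInv.grp.cum_eq, List.map_map]
      rfl
  have e16 : σ₄.var 16 = (s + S : ℕ) := by
    rw [f₄.1 16 (by decide), f₃.1 16 (by decide), f₂.1 16 (by decide), f₁.1 16 (by decide),
      hent.h16]
  refine Run.seq (Run.binop ((s + S : ℕ) : ℚ) (by simp [BinOp.eval, e16, hc4.h4])
    (fit_nat (by omega) hΩ1) ?_)
  refine Run.binop ((s + S + T : ℕ) : ℚ) (by simp [BinOp.eval, hInv.h17, hc4.h4])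
    (fit_nat (by omega) hΩ1) ?_
  exact ⟨l, T, val', wt', cum, first, hl1, hInv.grp,
    ⟨by simp, by simp, hInv.hval, hInv.hwt⟩, hT⟩


/-! ### Evaluation of the last list and rounding of the result. -/

/-- The weights of the entries whose value is at most the number in the array 9 are added up in the
array 10. -/
def finalSum : Prog :=
  .seq (.binop 40 .sub 16 15) <|
  .seq (.binop 47 .sub 4 5) <|
  .for 5 41 40 <|
  .seq (.binop 42 .add 15 41) <|
  .seq (.binop 42 .mul 42 14) <|
  .seq (call 9 2 8 4 42 4 5 47) <|
  .ite (.lt 26 4) .skip (call 10 3 10 4 42 4 5 5)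

/-- Each entry is compared with the bound by the sign of the carry of `z - val k`, which is reliable
because both numbers lie in `[0, 2 ^ K)`. -/
theorem run_finalSum {c : Params} {N R s S : ℕ} {σ : State} {val wt : ℕ → ℤ} {z : ℤ}
    (hc : Ctx c σ) (hB : Bounds c N R Ω) (hent : Entries c s S val wt σ) (hR : s + S ≤ R)
    (hz : Rep (σ.arr 9) 0 c.K z) (hz0 : 0 ≤ z) (hzK : z < 2 ^ c.K)
    (hval : ∀ k < S, 0 ≤ val k ∧ val k < 2 ^ c.K) (h10 : Rep (σ.arr 10) 0 c.K 0) :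
    Run f Ω finalSum σ (S * (c.K * 34 + 21) + 4) (fun τ =>
      Rep (τ.arr 10) 0 c.K (stepFun S val wt z)) := by
  have hΩu := hB.hu
  have hΩ1 : 1 ≤ Ω := by omega
  have hRΩ : R ≤ Ω := le_trans (by nlinarith) hB.hR
  have hKΩ : c.K ≤ Ω := le_trans (by nlinarith) hB.hR
  refine Run.seq (Run.binop (S : ℚ) (by simp [BinOp.eval, hent.h15, hent.h16])
    (fit_nat (by omega) hΩ1) ?_)
  refine Run.seq (Run.binop ((-1 : ℤ) : ℚ) (by simp [BinOp.eval, hc.h4, hc.h5])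
    (fit_int (by norm_num; omega) hΩ1) ?_)
  have hc0 : Ctx c ((σ.setVar 40 (S : ℚ)).setVar 47 ((-1 : ℤ) : ℚ)) :=
    (hc.setVar (by decide)).setVar (by decide)
  refine Run.mono (Run.for (t := c.K * 34 + 19) (M := S) (fun k τ =>
    Rep (τ.arr 10) 0 c.K (stepFun k val wt z)) (by simp) (by simpa using hc.h5) (by omega) hΩ1
    (by decide) (by simpa [stepFun] using h10) ?_) le_rfl (fun _ _ h => h)
  intro k hk τ hτ hkv hI
  have hcτ : Ctx c τ := hc0.of_agree hτ (by decide) (by decide)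
  have e15 : τ.var 15 = s := by
    rw [hτ.1 15 (by decide)]
    simpa using hent.h15
  have e47 : τ.var 47 = ((-1 : ℤ) : ℚ) := by
    rw [hτ.1 47 (by decide)]
    simp
  have hb := add_le_of_lt_of_mul_le hB.hR (show s + k ≤ R by omega)
  refine Run.seq (Run.binop ((s + k : ℕ) : ℚ) (by simp [BinOp.eval, e15, hkv])
    (fit_nat (by omega) hΩ1) ?_)
  refine Run.seq (Run.binop (((s + k) * c.K : ℕ) : ℚ) (by simp [BinOp.eval, hcτ.h14])
    (fit_nat (by omega) hΩ1) ?_)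
  set σ' := (τ.setVar 42 ((s + k : ℕ) : ℚ)).setVar 42 (((s + k) * c.K : ℕ) : ℚ) with hσ'
  have hc' : Ctx c σ' := (hcτ.setVar (by decide)).setVar (by decide)
  refine Run.comp (run_call_ctx hc' hB 0 ((s + k) * c.K) 0 1 (-1) z (val k) (by decide)
    (by simpa using hc'.h4) (by simp [hσ']) (by simpa using hc'.h4)
    (by simpa using hc'.h5) (by simpa [hσ'] using e47) (by omega) (by omega) (by omega)
    (by norm_num; omega) ?_ ?_ (Or.inl (by decide)) (Or.inl (by decide))) ?_
    (t := c.K * 17 + 9) (by omega)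
  · simp only [hσ', setVar_arr]
    rw [hτ.2 9 (by decide)]
    exact hz
  · simp only [hσ', setVar_arr]
    rw [hτ.2 2 (by decide)]
    exact hent.hval k hk
  intro σ₁ _ p₁
  have hc1 := p₁.ctx hc' (by decide)
  have hcarry := p₁.carry_eq
  have hv := hval k hk
  rw [Int.emod_eq_of_lt hz0 hzK, Int.emod_eq_of_lt hv.1 hv.2] at hcarry
  have htest : (Test.lt 26 4).Holds σ₁ ↔ z < val k := by
    show σ₁.var 26 < σ₁.var 4 ↔ _
    rw [hcarry, hc1.h4]
    rw [show ((0 : ℚ)) = ((0 : ℤ) : ℚ) by simp, Int.cast_lt, ediv_two_pow_neg_iff]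
    constructor <;> intro <;> linarith
  have hI₁ : Rep (σ₁.arr 10) 0 c.K (stepFun k val wt z) := p₁.rep_other hI (Or.inl (by decide))
  have hstep : stepFun (k + 1) val wt z = stepFun k val wt z + if val k ≤ z then wt k else 0 := by
    unfold stepFun
    rw [Finset.sum_range_succ]
  refine Run.ite (fun hT => ?_) (fun hT => ?_)
  · rw [htest] at hT
    refine Run.skip ?_
    intro _
    rw [hstep, if_neg (by omega), add_zero]
    exact hI₁
  · rw [htest] at hT
    refine Run.mono (run_call_ctx hc1 hB 0 ((s + k) * c.K) 0 1 1 (stepFun k val wt z) (wt k)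
      (by decide) (by simpa using hc1.h4) (by rw [p₁.var_eq 42 (by decide)]; simp [hσ'])
      (by simpa using hc1.h4)
      (by simpa using hc1.h5) (by simpa using hc1.h5) (by omega) (by omega) (by omega)
      (by norm_num; omega) hI₁ ?_ (Or.inr (Or.inl rfl)) (Or.inl (by decide))) le_rfl ?_
    · rw [p₁.arr_eq 3 (by decide)]
      simp only [hσ', setVar_arr]
      rw [hτ.2 3 (by decide)]
      exact hent.hwt k hk
    · intro ρ _ p₂ _
      have := p₂.rep
      rw [hstep, if_pos (by omega)]
      simpa using this

/-- The number in the array 10 is rounded up to a number with few binary digits, the mantissa and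
the exponent of which are left in the variables 0 and 1. -/
def output : Prog :=
  .seq (.const 40 0) <|
  .seq (.binop 41 .add 14 4) <|
  .seq (.for 5 42 14 (.ite (.le 40 7)
    (.seq (.binop 41 .sub 41 5) <|
     .seq (.load 43 10 41) <|
     .seq (.binop 40 .mul 40 6) <|
     .binop 40 .add 40 43) .skip)) <|
  .seq (.ite (.lt 4 41) (.binop 40 .add 40 5) .skip) <|
  .seq (.binop 0 .add 40 4) <|
  .binop 1 .add 41 4

/-- Digits are read from the top until the mantissa `V / 2 ^ e` exceeds `E` or none is left. In the
first case rounding the mantissa up costs at most `2 ^ e`, which is at most `V / E`; if `e = 0` the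
mantissa is exact. The mantissa never exceeds `2 * E + 2`, so it fits in a machine word although `V`
does not. -/
theorem run_output {c : Params} {N R : ℕ} {σ : State} {V : ℕ}
    (hc : Ctx c σ) (hB : Bounds c N R Ω) (hV : Rep (σ.arr 10) 0 c.K V) (hVK : V < 2 ^ c.K) :
    Run f Ω output σ (c.K * 7 + 8) (fun τ => ∃ m e : ℕ, τ.var 0 = m ∧ τ.var 1 = e ∧
      V ≤ m * 2 ^ e ∧ c.E * (m * 2 ^ e) ≤ (c.E + 1) * V) := by
  have hΩu := hB.hu
  have hΩE := hB.hE
  have hΩ1 : 1 ≤ Ω := by omega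
  have hKΩ : c.K ≤ Ω := le_trans (by nlinarith) hB.hR
  refine Run.seq (Run.const (by simpa using fit_nat (k := 0) (Nat.zero_le _) hΩ1) ?_)
  refine Run.seq (Run.binop (c.K : ℚ) (by simp [BinOp.eval, hc.h14, hc.h4])
    (fit_nat hKΩ hΩ1) ?_)
  set σ' := (σ.setVar 40 0).setVar 41 (c.K : ℚ) with hσ'
  have hc' : Ctx c σ' := (hc.setVar (by decide)).setVar (by decide)
  refine Run.comp (Run.for (t := 5) (M := c.K) (fun t τ => ∃ e : ℕ, e ≤ c.K ∧ τ.var 41 = e ∧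
    τ.var 40 = (V / 2 ^ e : ℕ) ∧ (e + t = c.K ∨ c.E < V / 2 ^ e) ∧ V / 2 ^ e ≤ 2 * c.E + 1)
    hc'.h14 hc'.h5 hKΩ hΩ1 (by decide) ?_ ?_) ?_ (t := 4) (by omega)
  · refine ⟨c.K, le_rfl, by simp [hσ'], ?_, Or.inl rfl, ?_⟩
    · rw [Nat.div_eq_of_lt hVK]
      simp [hσ']
    · rw [Nat.div_eq_of_lt hVK]
      omega
  · rintro t ht τ hτ htv ⟨e, heK, h41, h40, he, hle⟩
    have hcτ : Ctx c τ := hc'.of_agree hτ (by decide) (by decide)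
    refine Run.ite (t := 4) (fun hT => ?_) (fun hT => ?_)
    · have hT' : V / 2 ^ e ≤ c.E := by
        have : τ.var 40 ≤ τ.var 7 := hT
        rw [h40, hcτ.h7] at this
        exact_mod_cast this
      have het : e + t = c.K := by omega
      obtain ⟨e', rfl⟩ : ∃ e', e = e' + 1 := ⟨e - 1, by omega⟩
      have hdiv : V / 2 ^ e' = V / 2 ^ (e' + 1) * 2 + V / 2 ^ e' % 2 := by
        rw [pow_succ, ← Nat.div_div_eq_div_mul]
        omega
      have hcell : τ.arr 10 e' = ((V / 2 ^ e' % 2 : ℕ) : ℚ) := by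
        have := hV e' (by omega)
        rw [zero_add] at this
        rw [hτ.2 10 (by decide)]
        simp only [hσ', setVar_arr]
        rw [this]
        norm_cast
      refine Run.seq (Run.binop (e' : ℚ) (by simp [BinOp.eval, h41, hcτ.h5])
        (fit_nat (by omega) hΩ1) ?_)
      refine Run.seq (Run.load e' ((V / 2 ^ e' % 2 : ℕ) : ℚ) (by simp) (by simpa using hcell)
        (fit_nat (by omega) hΩ1) ?_)
      refine Run.seq (Run.binop ((V / 2 ^ (e' + 1) * 2 : ℕ) : ℚ)
        (by
          simp only [BinOp.eval, setVar_var]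
          simp only [h40, hcτ.h6]
          norm_num)
        (fit_nat (by omega) hΩ1) ?_)
      refine Run.binop ((V / 2 ^ e' : ℕ) : ℚ)
        (by
          rw [hdiv]
          simp only [BinOp.eval, setVar_var]
          norm_num)
        (fit_nat (by omega) hΩ1) ?_
      intro _
      refine ⟨e', by omega, by simp, by simp, Or.inl (by omega), by omega⟩
    · have hT' : c.E < V / 2 ^ e := by
        by_contra hh
        apply hT
        show τ.var 40 ≤ τ.var 7
        rw [h40, hcτ.h7]
        exact_mod_cast not_lt.1 hh
      refine Run.skip ?_
      intro _
      exact ⟨e, heK, by simpa using h41, by simpa using h40, Or.inr hT', hle⟩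
  · rintro τ hτ ⟨e, heK, h41, h40, he, hle⟩
    have hcτ : Ctx c τ := hc'.of_agree hτ (by decide) (by decide)
    have h2 : 0 < 2 ^ e := by positivity
    have hdm := Nat.div_add_mod V (2 ^ e)
    have hml := Nat.mod_lt V h2
    refine Run.comp (s := 2) (Q := fun ρ => ∃ m : ℕ, ρ.var 40 = m ∧ m ≤ 2 * c.E + 2 ∧
      V ≤ m * 2 ^ e ∧ c.E * (m * 2 ^ e) ≤ (c.E + 1) * V)
      (Run.ite (t := 1) (fun hT => ?_) (fun hT => ?_)) ?_ (t := 2) le_rfl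
    · have he0 : 0 < e := by
        have : τ.var 4 < τ.var 41 := hT
        rw [h41, hcτ.h4] at this
        exact_mod_cast this
      refine Run.binop ((V / 2 ^ e + 1 : ℕ) : ℚ)
        (by
          simp only [BinOp.eval]
          rw [h40, hcτ.h5]
          push_cast
          ring)
        (fit_nat (by omega) hΩ1) ?_
      refine ⟨V / 2 ^ e + 1, by simp, by omega, by nlinarith, ?_⟩
      have hE : c.E < V / 2 ^ e := by omega
      -- The rounding error `2 ^ e` is at most the fraction `1 / E` of `V`, because the mantissa
      -- exceeds `E`.
      have h3 : c.E * 2 ^ e ≤ V :=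
        (Nat.mul_le_mul_right _ hE.le).trans (Nat.div_mul_le_self V (2 ^ e))
      have h4 : (V / 2 ^ e + 1) * 2 ^ e ≤ V + 2 ^ e := by
        have := Nat.div_mul_le_self V (2 ^ e)
        rw [add_mul, one_mul]
        omega
      nlinarith [Nat.mul_le_mul_left c.E h4]
    · have he0 : e = 0 := by
        by_contra hh
        apply hT
        show τ.var 4 < τ.var 41
        rw [h41, hcτ.h4]
        exact_mod_cast Nat.pos_of_ne_zero hh
      refine Run.skip ?_
      subst he0
      exact ⟨V, by simpa using h40, by simp at hle; omega, by simp, by simp; nlinarith⟩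
    · rintro ρ hρ ⟨m, hm40, hmE, hm1, hm2⟩
      have hcρ : Ctx c ρ := hcτ.of_agree hρ (by decide) (by decide)
      have e41 : ρ.var 41 = e := by rw [hρ.1 41 (by decide), h41]
      refine Run.seq (Run.binop (m : ℚ) (by simp [BinOp.eval, hm40, hcρ.h4])
        (fit_nat (by omega) hΩ1) ?_)
      refine Run.binop (e : ℚ) (by simp [BinOp.eval, e41, hcρ.h4])
        (fit_nat (by omega) hΩ1) ?_
      exact ⟨m, e, by simp, by simp, hm1, hm2⟩

end RatRAM

/-! ### Geometrically growing blocks of arguments. -/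

/-- The first elements of the blocks into which `{0, …, u - 1}` is divided. -/
def blockPoint (E u : ℕ) : ℕ → ℕ
  | 0 => 0
  | k + 1 => min u (blockPoint E u k + 1 + (blockPoint E u k + 1) / E)

theorem blockPoint_le (E u k : ℕ) : blockPoint E u k ≤ u := by
  cases k with
  | zero => exact Nat.zero_le _
  | succ k => exact min_le_left _ _

theorem blockPoint_lt_succ {E u k : ℕ} (h : blockPoint E u k < u) :
    blockPoint E u k < blockPoint E u (k + 1) := by
  rw [blockPoint, lt_min_iff]
  generalize (blockPoint E u k + 1) / E = q
  omega

theorem exists_blockPoint_eq (E : ℕ) {u : ℕ} (hu : 0 < u) :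
    ∃ m, 0 < m ∧ blockPoint E u m = u ∧ ∀ k < m, blockPoint E u k < u := by
  have hex : ∃ m, blockPoint E u m = u := by
    by_contra! h
    have hlt : ∀ k, blockPoint E u k < u := fun k => lt_of_le_of_ne (blockPoint_le E u k) (h k)
    have hge : ∀ k, k ≤ blockPoint E u k := by
      intro k
      induction k with
      | zero => exact Nat.zero_le _
      | succ k ih => exact lt_of_le_of_lt ih (blockPoint_lt_succ (hlt k))
    exact absurd (hge u) (not_le.2 (hlt u))
  classical
  refine ⟨Nat.find hex, ?_, Nat.find_spec hex, fun k hk =>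
    lt_of_le_of_ne (blockPoint_le E u k) (Nat.find_min hex hk)⟩
  rw [Nat.find_pos]
  exact hu.ne

/-! ### Preparations: accuracy, block points and row length. -/

namespace RatRAM
variable {n : ℕ} {f : Fin n → ℝ → ℝ} {Ω : ℕ}

/-- The constants and the accuracy `E` are computed. -/
def consts : Prog :=
  .seq (.const 5 1) <|
  .seq (.const 6 2) <|
  .seq (.ite (.lt 5 3) (.const 3 1) .skip) <|
  .seq (.const 40 6) <|
  .seq (.binop 40 .mul 40 0) <|
  .seq (.binop 40 .div 40 3) <|
  .seq (.unop 7 .floor 40) <|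
  .seq (.binop 7 .add 7 5) <|
  .seq (.binop 8 .add 7 5) <|
  .binop 9 .sub 4 7

theorem run_consts {σ : State} {E : ℕ} {δ : ℚ} (h0 : σ.var 0 = n) (h4 : σ.var 4 = 0)
    (h3 : σ.var 3 = δ) (hδ : 0 < δ) (hE : (E : ℤ) = ⌊6 * n / min δ 1⌋ + 1)
    (hEΩ : E + 1 ≤ Ω) (hd : 6 * (n * (min δ 1).den) ≤ Ω) (hnum : (min δ 1).num ≤ Ω) (hΩ : 6 ≤ Ω)
    (hnΩ : 6 * n ≤ Ω) :
    Run f Ω consts σ 11 (fun τ => τ.var 5 = 1 ∧ τ.var 6 = 2 ∧ τ.var 7 = E ∧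
      τ.var 8 = (E : ℚ) + 1 ∧ τ.var 9 = -(E : ℚ)) := by
  have hΩ1 : 1 ≤ Ω := by omega
  set δ' : ℚ := min δ 1 with hδ'
  have hδ0 : 0 < δ' := lt_min hδ one_pos
  have hnum0 : 0 < δ'.num := Rat.num_pos.2 hδ0
  refine Run.seq (Run.const (by simpa using fit_nat (k := 1) hΩ1 hΩ1) ?_)
  refine Run.seq (Run.const (by simpa using fit_nat (k := 2) (by omega : 2 ≤ Ω) hΩ1) ?_)
  refine Run.comp (s := 2) (t := 7) (Q := fun τ => τ.var 3 = δ')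
    (Run.ite (t := 1) (fun hT => ?_) (fun hT => ?_)) ?_ (by omega)
  · refine Run.const (by simpa using fit_nat (k := 1) hΩ1 hΩ1) ?_
    have : (1 : ℚ) < δ := by simpa [Test.Holds, h3] using hT
    simp [hδ', min_eq_right this.le]
  · refine Run.skip ?_
    have : δ ≤ 1 := by simpa [Test.Holds, h3] using hT
    simp [hδ', min_eq_left this, h3]
  intro τ hτ hτ3
  have e0 : τ.var 0 = n := by rw [hτ.1 0 (by decide)]; simpa using h0
  have e4 : τ.var 4 = 0 := by rw [hτ.1 4 (by decide)]; simpa using h4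
  have e5 : τ.var 5 = 1 := by rw [hτ.1 5 (by decide)]; simp
  have e6 : τ.var 6 = 2 := by rw [hτ.1 6 (by decide)]; simp
  refine Run.seq (Run.const (by simpa using fit_nat (k := 6) (by omega : 6 ≤ Ω) hΩ1) ?_)
  refine Run.seq (Run.binop ((6 * n : ℕ) : ℚ) (by simp [BinOp.eval, e0])
    (fit_nat hnΩ hΩ1) ?_)
  refine Run.seq (Run.binop (6 * n / δ') (by simp [BinOp.eval, hτ3])
    (fit_div (z := 6 * (n * δ'.den)) (d := δ'.num.natAbs) (by omega) ?_ ?_ (by omega)) ?_)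
  -- The quotient is `6 * n * δ'.den` over `δ'.num`; this possibly unreduced form is what the size
  -- bounds speak of.
  · have e : ((δ'.num.natAbs : ℕ) : ℚ) = δ'.num := by
      rw [Nat.cast_natAbs, abs_of_pos hnum0]
    have hn0 : (δ'.num : ℚ) ≠ 0 := by exact_mod_cast hnum0.ne'
    have hd0 : (δ'.den : ℚ) ≠ 0 := by exact_mod_cast δ'.den_pos.ne'
    rw [e]
    conv_lhs => rw [← Rat.num_div_den δ']
    push_cast
    field_simp
  · rw [abs_of_nonneg (by positivity)]
    exact_mod_cast hd
  refine Run.seq (Run.unop ((⌊6 * n / δ'⌋ : ℤ) : ℚ) (by simp [UnOp.eval])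
    (fit_int (by rw [abs_le]; omega) hΩ1) ?_)
  refine Run.seq (Run.binop (E : ℚ) ?_ (fit_nat (by omega) hΩ1) ?_)
  · have : (E : ℚ) = ((⌊6 * n / δ'⌋ + 1 : ℤ) : ℚ) := by exact_mod_cast congrArg (Int.cast : ℤ → ℚ) hE
    rw [this]
    simp [BinOp.eval, e5]
  refine Run.seq (Run.binop ((E + 1 : ℕ) : ℚ) (by simp [BinOp.eval, e5])
    (fit_nat (by omega) hΩ1) ?_)
  refine Run.binop ((-E : ℤ) : ℚ) (by simp [BinOp.eval, e4])
    (fit_int (by rw [abs_neg, abs_of_nonneg (by omega)]; omega) hΩ1) ?_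
  simp [e5, e6]

/-- The points `blockPoint E u k` are computed. -/
def points : Prog :=
  .seq (.const 10 0) <|
  .seq (.const 40 0) <|
  .while (.lt 40 1) <|
  .seq (.binop 41 .add 40 5) <|
  .seq (.binop 42 .div 41 7) <|
  .seq (.unop 42 .floor 42) <|
  .seq (.binop 40 .add 41 42) <|
  .seq (.ite (.lt 1 40) (.binop 40 .add 1 4) .skip) <|
  .seq (.binop 10 .add 10 5) <|
  .store 0 10 40

theorem run_points {σ : State} {E u m : ℕ} (h1 : σ.var 1 = u) (h4 : σ.var 4 = 0)
    (h5 : σ.var 5 = 1) (h7 : σ.var 7 = E) (h00 : σ.arr 0 0 = 0) (hE : 0 < E) (hEΩ : E ≤ Ω)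
    (hm : blockPoint E u m = u) (hlt : ∀ k < m, blockPoint E u k < u) (hu : 2 * u ≤ Ω)
    (hmΩ : m ≤ Ω) :
    Run f Ω points σ (m * 9 + 3) (fun τ => τ.var 10 = m ∧
      ∀ k ≤ m, τ.arr 0 k = blockPoint E u k) := by
  have hΩ1 : 1 ≤ Ω := by omega
  have fit0 : Fit Ω 0 := by simpa using fit_nat (k := 0) (Nat.zero_le _) hΩ1
  refine Run.seq (Run.const fit0 ?_)
  refine Run.seq (Run.const fit0 ?_)
  refine Run.mono (Run.while (t := 8) m (fun k τ => τ.var 10 = k ∧ τ.var 40 = blockPoint E u k ∧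
    ∀ i ≤ k, τ.arr 0 i = blockPoint E u i) ?_ ?_ ?_) le_rfl (fun _ _ h => ⟨h.1, h.2.2⟩)
  · refine ⟨by simp, by simp [blockPoint], fun i hi => ?_⟩
    obtain rfl : i = 0 := by omega
    simpa [blockPoint] using h00
  · rintro k hk τ hτ ⟨h10, h40, hI⟩
    have e1 : τ.var 1 = u := by rw [hτ.1 1 (by decide)]; simpa using h1
    have e4 : τ.var 4 = 0 := by rw [hτ.1 4 (by decide)]; simpa using h4
    have e5 : τ.var 5 = 1 := by rw [hτ.1 5 (by decide)]; simpa using h5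
    have e7 : τ.var 7 = E := by rw [hτ.1 7 (by decide)]; simpa using h7
    have hku := hlt k hk
    set p := blockPoint E u k with hp
    have hdle := Nat.div_le_self (p + 1) E
    refine ⟨?_, ?_⟩
    · show τ.var 40 < τ.var 1
      rw [h40, e1]
      exact_mod_cast hku
    refine Run.seq (Run.binop ((p + 1 : ℕ) : ℚ) (by simp [BinOp.eval, h40, e5])
      (fit_nat (by omega) hΩ1) ?_)
    refine Run.seq (Run.binop (((p + 1 : ℕ) : ℚ) / E) (by simp [BinOp.eval, e7])
      (fit_div (z := (p + 1 : ℕ)) hE (by simp) (by rw [abs_of_nonneg (by omega)]; omega) hEΩ) ?_)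
    refine Run.seq (Run.unop (((p + 1) / E : ℕ) : ℚ)
      (by
        simp only [UnOp.eval, setVar_var, if_true, Rat.floor_natCast_div_natCast]
        norm_cast) (fit_nat (by omega) hΩ1) ?_)
    refine Run.seq (Run.binop ((p + 1 + (p + 1) / E : ℕ) : ℚ) (by simp [BinOp.eval])
      (fit_nat (by omega) hΩ1) ?_)
    refine Run.comp (s := 2) (t := 2) (Q := fun ρ => ρ.var 40 = blockPoint E u (k + 1))
      (Run.ite (t := 1) (fun hT => ?_) (fun hT => ?_)) ?_ (by omega)
    · have hT' : u < p + 1 + (p + 1) / E := by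
        simp only [Test.Holds, setVar_var] at hT
        simp only [e1] at hT
        norm_num at hT
        exact_mod_cast hT
      refine Run.binop (u : ℚ) (by simp [BinOp.eval, e1, e4]) (fit_nat (by omega) hΩ1) ?_
      rw [blockPoint, ← hp, min_eq_left hT'.le]
      simp
    · have hT' : p + 1 + (p + 1) / E ≤ u := by
        simp only [Test.Holds, setVar_var] at hT
        simp only [e1] at hT
        norm_num at hT
        exact_mod_cast hT
      refine Run.skip ?_
      rw [blockPoint, ← hp, min_eq_right hT']
      simp
    intro ρ hρ hρ40
    have e10 : ρ.var 10 = k := by rw [hρ.1 10 (by decide)]; simpa using h10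
    have e5' : ρ.var 5 = 1 := by rw [hρ.1 5 (by decide)]; simpa using e5
    have hle := blockPoint_le E u (k + 1)
    refine Run.seq (Run.binop ((k + 1 : ℕ) : ℚ) (by simp [BinOp.eval, e10, e5'])
      (fit_nat (by omega) hΩ1) ?_)
    refine Run.store (k + 1) (blockPoint E u (k + 1)) (by simp) (by simpa using hρ40)
      (fit_nat (by omega) hΩ1) ?_
    refine ⟨by simp, by simpa using hρ40, fun i hi => ?_⟩
    rw [setArr_apply]
    by_cases hik : i = k + 1
    · simp [hik]
    · rw [if_neg (by omega), setVar_arr, hρ.2 0 (by decide)]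
      exact hI i (by omega)
  · rintro τ hτ ⟨_, h40, _⟩
    show ¬ τ.var 40 < τ.var 1
    rw [h40, hτ.1 1 (by decide), hm]
    simpa using h1.le

/-- The variable 44 is increased to the number in the variable `x`, if that is greater. -/
def updMax (x : ℕ) : Prog :=
  .ite (.lt 44 x) (.binop 44 .add x 4) .skip

theorem run_updMax {σ : State} {x A v : ℕ} {Q : State → Prop} (h4 : σ.var 4 = 0)
    (h44 : σ.var 44 = A) (hx : σ.var x = v) (hv : v ≤ Ω) (hΩ : 1 ≤ Ω)
    (hQ : ∀ τ, Agree [44] [] σ τ → τ.var 44 = (max A v : ℕ) → Q τ) :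
    Run f Ω (updMax x) σ 2 Q := by
  refine Run.ite (t := 1) (fun hT => ?_) (fun hT => ?_)
  · have hT' : A < v := by
      simp only [Test.Holds, h44, hx] at hT
      exact_mod_cast hT
    refine Run.binop (v : ℚ) (by simp [BinOp.eval, h4, hx]) (fit_nat hv hΩ) ?_
    refine hQ _ (Agree.setVar _ (by simp)) ?_
    simp [max_eq_right hT'.le]
  · have hT' : v ≤ A := by
      simp only [Test.Holds, h44, hx] at hT
      exact_mod_cast not_lt.1 hT
    refine Run.skip (hQ _ (Agree.refl _ _ _) ?_)
    rw [max_eq_left hT']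
    exact h44


/-- The length `K` of the rows, and the power of two by which values are divided, are computed. -/
def sizes : Prog :=
  .seq (.binop 44 .add 0 4) <|
  .seq (updMax 1) <|
  .seq (.unop 40 .num 2) <|
  .seq (updMax 40) <|
  .seq (.unop 40 .den 2) <|
  .seq (updMax 40) <|
  .seq (.for 5 19 0 <| .for 5 41 10 <|
    .seq (.load 42 0 41) <|
    .seq (.query 42 19 42) <|
    .seq (.unop 40 .num 42) <|
    .seq (updMax 40) <|
    .seq (.unop 40 .den 42) (updMax 40)) <|
  .seq (.const 12 1) <|
  .seq (.const 11 0) <|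
  .seq (.while (.le 12 44) (.seq (.binop 12 .mul 12 6) (.binop 11 .add 11 5))) <|
  .seq (.binop 13 .mul 12 12) <|
  .seq (.const 14 4) <|
  .seq (.binop 14 .add 14 0) <|
  .binop 14 .mul 14 11

theorem num_eq_natAbs {q : ℚ} (hq : 0 ≤ q) : (q.num : ℚ) = (q.num.natAbs : ℕ) := by
  rw [Nat.cast_natAbs, abs_of_nonneg (Rat.num_nonneg.2 hq)]

theorem run_updMax_then {σ : State} {x A v t : ℕ} {P : Prog} {Q : State → Prop} (h4 : σ.var 4 = 0)
    (h44 : σ.var 44 = A) (hx : σ.var x = v) (hv : v ≤ Ω) (hΩ : 1 ≤ Ω)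
    (hQ : ∀ τ, Agree [44] [] σ τ → τ.var 44 = (max A v : ℕ) → Run f Ω P τ t Q) :
    Run f Ω (.seq (updMax x) P) σ (t + 2) Q :=
  Run.comp (s := 2) (t := t) (Q := fun τ => τ.var 44 = (max A v : ℕ))
    (run_updMax h4 h44 hx hv hΩ fun _ _ h => h) (fun τ hτ h => hQ τ (hτ.mono (by simp [updMax, Prog.wvars])
      (by simp [updMax, Prog.warrs])) h) (by omega)

/-- The program does not know `L`. It measures the largest numerator or denominator that occurs at a
block point and takes the least `ℓ` with `A < 2 ^ ℓ`. `M` and `Λ` belong to the analysis only: they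
bound what the program finds, so that the time and the word length do not depend on `A`. -/
theorem run_sizes {σ : State} {u m M Λ : ℕ} {b : ℚ} {p : ℕ → ℕ} {g : ℕ → ℕ → ℚ}
    (h0 : σ.var 0 = n) (h1 : σ.var 1 = u) (h2 : σ.var 2 = b) (h4 : σ.var 4 = 0)
    (h5 : σ.var 5 = 1) (h6 : σ.var 6 = 2) (h10 : σ.var 10 = m)
    (hp : ∀ k ≤ m, σ.arr 0 k = p k) (hpΩ : ∀ k ≤ m, p k ≤ Ω)
    (hg : ∀ (j : Fin n), ∀ l < m, f j (p l : ℝ) = (g j l : ℝ))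
    (hg0 : ∀ j < n, ∀ l < m, 0 ≤ g j l)
    (hnum : ∀ j < n, ∀ l < m, (g j l).num.natAbs ≤ M) (hden : ∀ j < n, ∀ l < m, (g j l).den ≤ M)
    (hb0 : 0 ≤ b) (hbn : b.num.natAbs ≤ M) (hbd : b.den ≤ M) (hnM : n ≤ M) (huM : u ≤ M)
    (hmΩ : m ≤ Ω) (hMΩ : 4 * M ^ 2 ≤ Ω) (hKΩ : (n + 4) * Λ ≤ Ω) (hM : 1 ≤ M)
    (hΛ : 2 * M ≤ 2 ^ Λ) :
    Run f Ω sizes σ (n * (m * 10 + 4) + Λ * 3 + 19) (fun τ =>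
      ∃ A ℓ : ℕ, n ≤ A ∧ u ≤ A ∧ b.num.natAbs ≤ A ∧ b.den ≤ A ∧
      (∀ j < n, ∀ l < m, (g j l).num.natAbs ≤ A ∧ (g j l).den ≤ A) ∧ A < 2 ^ ℓ ∧ 2 ^ ℓ ≤ 2 * M ∧
      τ.var 13 = ((2 ^ ℓ) ^ 2 : ℕ) ∧ τ.var 14 = ((n + 4) * ℓ : ℕ)) := by
  have hM2 : 4 * M ≤ Ω := le_trans (by nlinarith) hMΩ
  have hΩ1 : 1 ≤ Ω := by omega
  -- the numbers `n`, `u` and `b`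
  refine Run.seq (Run.binop (n : ℚ) (by simp [BinOp.eval, h0, h4]) (fit_nat (by omega) hΩ1) ?_)
  refine run_updMax_then (A := n) (v := u) (by simpa using h4) (by simp) (by simpa using h1)
    (by omega) hΩ1 ?_
  intro σ₁ f₁ m₁
  have e2₁ : σ₁.var 2 = b := by rw [f₁.1 2 (by decide)]; simpa using h2
  refine Run.seq (Run.unop ((b.num.natAbs : ℕ) : ℚ)
    (by simp only [UnOp.eval, e2₁, num_eq_natAbs hb0]) (fit_nat (by omega) hΩ1) ?_)
  refine run_updMax_then (A := max n u) (v := b.num.natAbs)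
    (by
      have := f₁.1 4 (by decide)
      simpa [this] using h4) (by simpa using m₁) (by simp) (by omega) hΩ1 ?_
  intro σ₂ f₂ m₂
  have e2₂ : σ₂.var 2 = b := by rw [f₂.1 2 (by decide)]; simpa using e2₁
  refine Run.seq (Run.unop ((b.den : ℕ) : ℚ)
    (by simp only [UnOp.eval, e2₂]) (fit_nat (by omega) hΩ1) ?_)
  have e4₂ : σ₂.var 4 = 0 := by
    rw [f₂.1 4 (by decide), setVar_var, if_neg (by decide), f₁.1 4 (by decide)]
    simpa using h4
  refine run_updMax_then (A := max (max n u) b.num.natAbs) (v := b.den)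
    (by simpa using e4₂) (by simpa using m₂) (by simp) (by omega) hΩ1 ?_
  intro σ₃ f₃ m₃
  have hσ₃ : Agree [44, 40] [] σ σ₃ := by
    have a₁ : Agree [44, 40] [] σ σ₁ := (Agree.setVar (d := 44) (n : ℚ) (by simp)).trans
      (f₁.mono (by simp) (by simp))
    have a₂ : Agree [44, 40] [] σ₁ σ₂ := (Agree.setVar (d := 40) _ (by simp)).trans
      (f₂.mono (by simp) (by simp))
    have a₃ : Agree [44, 40] [] σ₂ σ₃ := (Agree.setVar (d := 40) _ (by simp)).trans
      (f₃.mono (by simp) (by simp))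
    exact (a₁.trans a₂).trans a₃
  set A₀ : ℕ := max (max (max n u) b.num.natAbs) b.den with hA₀
  have e0 : σ₃.var 0 = n := by rw [hσ₃.1 0 (by decide), h0]
  have e4 : σ₃.var 4 = 0 := by rw [hσ₃.1 4 (by decide), h4]
  have e5 : σ₃.var 5 = 1 := by rw [hσ₃.1 5 (by decide), h5]
  have e6 : σ₃.var 6 = 2 := by rw [hσ₃.1 6 (by decide), h6]
  have e10 : σ₃.var 10 = m := by rw [hσ₃.1 10 (by decide), h10]
  have hp₃ : ∀ k ≤ m, σ₃.arr 0 k = p k := by rw [hσ₃.2 0 (by decide)]; exact hp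
  -- the values of the functions
  refine Run.comp (Run.for (t := m * 10 + 2) (M := n) (fun j τ => ∃ A : ℕ, τ.var 44 = A ∧
    A₀ ≤ A ∧ A ≤ M ∧ ∀ i < j, ∀ l < m, (g i l).num.natAbs ≤ A ∧ (g i l).den ≤ A) e0 e5
    (by omega) hΩ1 (by decide) ⟨A₀, by simpa using m₃, le_rfl, by omega, by simp⟩ ?_) ?_
    (t := Λ * 3 + 7) (by show n * (m * 10 + 4) + 2 + (Λ * 3 + 7) ≤ _; omega)
  · rintro j hj τ hτ hjv ⟨A, hA, hA0, hAM, hI⟩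
    refine Run.mono (Run.for (t := 8) (M := m) (fun k ρ => ∃ A : ℕ, ρ.var 44 = A ∧
      A₀ ≤ A ∧ A ≤ M ∧ (∀ i < j, ∀ l < m, (g i l).num.natAbs ≤ A ∧ (g i l).den ≤ A) ∧
      ∀ l < k, (g j l).num.natAbs ≤ A ∧ (g j l).den ≤ A)
      (by rw [hτ.1 10 (by decide), e10]) (by rw [hτ.1 5 (by decide), e5]) hmΩ hΩ1 (by decide)
      ⟨A, by simpa using hA, hA0, hAM, hI, by simp⟩ ?_) le_rfl ?_
    · rintro k hk ρ hρ hkv ⟨A, hA, hA0, hAM, hI, hI'⟩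
      have r4 : ρ.var 4 = 0 := by rw [hρ.1 4 (by decide), hτ.1 4 (by decide), e4]
      have r19 : ρ.var 19 = j := by rw [hρ.1 19 (by decide), hjv]
      have hn := hnum j hj k hk
      have hd := hden j hj k hk
      have hcell : ρ.arr 0 k = p k := by
        rw [hρ.2 0 (by decide), hτ.2 0 (by decide), hp₃ k hk.le]
      refine Run.seq (Run.load k (p k) hkv hcell (fit_nat (hpΩ k hk.le) hΩ1) ?_)
      refine Run.seq (Run.query ⟨j, hj⟩ (g j k) (by simpa using r19)
        (by simpa using hg ⟨j, hj⟩ k hk) ⟨by omega, by omega⟩ ?_)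
      refine Run.seq (Run.unop (((g j k).num.natAbs : ℕ) : ℚ)
        (by simp only [UnOp.eval, setVar_var, if_true, num_eq_natAbs (hg0 j hj k hk)])
        (fit_nat (by omega) hΩ1) ?_)
      refine run_updMax_then (A := A) (v := (g j k).num.natAbs) (by simpa using r4)
        (by simpa using hA) (by simp) (by omega) hΩ1 ?_
      intro π fπ mπ
      have p42 : π.var 42 = g j k := by rw [fπ.1 42 (by decide)]; simp
      have p4 : π.var 4 = 0 := by rw [fπ.1 4 (by decide)]; simpa using r4
      refine Run.seq (Run.unop (((g j k).den : ℕ) : ℚ)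
        (by simp only [UnOp.eval, p42]) (fit_nat (by omega) hΩ1) ?_)
      refine run_updMax (A := max A (g j k).num.natAbs) (v := (g j k).den) (by simpa using p4)
        (by simpa using mπ) (by simp) (by omega) hΩ1 ?_
      intro π' _ mπ' _
      refine ⟨max (max A (g j k).num.natAbs) (g j k).den, by simpa using mπ', by omega, by omega,
        fun i hi l hl => ?_, fun l hl => ?_⟩
      · have := hI i hi l hl
        omega
      · rcases Nat.lt_succ_iff_lt_or_eq.mp hl with h | rfl
        · have := hI' l h
          omega
        · omega
    · rintro ρ _ ⟨A, hA, hA0, hAM, hI, hI'⟩ _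
      refine ⟨A, by simpa using hA, hA0, hAM, fun i hi => ?_⟩
      rcases Nat.lt_succ_iff_lt_or_eq.mp hi with h | rfl
      · exact hI i h
      · exact hI'
  rintro σ₄ f₄ ⟨A, hA, hA0, hAM, hI⟩
  have q0 : σ₄.var 0 = n := by rw [f₄.1 0 (by decide), e0]
  have q5 : σ₄.var 5 = 1 := by rw [f₄.1 5 (by decide), e5]
  have q6 : σ₄.var 6 = 2 := by rw [f₄.1 6 (by decide), e6]
  -- the power of two
  have hex : ∃ ℓ, A < 2 ^ ℓ := ⟨A, Nat.lt_two_pow_self⟩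
  classical
  set ℓ : ℕ := Nat.find hex with hℓ
  have hℓ1 : A < 2 ^ ℓ := Nat.find_spec hex
  have hℓ2 : ∀ k < ℓ, 2 ^ k ≤ A := fun k hk => not_lt.1 (Nat.find_min hex hk)
  have hℓ0 : ℓ ≠ 0 := by
    intro h
    rw [h] at hℓ1
    have := b.den_pos
    omega
  -- By minimality of `ℓ` the preceding power of two is at most `A`, hence at most `M`.
  have hℓM : 2 ^ ℓ ≤ 2 * M := by
    obtain ⟨k, hk⟩ := Nat.exists_eq_succ_of_ne_zero hℓ0
    have := hℓ2 k (by omega)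
    rw [hk, pow_succ]
    omega
  have hℓΛ : ℓ ≤ Λ := (Nat.pow_le_pow_iff_right (by norm_num)).1 (hℓM.trans hΛ)
  have hℓ4 : (n + 4) * ℓ ≤ Ω := le_trans (Nat.mul_le_mul_left _ hℓΛ) hKΩ
  have fit1 : Fit Ω 1 := by simpa using fit_nat (k := 1) hΩ1 hΩ1
  have fit0 : Fit Ω 0 := by simpa using fit_nat (k := 0) (Nat.zero_le _) hΩ1
  refine Run.seq (Run.const fit1 ?_)
  refine Run.seq (Run.const fit0 ?_)
  refine Run.comp (Run.while (t := 2) ℓ (fun k τ => τ.var 12 = (2 ^ k : ℕ) ∧ τ.var 11 = k)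
    (by simp) ?_ ?_) ?_ (t := 4) (by omega)
  · rintro k hk τ hτ ⟨h12, h11⟩
    have h2k : 2 ^ k ≤ A := hℓ2 k hk
    refine ⟨?_, ?_⟩
    · show τ.var 12 ≤ τ.var 44
      rw [h12, hτ.1 44 (by decide)]
      have : ((2 ^ k : ℕ) : ℚ) ≤ (A : ℕ) := by exact_mod_cast h2k
      simpa [hA] using this
    · have t5 : τ.var 5 = 1 := by rw [hτ.1 5 (by decide)]; simpa using q5
      have t6 : τ.var 6 = 2 := by rw [hτ.1 6 (by decide)]; simpa using q6
      have hpow : 2 ^ (k + 1) = 2 ^ k * 2 := pow_succ _ _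
      refine Run.seq (Run.binop ((2 ^ (k + 1) : ℕ) : ℚ)
        (by simp [BinOp.eval, h12, t6, pow_succ]) (fit_nat (by omega) hΩ1) ?_)
      refine Run.binop ((k + 1 : ℕ) : ℚ) (by simp [BinOp.eval, h11, t5])
        (fit_nat (by have := Nat.lt_two_pow_self (n := k); omega) hΩ1) ⟨by simp, by simp⟩
  · rintro τ hτ ⟨h12, _⟩
    show ¬ τ.var 12 ≤ τ.var 44
    rw [h12, hτ.1 44 (by decide)]
    have : ((A : ℕ) : ℚ) < (2 ^ ℓ : ℕ) := by exact_mod_cast hℓ1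
    simpa [hA] using this
  rintro τ hτ ⟨h12, h11⟩
  have t0 : τ.var 0 = n := by rw [hτ.1 0 (by decide)]; simpa using q0
  have hn4 : n + 4 ≤ Ω := le_trans (by nlinarith [Nat.pos_of_ne_zero hℓ0]) hℓ4
  have hX : (2 ^ ℓ) ^ 2 ≤ Ω := le_trans (Nat.pow_le_pow_left hℓM 2) (by nlinarith)
  refine Run.seq (Run.binop (((2 ^ ℓ) ^ 2 : ℕ) : ℚ) (by simp [BinOp.eval, h12]; ring)
    (fit_nat hX hΩ1) ?_)
  refine Run.seq (Run.const (by simpa using fit_nat (k := 4) (by omega : 4 ≤ Ω) hΩ1) ?_)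
  refine Run.seq (Run.binop ((n + 4 : ℕ) : ℚ) (by simp [BinOp.eval, t0]; ring)
    (fit_nat hn4 hΩ1) ?_)
  refine Run.binop (((n + 4) * ℓ : ℕ) : ℚ) (by simp [BinOp.eval, h11]) (fit_nat hℓ4 hΩ1) ?_
  exact ⟨A, ℓ, by omega, by omega, by omega, by omega, hI, hℓ1, hℓM, by simp, by simp⟩

end RatRAM

/-! ### The exact count, the count over blocks and the count with rounded values. -/

section BlockCount
open Finset

/-- The number of points `(x_0, …, x_{j - 1})`, each coordinate ranging over `m` indices with the
weights `d`, with `∑ i, y i (x i) ≤ c`, each point counted with the product of its weights. -/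
def blockCnt {A : Type*} [AddCommGroup A] [LinearOrder A] (m : ℕ) (d : ℕ → ℤ) (y : ℕ → ℕ → A) :
    ℕ → A → ℤ
  | 0, c => if 0 ≤ c then 1 else 0
  | j + 1, c => ∑ l ∈ range m, d l * blockCnt m d y j (c - y j l)

section
variable {A : Type*} [AddCommGroup A] [LinearOrder A] {m : ℕ} {d : ℕ → ℤ} {y : ℕ → ℕ → A}

theorem blockCnt_nonneg (hd : ∀ l < m, 0 ≤ d l) (j : ℕ) (c : A) : 0 ≤ blockCnt m d y j c := by
  induction j generalizing c with
  | zero => rw [blockCnt]; split_ifs <;> simp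
  | succ j ih =>
    rw [blockCnt]
    exact sum_nonneg fun l hl => mul_nonneg (hd l (mem_range.1 hl)) (ih _)

theorem blockCnt_mono [IsOrderedAddMonoid A] (hd : ∀ l < m, 0 ≤ d l) (j : ℕ) :
    Monotone (blockCnt m d y j) := by
  induction j with
  | zero =>
    intro c c' hc
    simp only [blockCnt]
    split_ifs with h h'
    · exact le_rfl
    · exact absurd (h.trans hc) h'
    · simp
    · exact le_rfl
  | succ j ih =>
    intro c c' hc
    simp only [blockCnt]
    exact sum_le_sum fun l hl => mul_le_mul_of_nonneg_left
      (ih (sub_le_sub_right hc _)) (hd l (mem_range.1 hl))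

end

/-- The recursion peels off the last coordinate, which corresponds to `Fin.snocEquiv`. -/
theorem blockCnt_one_eq_sum {u : ℕ} (g : ℕ → ℕ → ℚ) (n : ℕ) (c : ℚ) :
    blockCnt u (fun _ => 1) g n c =
      ∑ x : Fin n → Fin u, if ∑ j : Fin n, g j (x j) ≤ c then 1 else 0 := by
  induction n generalizing c with
  | zero => simp [blockCnt]
  | succ n ih =>
    rw [blockCnt, ← (Fin.snocEquiv fun _ : Fin (n + 1) => Fin u).sum_comp, Fintype.sum_prod_type,
      Finset.sum_range]
    refine Finset.sum_congr rfl fun a _ => ?_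
    rw [one_mul, ih]
    refine Finset.sum_congr rfl fun x _ => ?_
    simp only [Fin.snocEquiv, Equiv.coe_fn_mk, Fin.sum_univ_castSucc, Fin.snoc_castSucc,
      Fin.snoc_last, Fin.val_castSucc, Fin.val_last]
    congr 1
    rw [le_sub_iff_add_le]

theorem ncard_solutionSet {n u : ℕ} {f : Fin n → ℝ → ℝ} {b : ℚ} {g : ℕ → ℕ → ℚ}
    (hg : ∀ (j : Fin n) (x : ℕ), f j (x : ℝ) = (g j x : ℝ)) :
    ((solutionSet f b u).ncard : ℤ) = blockCnt u (fun _ => 1) g n b := by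
  rw [blockCnt_one_eq_sum]
  have : solutionSet f b u = ((univ.filter fun x : Fin n → Fin u => ∑ j : Fin n, g j (x j) ≤ b :
      Finset (Fin n → Fin u)) : Set (Fin n → Fin u)) := by
    ext x
    simp only [solutionSet, Set.mem_ofPred_eq, hg, coe_filter, mem_univ, true_and]
    exact_mod_cast Iff.rfl
  rw [this, Set.ncard_coe_finset, Finset.sum_ite]
  simp

/-- The division of `{0, …, u - 1}` into the `m` blocks `{p l, …, p (l + 1) - 1}`, the lengths of
which grow at most with the factor `1 + 1 / E`. -/
structure Blocks (E u m : ℕ) (p : ℕ → ℕ) : Prop where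
  zero : p 0 = 0
  last : p m = u
  lt : ∀ l < m, p l < p (l + 1)
  le : ∀ l < m, E * p (l + 1) ≤ (E + 1) * (p l + 1)

/-- On each block an antitone function is at most its value at the first point. -/
theorem Blocks.sum_le {E u m : ℕ} {p : ℕ → ℕ} (h : Blocks E u m p) {ψ : ℕ → ℤ}
    (hψ : Antitone ψ) :
    ∑ x ∈ range u, ψ x ≤ ∑ l ∈ range m, ((p (l + 1) : ℤ) - p l) * ψ (p l) := by
  have key : ∀ k ≤ m, ∑ x ∈ range (p k), ψ x ≤
      ∑ l ∈ range k, ((p (l + 1) : ℤ) - p l) * ψ (p l) := by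
    intro k
    induction k with
    | zero => simp [h.zero]
    | succ k ih =>
      intro hk
      have hlt := h.lt k hk
      rw [sum_range_succ, ← sum_range_add_sum_Ico _ hlt.le]
      refine add_le_add (ih (by omega)) ?_
      refine (sum_le_card_nsmul _ _ (ψ (p k)) fun x hx => hψ (mem_Ico.1 hx).1).trans ?_
      rw [Nat.card_Ico, nsmul_eq_mul, Nat.cast_sub hlt.le]
  have := key m le_rfl
  rwa [h.last] at this

/-- A block on which `ψ` drops sharply can lose a lot by itself, but then earlier points, where `ψ`
is at least as large, make up for it. The induction therefore keeps the reserve `p k * ψ (p k)`,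
which is dropped at the end. -/
theorem Blocks.le_sum {E u m : ℕ} {p : ℕ → ℕ} (h : Blocks E u m p) {ψ : ℕ → ℤ}
    (hψ : Antitone ψ) (h0 : ∀ x, 0 ≤ ψ x) :
    E * ∑ l ∈ range m, ((p (l + 1) : ℤ) - p l) * ψ (p l) ≤ (E + 1) * ∑ x ∈ range u, ψ x := by
  have key : ∀ k ≤ m, E * ∑ l ∈ range k, ((p (l + 1) : ℤ) - p l) * ψ (p l) + p k * ψ (p k) ≤
      (E + 1) * ∑ x ∈ range (p k), ψ x := by
    intro k
    induction k with
    | zero => simp [h.zero]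
    | succ k ih =>
      intro hk
      have hlt := h.lt k hk
      have hle : (E : ℤ) * p (k + 1) ≤ (E + 1) * (p k + 1) := by exact_mod_cast h.le k hk
      have ih' := ih (by omega)
      -- The first point of the block is kept exactly; the others are bounded below by the value at
      -- the next block point.
      have hsum : ψ (p k) + ((p (k + 1) : ℤ) - p k - 1) * ψ (p (k + 1)) ≤
          ∑ x ∈ Ico (p k) (p (k + 1)), ψ x := by
        rw [sum_eq_sum_Ico_succ_bot hlt]
        refine add_le_add le_rfl ?_
        have := card_nsmul_le_sum (Ico (p k + 1) (p (k + 1))) ψ (ψ (p (k + 1)))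
          fun x hx => hψ (mem_Ico.1 hx).2.le
        rw [Nat.card_Ico, nsmul_eq_mul, Nat.cast_sub hlt] at this
        push_cast at this
        linarith
      have hab := hψ hlt.le
      rw [sum_range_succ, ← sum_range_add_sum_Ico _ hlt.le]
      have hE : (0 : ℤ) ≤ E := by positivity
      -- After inserting `hsum`, the slack in the step is this coefficient times `ψ (p k) - ψ (p (k
      -- + 1))`. That it is nonnegative is exactly the growth condition on the blocks.
      have hc : 0 ≤ (p k : ℤ) + E + 1 - E * (p (k + 1) - p k) := by linarith
      have h1 := mul_le_mul_of_nonneg_left hab hc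
      have h2 := mul_le_mul_of_nonneg_left hsum (by linarith : (0 : ℤ) ≤ E + 1)
      linarith
  have := key m le_rfl
  rw [h.last] at this
  have h1 : 0 ≤ (u : ℤ) * ψ u := mul_nonneg (by positivity) (h0 u)
  linarith

/-- The count of the earlier coordinates is monotone in the bound and `g` is monotone, so it is
antitone in the last coordinate. Replacing the coordinates one by one applies the one-dimensional
estimate; in the companion upper bound each coordinate costs one factor `1 + 1 / E`. -/
theorem Blocks.cnt_le {E u m : ℕ} {p : ℕ → ℕ} (h : Blocks E u m p) {g : ℕ → ℕ → ℚ} {n : ℕ}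
    (hg : ∀ j < n, Monotone (g j)) (c : ℚ) :
    blockCnt u (fun _ => 1) g n c ≤
      blockCnt m (fun l => (p (l + 1) : ℤ) - p l) (fun j l => g j (p l)) n c := by
  induction n generalizing c with
  | zero => exact le_rfl
  | succ n ih =>
    simp only [blockCnt, one_mul]
    refine (h.sum_le (ψ := fun x => blockCnt u (fun _ => 1) g n (c - g n x)) fun x x' hx =>
      blockCnt_mono (by simp) n (sub_le_sub_left (hg n (by omega) hx) _)).trans ?_
    refine sum_le_sum fun l hl => mul_le_mul_of_nonneg_left
      (ih (fun j hj => hg j (by omega)) _) ?_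
    have := h.lt l (mem_range.1 hl)
    omega

theorem Blocks.le_cnt {E u m : ℕ} {p : ℕ → ℕ} (h : Blocks E u m p) {g : ℕ → ℕ → ℚ} {n : ℕ}
    (hg : ∀ j < n, Monotone (g j)) (c : ℚ) :
    (E : ℤ) ^ n * blockCnt m (fun l => (p (l + 1) : ℤ) - p l) (fun j l => g j (p l)) n c ≤
      (E + 1) ^ n * blockCnt u (fun _ => 1) g n c := by
  induction n generalizing c with
  | zero => exact le_of_eq (by simp [blockCnt])
  | succ n ih =>
    simp only [blockCnt, one_mul]
    have h1 := h.le_sum (ψ := fun x => blockCnt u (fun _ => 1) g n (c - g n x)) (fun x x' hx =>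
      blockCnt_mono (by simp) n (sub_le_sub_left (hg n (by omega) hx) _))
      (fun x => blockCnt_nonneg (by simp) _ _)
    have h2 : (E : ℤ) ^ n * ∑ l ∈ range m, ((p (l + 1) : ℤ) - p l) *
        blockCnt m (fun l => (p (l + 1) : ℤ) - p l) (fun j l => g j (p l)) n (c - g n (p l)) ≤
        (E + 1) ^ n * ∑ l ∈ range m, ((p (l + 1) : ℤ) - p l) *
        blockCnt u (fun _ => 1) g n (c - g n (p l)) := by
      rw [mul_sum, mul_sum]
      refine sum_le_sum fun l hl => ?_
      have hd : 0 ≤ (p (l + 1) : ℤ) - p l := by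
        have := h.lt l (mem_range.1 hl)
        omega
      have := mul_le_mul_of_nonneg_left (ih (fun j hj => hg j (by omega)) (c - g n (p l))) hd
      linarith
    have h3 := mul_le_mul_of_nonneg_left h2 (by positivity : (0 : ℤ) ≤ E)
    have h4 := mul_le_mul_of_nonneg_left h1 (by positivity : (0 : ℤ) ≤ (E + 1) ^ n)
    rw [pow_succ, pow_succ]
    linarith

/-- Rounding the values and the bound down to multiples of `1 / M` does not change the count, if
`M` is large in comparison with the denominators. -/
theorem blockCnt_floor {m n A M : ℕ} {d : ℕ → ℤ} {y : ℕ → ℕ → ℚ}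
    (hden : ∀ j < n, ∀ l < m, (y j l).den ≤ A) (j : ℕ) (hj : j ≤ n) (c : ℚ) (c' : ℤ) (Q : ℕ)
    (hQ0 : 0 < Q) (hQ : ∃ z : ℤ, c * Q = z) (hM : Q * A ^ j * (n + 1) ≤ M)
    (hlo : -((n : ℚ) - j) ≤ c * M - c') (hhi : c * M - c' < 1) :
    blockCnt m d y j c = blockCnt m d (fun j l => ⌊y j l * M⌋) j c' := by
  -- `c` is what remains of the bound after the coordinates from `j` on have been chosen, `c'` its
  -- rounded version, and `Q` a common denominator of `c`. Each chosen coordinate lowers `c * M -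
  -- c'` by less than 1, which gives the range in `hlo` and `hhi`.
  induction j generalizing c c' Q with
  | zero =>
    simp only [blockCnt]
    congr 1
    rw [eq_iff_iff]
    obtain ⟨z, hz⟩ := hQ
    have hQ0' : (0 : ℚ) < Q := by exact_mod_cast hQ0
    have hM' : (Q : ℚ) * (n + 1) ≤ M := by
      rw [pow_zero, mul_one] at hM
      exact_mod_cast hM
    have hM0 : (0 : ℚ) < M := lt_of_lt_of_le (by positivity) hM'
    constructor
    · intro hc
      by_contra hc'
      have : (c' : ℚ) ≤ -1 := by exact_mod_cast (by omega : c' ≤ -1)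
      have : 0 ≤ c * M := by positivity
      linarith
    · intro hc'
      have h1 : (0 : ℚ) ≤ c' := by exact_mod_cast hc'
      by_contra hc
      have hz1 : z ≤ -1 := by
        have : (z : ℚ) < 0 := by rw [← hz]; exact mul_neg_of_neg_of_pos (not_le.1 hc) hQ0'
        have : z < 0 := by exact_mod_cast this
        omega
      -- A negative multiple of `1 / Q` is at most `-1 / Q`, so `c * M ≤ -(n + 1)`. The total
      -- rounding error is at most `n` and cannot make `c'` nonnegative.
      have hz2 : c * Q ≤ -1 := by rw [hz]; exact_mod_cast hz1
      have h2 : c * M ≤ c * (Q * (n + 1)) := mul_le_mul_of_nonpos_left hM' (not_le.1 hc).le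
      have h3 : c * (Q * (n + 1)) ≤ -1 * (n + 1) := by
        rw [← mul_assoc]
        exact mul_le_mul_of_nonneg_right hz2 (by positivity)
      push_cast at hlo
      linarith
  | succ j ih =>
    simp only [blockCnt]
    refine sum_congr rfl fun l hl => ?_
    have hl' := mem_range.1 hl
    congr 1
    have hd := hden j (by omega) l hl'
    have hfl := Int.floor_le (y j l * M)
    have hfl' := Int.lt_floor_add_one (y j l * M)
    refine ih (by omega) (c - y j l) _ (Q * (y j l).den) (Nat.mul_pos hQ0 (y j l).den_pos) ?_ ?_ ?_ ?_
    · obtain ⟨z, hz⟩ := hQ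
      refine ⟨z * (y j l).den - (y j l).num * Q, ?_⟩
      have := Rat.mul_den_eq_num (y j l)
      push_cast
      linear_combination ((y j l).den : ℚ) * hz - (Q : ℚ) * this
    · refine le_trans ?_ hM
      rw [pow_succ]
      calc Q * (y j l).den * A ^ j * (n + 1) ≤ Q * A * A ^ j * (n + 1) := by gcongr
        _ = _ := by ring
    · push_cast at hlo ⊢
      linarith
    · push_cast
      linarith

end BlockCount

/-! ### The error of the lists, layer by layer. -/

section ListInvariant
open Finset

theorem sum_range_mul_div_mod {M : Type*} [AddCommMonoid M] (F : ℕ → ℕ → M) (S : ℕ) {m : ℕ}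
    (hm : 0 < m) :
    ∑ i ∈ range (S * m), F (i / m) (i % m) = ∑ k ∈ range S, ∑ l ∈ range m, F k l := by
  induction S with
  | zero => simp
  | succ S ih =>
    rw [sum_range_succ, ← ih, Nat.succ_mul, sum_range_add]
    congr 1
    refine sum_congr rfl fun l hl => ?_
    have hl' := mem_range.1 hl
    rw [add_comm (S * m), Nat.add_mul_div_right _ _ hm, Nat.add_mul_mod_self_right,
      Nat.div_eq_of_lt hl', Nat.mod_eq_of_lt hl', zero_add]

theorem list_sum_map_range {M : Type*} [AddCommMonoid M] (F : ℕ → M) (n : ℕ) :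
    ((List.range n).map F).sum = ∑ i ∈ range n, F i := by
  induction n with
  | zero => simp
  | succ n ih => rw [List.range_succ, List.map_append, List.sum_append, ih, sum_range_succ]; simp

theorem sum_pair_weights {m u : ℕ} {d : ℕ → ℤ} (hm : 0 < m) (hdu : ∑ l ∈ range m, d l = u) (S : ℕ)
    (wt : ℕ → ℤ) : ((List.range (S * m)).map fun i => wt (i / m) * d (i % m)).sum =
      (∑ k ∈ range S, wt k) * u := by
  rw [list_sum_map_range, sum_range_mul_div_mod (fun k l => wt k * d l) S hm, sum_mul]
  exact sum_congr rfl fun k _ => by rw [← mul_sum, hdu]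

/-- One step of the recursion of `blockCnt`, with the step function in place of the count: the
ungrouped list of pairs represents it exactly, whatever its order. -/
theorem listFun_pairs {m S : ℕ} {d val wt y : ℕ → ℤ} (hm : 0 < m) {l : List ℕ}
    (hl : l.Perm (List.range (S * m))) (c : ℤ) :
    listFun (l.map fun i => (val (i / m) + y (i % m), wt (i / m) * d (i % m))) c =
      ∑ i ∈ range m, d i * stepFun S val wt (c - y i) := by
  rw [listFun, List.map_map, (hl.map _).sum_eq, list_sum_map_range]
  simp only [Function.comp_def]
  rw [sum_range_mul_div_mod (fun k l => if val k + y l ≤ c then wt k * d l else 0) S hm, sum_comm]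
  refine sum_congr rfl fun i _ => ?_
  rw [stepFun, mul_sum]
  refine sum_congr rfl fun k _ => ?_
  simp only [le_sub_iff_add_le, mul_ite, mul_zero, mul_comm]

/-- The list of `S` entries approximates the counting function of the first `j` coordinates within
the factor `(1 + 1 / E) ^ j`. -/
structure Approximates (E u m : ℕ) (d : ℕ → ℤ) (y : ℕ → ℕ → ℤ) (Y : ℤ) (j S : ℕ) (val wt : ℕ → ℤ) :
    Prop where
  lower : ∀ c, blockCnt m d y j c ≤ stepFun S val wt c
  upper : ∀ c, (E : ℤ) ^ j * stepFun S val wt c ≤ (E + 1) ^ j * blockCnt m d y j c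
  wt_sum : ∑ k ∈ range S, wt k = (u : ℤ) ^ j
  wt_pos : ∀ k < S, 0 < wt k
  val_nonneg : ∀ k < S, 0 ≤ val k
  val_le : ∀ k < S, val k ≤ j * Y

theorem Approximates.zero (E u m : ℕ) (d : ℕ → ℤ) (y : ℕ → ℕ → ℤ) (Y : ℤ) :
    Approximates E u m d y Y 0 1 (fun _ => 0) (fun _ => 1) := by
  constructor <;> simp [blockCnt, stepFun]

/-- The recursion step is linear with positive weights, so the factor of the old list passes to the
list of pairs, and grouping multiplies it by `1 + 1 / E` once more. The total weight is multiplied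
by the sum `u` of all block lengths. -/
theorem Approximates.succ {E u m : ℕ} {d : ℕ → ℤ} {y : ℕ → ℕ → ℤ} {Y : ℤ} {j S T : ℕ}
    {val wt val' wt' : ℕ → ℤ} {cum first : ℤ} {l : List ℕ}
    (h : Approximates E u m d y Y j S val wt) (hm : 0 < m) (hd : ∀ i < m, 0 < d i)
    (hdu : ∑ l ∈ range m, d l = u) (hy0 : ∀ i < m, 0 ≤ y j i) (hyY : ∀ i < m, y j i ≤ Y)
    (hl : l.Perm (List.range (S * m)))
    (hG : Grouping E (l.map fun i => (val (i / m) + y j (i % m), wt (i / m) * d (i % m))) T val' wt'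
      cum first) :
    Approximates E u m d y Y (j + 1) T val' wt' := by
  have hmem : ∀ k < T, ∃ k' < S, ∃ i < m, val' k = val k' + y j i := by
    intro k hk
    obtain ⟨a, ha, e⟩ := hG.val_mem k hk
    obtain ⟨i, hi, rfl⟩ := List.mem_map.1 ha
    have hi' : i < S * m := List.mem_range.1 (hl.mem_iff.1 hi)
    exact ⟨i / m, Nat.div_lt_of_lt_mul (by rwa [mul_comm]), i % m, Nat.mod_lt _ hm, e⟩
  constructor
  · intro c
    refine le_trans ?_ (hG.lower c)
    rw [listFun_pairs hm hl, blockCnt]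
    exact sum_le_sum fun i hi => mul_le_mul_of_nonneg_left (h.lower _)
      (hd i (mem_range.1 hi)).le
  · intro c
    have h1 := hG.upper c
    rw [listFun_pairs hm hl] at h1
    have h2 : (E : ℤ) ^ j * ∑ i ∈ range m, d i * stepFun S val wt (c - y j i) ≤
        (E + 1) ^ j * blockCnt m d y (j + 1) c := by
      rw [blockCnt, mul_sum, mul_sum]
      refine sum_le_sum fun i hi => ?_
      have := mul_le_mul_of_nonneg_left (h.upper (c - y j i)) (hd i (mem_range.1 hi)).le
      linarith
    have h3 := mul_le_mul_of_nonneg_left h1 (by positivity : (0 : ℤ) ≤ (E : ℤ) ^ j)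
    have h4 := mul_le_mul_of_nonneg_left h2 (by positivity : (0 : ℤ) ≤ (E : ℤ) + 1)
    rw [pow_succ, pow_succ]
    linarith
  · rw [hG.wt_sum, hG.cum_eq, List.map_map, (hl.map _).sum_eq]
    simp only [Function.comp_def]
    rw [sum_pair_weights hm hdu, h.wt_sum, pow_succ]
  · exact hG.wt_pos
  · intro k hk
    obtain ⟨k', hk', i, hi, e⟩ := hmem k hk
    rw [e]
    exact add_nonneg (h.val_nonneg k' hk') (hy0 i hi)
  · intro k hk
    obtain ⟨k', hk', i, hi, e⟩ := hmem k hk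
    have h1 := h.val_le k' hk'
    have h2 := hyY i hi
    rw [e]
    push_cast
    linarith

end ListInvariant

/-! ### The numbers of blocks and of groups. -/

/-- By Bernoulli `(1 + 1 / E) ^ E ≥ 2`, so more than `E * q` factors `1 + 1 / E` exceed `2 ^ q`.
This bounds both the number of blocks and the number of groups. -/
theorem le_mul_of_pow_le {E k q : ℕ} (hE : 0 < E) (h : (E + 1) ^ k ≤ E ^ k * 2 ^ q) :
    k ≤ E * q := by
  by_contra! hk
  obtain ⟨r, rfl⟩ := Nat.exists_eq_add_of_lt hk
  have h1 : 2 * E ^ E ≤ (E + 1) ^ E := by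
    have hE' : (0 : ℚ) < E := by exact_mod_cast hE
    have := one_add_mul_le_pow (a := (1 : ℚ) / E) 
      (le_trans (by norm_num) (by positivity : (0 : ℚ) ≤ 1 / E)) E
    have h2 : (1 + 1 / (E : ℚ)) ^ E * E ^ E = (E + 1) ^ E := by
      rw [← mul_pow]
      congr 1
      field_simp
    have h3 := mul_le_mul_of_nonneg_right this (by positivity : (0 : ℚ) ≤ (E : ℚ) ^ E)
    rw [h2, mul_one_div_cancel hE'.ne'] at h3
    have : (2 : ℚ) * E ^ E ≤ (E + 1) ^ E := by linarith
    exact_mod_cast this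
  have h2 : E ^ (E * q) * 2 ^ q ≤ (E + 1) ^ (E * q) := by
    rw [pow_mul, pow_mul, ← mul_pow, mul_comm]
    exact Nat.pow_le_pow_left h1 q
  have h3 : E ^ (r + 1) < (E + 1) ^ (r + 1) := Nat.pow_lt_pow_left (Nat.lt_succ_self E) (by omega)
  rw [add_assoc, pow_add, pow_add E (E * q)] at h
  have h4 : E ^ (E * q) * 2 ^ q * (E + 1) ^ (r + 1) ≤ E ^ (E * q) * 2 ^ q * E ^ (r + 1) :=
    (Nat.mul_le_mul_right _ h2).trans (h.trans (by rw [mul_right_comm]))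
  exact absurd (Nat.le_of_mul_le_mul_left h4 (by positivity)) (not_le.2 h3)

theorem blocks_blockPoint {E u m : ℕ} (hm : blockPoint E u m = u)
    (hlt : ∀ k < m, blockPoint E u k < u) : Blocks E u m (blockPoint E u) where
  zero := rfl
  last := hm
  lt k hk := blockPoint_lt_succ (hlt k hk)
  le k hk := by
    rw [blockPoint]
    have := Nat.mul_div_le (blockPoint E u k + 1) E
    calc E * min u (blockPoint E u k + 1 + (blockPoint E u k + 1) / E)
        ≤ E * (blockPoint E u k + 1 + (blockPoint E u k + 1) / E) :=
          Nat.mul_le_mul_left _ (min_le_right _ _)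
      _ ≤ _ := by linarith

/-- Before the cut at `u` takes effect, rounding down in `(p + 1) / E` loses less than 1. Hence the
block point plus one grows at least by the factor `1 + 1 / E` per block. -/
theorem pow_le_blockPoint {E u m : ℕ} (hE : 0 < E) (hlt : ∀ k < m, blockPoint E u k < u) (k : ℕ)
    (hk : k < m) : (E + 1) ^ k ≤ E ^ k * (blockPoint E u k + 1) := by
  induction k with
  | zero => simp [blockPoint]
  | succ k ih =>
    have h1 := ih (by omega)
    have h2 := hlt _ hk
    rw [blockPoint] at h2 ⊢
    rw [min_eq_right ((min_lt_iff.1 h2).resolve_left (lt_irrefl u)).le]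
    have h3 := Nat.lt_mul_div_succ (blockPoint E u k + 1) hE
    have h4 : (E + 1) * (blockPoint E u k + 1) ≤
        E * (blockPoint E u k + 1 + (blockPoint E u k + 1) / E + 1) := by linarith
    calc (E + 1) ^ (k + 1) = (E + 1) * (E + 1) ^ k := by ring
      _ ≤ (E + 1) * (E ^ k * (blockPoint E u k + 1)) := Nat.mul_le_mul_left _ h1
      _ = E ^ k * ((E + 1) * (blockPoint E u k + 1)) := by ring
      _ ≤ E ^ k * (E * (blockPoint E u k + 1 + (blockPoint E u k + 1) / E + 1)) :=
        Nat.mul_le_mul_left _ h4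
      _ = _ := by ring

theorem card_blocks_le {E u m : ℕ} (hE : 0 < E) (hlt : ∀ k < m, blockPoint E u k < u) :
    m ≤ E * Nat.clog 2 u + 1 := by
  rcases m with _ | k
  · exact Nat.zero_le _
  · refine Nat.succ_le_succ (le_mul_of_pow_le hE ?_)
    refine (pow_le_blockPoint hE hlt k (by omega)).trans (Nat.mul_le_mul_left _ ?_)
    exact (hlt k (by omega)).trans_le (Nat.le_pow_clog (by norm_num) u)

/-! ### All layers. -/

namespace RatRAM
variable {n : ℕ} {f : Fin n → ℝ → ℝ} {Ω : ℕ}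

/-- The lengths of the blocks. -/
def Params.len (c : Params) (l : ℕ) : ℤ := (c.p (l + 1) : ℤ) - c.p l

theorem Params.sum_len {c : Params} (h0 : c.p 0 = 0) (hm : c.p c.m = c.u) :
    ∑ l ∈ Finset.range c.m, c.len l = c.u := by
  simp only [Params.len]
  rw [Finset.sum_range_sub (fun l => (c.p l : ℤ)), h0, hm]
  simp

/-- The functions are processed one after the other. -/
def layers : Prog := .for 5 19 0 layer

/-- Every layer appends at most `S'` rows, so `(n + 1) * S'` rows suffice. All total weights are
powers of `u` up to `u ^ n ≤ 2 ^ q`, so the same `S'` serves every layer. -/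
theorem run_layers {c : Params} {N R S' q : ℕ} {σ : State} {g : ℕ → ℕ → ℚ} {Y : ℤ}
    (hc : Ctx c σ) (hB : Bounds c N R Ω) (hn : c.n = n)
    (hent : Entries c 0 1 (fun _ => 0) (fun _ => 1) σ)
    (hg : ∀ (j : Fin n), ∀ l < c.m, f j (c.p l : ℝ) = (g j l : ℝ)) (hX : 0 < c.X)
    (hg0 : ∀ j < n, ∀ l < c.m, 0 ≤ g j l) (hgX : ∀ j < n, ∀ l < c.m, g j l < c.X)
    (hden : ∀ j < n, ∀ l < c.m, 2 * ((g j l).den * c.X) ≤ Ω)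
    (hY : ∀ j < n, ∀ l < c.m, ⌊g j l / c.X * 2 ^ c.K⌋ ≤ Y) (hY0 : 0 ≤ Y)
    (hnY : (n : ℤ) * Y < 2 ^ c.K)
    (hp0 : c.p 0 = 0) (hpm : c.p c.m = c.u) (hu0 : 0 < c.u) (huq : c.u ^ n ≤ 2 ^ q)
    (huK : c.u ^ n < 2 ^ c.K)
    (hS' : S' = c.E * q + 1) (hN : S' * c.m ≤ N) (hR : (n + 1) * S' ≤ R) :
    Run f Ω layers σ (n * (c.m * (c.K * 9 + 8) + c.K * (S' * c.m * 20 + 8) +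
      S' * c.m * (c.K * 119 + 91) + c.K * 4 + 16 + 2) + 2) (fun τ => ∃ (s S : ℕ) (val wt : ℕ → ℤ),
        Entries c s S val wt τ ∧ s + S ≤ R ∧ S ≤ S' ∧
        Approximates c.E c.u c.m c.len (fun j l => ⌊g j l / c.X * 2 ^ c.K⌋) Y n S val wt) := by
  have hΩu := hB.hu
  have hd : ∀ i < c.m, 0 < c.len i := fun i hi => by
    have := hB.p_lt i hi
    simp only [Params.len]
    omega
  have hy0 : ∀ j < n, ∀ l < c.m, 0 ≤ ⌊g j l / c.X * 2 ^ c.K⌋ := fun j hj l hl =>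
    Int.floor_nonneg.2 (mul_nonneg (div_nonneg (hg0 j hj l hl) (by positivity)) (by positivity))
  refine Run.mono (Run.for _ n (fun j τ => ∃ (s S : ℕ) (val wt : ℕ → ℤ),
    Entries c s S val wt τ ∧ s ≤ j * S' ∧ S ≤ S' ∧
    Approximates c.E c.u c.m c.len (fun j l => ⌊g j l / c.X * 2 ^ c.K⌋) Y j S val wt)
    (by rw [hc.h0, hn]) hc.h5 (by rw [← hn]; exact hB.hn) (by omega) (by decide) ?_ ?_) le_rfl ?_
  · exact ⟨0, 1, _, _, ⟨by simpa using hent.h15, by simpa using hent.h16, hent.hval, hent.hwt⟩,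
      by simp, by omega, .zero _ _ _ _ _ _⟩
  · rintro j hj τ hτ hj19 ⟨s, S, val, wt, he, hs, hS, hA⟩
    have hcτ : Ctx c τ := hc.of_agree hτ (by decide) (by decide)
    have hpair : pairWeight c wt = fun i => wt (i / c.m) * c.len (i % c.m) := rfl
    have htot : ((List.range (S * c.m)).map (pairWeight c wt)).sum = ((c.u ^ (j + 1) : ℕ) : ℤ) := by
      rw [hpair, sum_pair_weights hB.m_pos (Params.sum_len hp0 hpm), hA.wt_sum]
      push_cast
      ring
    have hpow : c.u ^ (j + 1) ≤ c.u ^ n := Nat.pow_le_pow_right hu0 hj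
    have hSm : S * c.m ≤ S' * c.m := Nat.mul_le_mul_right _ hS
    have hjS : (j + 2) * S' ≤ (n + 1) * S' := Nat.mul_le_mul_right _ (by omega)
    have hjY : ((j : ℤ) + 1) * Y ≤ n * Y := mul_le_mul_of_nonneg_right (by omega) hY0
    refine Run.mono (run_layer (j := ⟨j, hj⟩) (g := g j) (N := N) (R := R) (S' := S') hcτ hB hj19
      (hg ⟨j, hj⟩) hX (hg0 j hj) (hgX j hj) (hden j hj) (y := fun l => ⌊g j l / c.X * 2 ^ c.K⌋)
      (fun l _ => rfl) he (hSm.trans hN) (by linarith) hA.wt_pos ?_ ?_ ?_) ?_ ?_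
    · intro k hk l hl
      have h1 := hA.val_nonneg k hk
      have h2 := hA.val_le k hk
      have h3 := hy0 j hj l hl
      have h4 := hY j hj l hl
      exact ⟨by linarith, by linarith⟩
    · rw [htot]
      exact_mod_cast hpow.trans_lt huK
    · intro T hT
      rw [htot] at hT
      -- `T` groups contain `T - 1` starts after the first, whence the `+ 1` in `S'`.
      have hT' : (c.E + 1) ^ (T - 1) ≤ c.E ^ (T - 1) * c.u ^ (j + 1) := by exact_mod_cast hT
      have := le_mul_of_pow_le hB.E_pos (hT'.trans (Nat.mul_le_mul_left _ (hpow.trans huq)))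
      omega
    · gcongr
    · rintro ρ hρ ⟨l, T, val', wt', cum, first, hl, hG, hent', hT⟩ hρ'
      refine ⟨s + S, T, val', wt', ⟨by simpa using hent'.h15, by simpa using hent'.h16,
        hent'.hval, hent'.hwt⟩, by linarith, hT, ?_⟩
      exact hA.succ hB.m_pos hd (Params.sum_len hp0 hpm) (hy0 j hj) (hY j hj) hl hG
  · rintro τ - ⟨s, S, val, wt, he, hs, hS, hA⟩
    exact ⟨s, S, val, wt, he, by linarith, hS, hA⟩

end RatRAM

/-! ### Correctness and cost of the whole program. -/

/-- The exponent `ℓ * (n + 2)` pays for the denominator of `b`, for those of `n` values, and for the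
factor `n + 1` that beats the rounding errors; each of these is at most `2 ^ ℓ`. -/
theorem blockCnt_eq_blockCnt_floor {n A ℓ m : ℕ} {b : ℚ} {d : ℕ → ℤ} {y : ℕ → ℕ → ℚ} (hn : n ≤ A)
    (hb : b.den ≤ A) (hy : ∀ j < n, ∀ l < m, (y j l).den ≤ A) (hA : A < 2 ^ ℓ) :
    blockCnt m d y n b = blockCnt m d
      (fun j l => ⌊y j l * (2 ^ (ℓ * (n + 2)) : ℕ)⌋) n ⌊b * (2 ^ (ℓ * (n + 2)) : ℕ)⌋ := by
  refine blockCnt_floor hy n le_rfl b _ b.den b.den_pos ⟨b.num, Rat.mul_den_eq_num b⟩ ?_ ?_ ?_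
  · calc b.den * A ^ n * (n + 1) ≤ 2 ^ ℓ * (2 ^ ℓ) ^ n * 2 ^ ℓ := by gcongr <;> omega
      _ = _ := by ring
  · have := Int.floor_le (b * (2 ^ (ℓ * (n + 2)) : ℕ))
    linarith
  · have := Int.lt_floor_add_one (b * (2 ^ (ℓ * (n + 2)) : ℕ))
    linarith

theorem le_natAbs_num {q : ℚ} (h : 0 ≤ q) : q ≤ q.num.natAbs := by
  have h1 := Rat.mul_den_eq_num q
  have h2 : (1 : ℚ) ≤ q.den := by exact_mod_cast q.den_pos
  rw [← RatRAM.num_eq_natAbs h, ← h1]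
  nlinarith

theorem num_le_den {q : ℚ} (h : q ≤ 1) : q.num ≤ q.den := by
  have h1 := Rat.mul_den_eq_num q
  have h2 : (0 : ℚ) < q.den := by exact_mod_cast q.den_pos
  have : (q.num : ℚ) ≤ q.den := by
    rw [← h1]
    nlinarith
  exact_mod_cast this

theorem stepFun_le_sum {S : ℕ} {val wt : ℕ → ℤ} (h : ∀ k < S, 0 < wt k) (c : ℤ) :
    stepFun S val wt c ≤ ∑ k ∈ Finset.range S, wt k :=
  Finset.sum_le_sum fun k hk => by
    have := h k (Finset.mem_range.1 hk)
    split_ifs <;> omega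

/-- The exponent `2 * n + 1` collects `n` factors from the blocks, `n` from the groupings and one
from rounding the output. -/
theorem Approximates.output_bounds {E u m n S V Z : ℕ} {p : ℕ → ℕ} {G : ℕ → ℕ → ℚ}
    {y : ℕ → ℕ → ℤ} {Y z : ℤ} {b : ℚ} {val wt : ℕ → ℤ} (hbl : Blocks E u m p)
    (hmono : ∀ j < n, Monotone (G j))
    (hA : Approximates E u m (fun l => (p (l + 1) : ℤ) - p l) y Y n S val wt)
    (hy : blockCnt m (fun l => (p (l + 1) : ℤ) - p l) (fun j l => G j (p l)) n b =
      blockCnt m (fun l => (p (l + 1) : ℤ) - p l) y n z)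
    (hV : (V : ℤ) = stepFun S val wt z) (h1 : V ≤ Z) (h2 : E * Z ≤ (E + 1) * V) :
    blockCnt u (fun _ => 1) G n b ≤ Z ∧
      (E : ℤ) ^ (2 * n + 1) * Z ≤ (E + 1) ^ (2 * n + 1) * blockCnt u (fun _ => 1) G n b := by
  have a1 := hbl.cnt_le hmono b
  have a2 := hbl.le_cnt hmono b
  have a3 := hA.lower z
  have a4 := hA.upper z
  rw [← hV, ← hy] at a3 a4
  have h1' : (V : ℤ) ≤ Z := by exact_mod_cast h1
  have h2' : (E : ℤ) * Z ≤ (E + 1) * V := by exact_mod_cast h2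
  refine ⟨by linarith, ?_⟩
  generalize blockCnt u (fun _ => 1) G n b = cnt at *
  generalize blockCnt m (fun l => (p (l + 1) : ℤ) - p l) (fun j l => G j (p l)) n b = B at *
  have hE : (0 : ℤ) ≤ E := by positivity
  calc (E : ℤ) ^ (2 * n + 1) * Z = E ^ n * E ^ n * (E * Z) := by ring
    _ ≤ E ^ n * E ^ n * ((E + 1) * V) := by gcongr
    _ = E ^ n * (E + 1) * (E ^ n * V) := by ring
    _ ≤ E ^ n * (E + 1) * ((E + 1) ^ n * B) := by gcongr
    _ = (E + 1) * (E + 1) ^ n * (E ^ n * B) := by ring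
    _ ≤ (E + 1) * (E + 1) ^ n * ((E + 1) ^ n * cnt) := by gcongr
    _ = _ := by ring

namespace RatRAM
variable {n : ℕ} {f : Fin n → ℝ → ℝ} {Ω : ℕ}

/-- The part of the program that follows the preparations. -/
def solve : Prog :=
  .seq (.binop 30 .add 2 4) <|
  .seq (.binop 31 .add 4 4) <|
  .seq (digits 9) <|
  .seq (.store 3 4 5) <|
  .seq (.binop 15 .add 4 4) <|
  .seq (.binop 16 .add 5 4) <|
  .seq layers <|
  .seq finalSum output

/-- Of the `(n + 4) * ℓ` digits of a row, `2 * ℓ` stand before the binary point and `ℓ * (n + 2)`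
behind it. Dividing by `X` moves all values below 1, which is what `digits` needs. -/
theorem run_solve {c : Params} {N R S' A ℓ : ℕ} {σ : State} {b : ℚ} {G : ℕ → ℕ → ℚ}
    (hc : Ctx c σ) (hB : Bounds c N R Ω) (hn : c.n = n) (hn1 : 1 ≤ n) (hu : 2 ≤ c.u)
    (hbl : Blocks c.E c.u c.m c.p) (hK : c.K = (n + 4) * ℓ) (hX : c.X = (2 ^ ℓ) ^ 2)
    (h2 : σ.var 2 = b) (harr : ∀ a, a ∉ [0] → σ.arr a = fun _ => 0) (hb : 0 ≤ b)
    (hG : ∀ (j : Fin n) (x : ℕ), f j (x : ℝ) = (G j x : ℝ)) (hG0 : ∀ j < n, ∀ x, 0 ≤ G j x)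
    (hmono : ∀ j < n, Monotone (G j)) (hnA : n ≤ A) (huA : c.u ≤ A) (hbn : b.num.natAbs ≤ A)
    (hbd : b.den ≤ A)
    (hGA : ∀ j < n, ∀ l < c.m, (G j (c.p l)).num.natAbs ≤ A ∧ (G j (c.p l)).den ≤ A)
    (hAℓ : A < 2 ^ ℓ) (hdX : 2 * (A * c.X) ≤ Ω)
    (hS' : S' = c.E * (n * Nat.clog 2 c.u) + 1) (hN : S' * c.m ≤ N) (hR : (n + 1) * S' ≤ R) :
    Run f Ω solve σ (c.K * 16 + 17 + S' * (c.K * 34 + 21) + 4 + (n * (c.m * (c.K * 9 + 8) +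
      c.K * (S' * c.m * 20 + 8) + S' * c.m * (c.K * 119 + 91) + c.K * 4 + 16 + 2) + 2))
      (fun τ => ∃ k e : ℕ,
      τ.var 0 = k ∧ τ.var 1 = e ∧ blockCnt c.u (fun _ => 1) G n b ≤ (k * 2 ^ e : ℕ) ∧
      (c.E : ℤ) ^ (2 * n + 1) * (k * 2 ^ e : ℕ) ≤
        (c.E + 1) ^ (2 * n + 1) * blockCnt c.u (fun _ => 1) G n b) := by
  have hΩu := hB.hu
  have hΩ1 : 1 ≤ Ω := by omega
  have hKΩ : c.K ≤ Ω := le_trans (by nlinarith) hB.hm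
  have hX0 : 0 < c.X := by rw [hX]; positivity
  have hℓ0 : 0 < ℓ := by
    rcases Nat.eq_zero_or_pos ℓ with rfl | h
    · omega
    · exact h
  have hscale : ∀ v : ℚ, v / c.X * 2 ^ c.K = v * (2 ^ (ℓ * (n + 2)) : ℕ) := by
    intro v
    have h1 : (2 : ℚ) ^ c.K = c.X * (2 ^ (ℓ * (n + 2)) : ℕ) := by
      rw [hK, hX]
      push_cast
      ring
    have : (c.X : ℚ) ≠ 0 := by exact_mod_cast hX0.ne'
    rw [h1]
    field_simp
  have hfloor : ∀ v : ℚ, 0 ≤ v → v.num.natAbs ≤ A →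
      ⌊v / c.X * 2 ^ c.K⌋ ≤ ((A * 2 ^ (ℓ * (n + 2)) : ℕ) : ℤ) := by
    intro v hv0 hv
    rw [hscale]
    have : v ≤ A := (le_natAbs_num hv0).trans (by exact_mod_cast hv)
    have h1 : v * (2 ^ (ℓ * (n + 2)) : ℕ) ≤ A * (2 ^ (ℓ * (n + 2)) : ℕ) := by gcongr
    have h2 := (Int.floor_le _).trans h1
    exact_mod_cast h2
  -- One factor `2 ^ ℓ` covers a single value, the other the number `n ≤ A` of summands; hence `X`
  -- is the square of `2 ^ ℓ`.
  have hpow : A * (A * 2 ^ (ℓ * (n + 2))) < 2 ^ c.K := by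
    have : 2 ^ c.K = 2 ^ ℓ * (2 ^ ℓ * 2 ^ (ℓ * (n + 2))) := by
      rw [hK]
      ring
    rw [this]
    gcongr
  have huK : c.u ^ n < 2 ^ c.K := by
    have h1 : c.u ^ n ≤ (2 ^ ℓ) ^ n := Nat.pow_le_pow_left (huA.trans hAℓ.le) n
    refine h1.trans_lt ?_
    rw [← pow_mul]
    refine Nat.pow_lt_pow_right (by norm_num) ?_
    rw [hK]
    nlinarith
  have hltX : ∀ v : ℚ, 0 ≤ v → v.num.natAbs ≤ A → v < c.X := by
    intro v hv0 hv
    refine lt_of_le_of_lt ((le_natAbs_num hv0).trans (Nat.cast_le.2 hv)) (Nat.cast_lt.2 ?_)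
    rw [hX]
    exact hAℓ.trans_le (Nat.le_self_pow two_ne_zero _)
  have hdX' : ∀ d ≤ A, 2 * (d * c.X) ≤ Ω := fun d hd => le_trans (by gcongr) hdX
  have hAΩ : A ≤ Ω := le_trans (by nlinarith) hdX
  have fit0 : Fit Ω 0 := by simpa using fit_nat (k := 0) (Nat.zero_le _) hΩ1
  have fit1 : Fit Ω 1 := by simpa using fit_nat (k := 1) hΩ1 hΩ1
  -- Naming the nonlinear running times leaves linear goals for `omega`.
  obtain ⟨t, ht⟩ : ∃ t, t = n * (c.m * (c.K * 9 + 8) +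
      c.K * (S' * c.m * 20 + 8) + S' * c.m * (c.K * 119 + 91) + c.K * 4 + 16 + 2) + 2 := ⟨_, rfl⟩
  obtain ⟨t', ht'⟩ : ∃ t, t = S' * (c.K * 34 + 21) + 4 := ⟨_, rfl⟩
  refine Run.mono (s := t' + (c.K * 7 + 8) + t + 1 + 1 + 1 + (c.K * 9 + 3) + 1 + 1)
    (Q := _) ?_ (by rw [← ht]; omega) (fun _ _ h => h)
  refine Run.seq (Run.binop b (by simp [BinOp.eval, h2, hc.h4])
    ⟨hbn.trans hAΩ, hbd.trans hAΩ⟩ ?_)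
  refine Run.seq (Run.binop 0 (by simp [BinOp.eval, hc.h4]) fit0 ?_)
  refine Run.comp (run_digits (K := c.K) (X := c.X) (v := b) (o := 0) (by simp [hc.h5])
    (by simp [hc.h6]) (by simp [hc.h13]) (by simp [hc.h14]) (by simp) (by simp) hX0 hb
    (hltX b hb hbn) (hdX' _ hbd) (by omega)) ?_ (t := t' + (c.K * 7 + 8) + t + 1 + 1 + 1) (by omega)
  rintro σ₁ f₁ ⟨p9, -⟩
  have hc1 : Ctx c σ₁ := ((hc.setVar (by decide)).setVar (by decide)).of_agree f₁
    (by decide) (by decide)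
  have arr1 : ∀ a, a ∉ [0, 9] → σ₁.arr a = fun _ => 0 := by
    intro a ha
    rw [f₁.2 a (by simp_all [warrs_digits])]
    exact harr a (by simp_all)
  refine Run.seq (Run.store 0 1 (by simp [hc1.h4]) (by simp [hc1.h5]) fit1 ?_)
  refine Run.seq (Run.binop 0 (by simp [BinOp.eval, hc1.h4]) fit0 ?_)
  refine Run.seq (Run.binop 1 (by simp [BinOp.eval, hc1.h4, hc1.h5]) fit1 ?_)
  set σ₂ := ((σ₁.setArr 3 0 1).setVar 15 0).setVar 16 1 with hσ₂
  have g2 : Agree [15, 16] [3] σ₁ σ₂ := by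
    constructor
    · intro v hv
      simp_all
    · intro a ha
      ext k
      simp_all [setArr_apply]
  have hc2 : Ctx c σ₂ := hc1.of_agree g2 (by decide) (by decide)
  -- The empty product: one entry of value 0 and weight 1. The arrays are zero initially, so storing
  -- the single digit 1 is enough.
  have hent : Entries c 0 1 (fun _ => 0) (fun _ => 1) σ₂ := by
    refine ⟨by simp [hσ₂], by simp [hσ₂], fun k hk => rep_zero fun i _ _ => ?_, fun k hk => ?_⟩
    · rw [g2.2 2 (by decide), arr1 2 (by decide)]
    · obtain rfl : k = 0 := by omega
      intro t ht
      rcases Nat.eq_zero_or_pos t with rfl | h0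
      · simp [hσ₂, setArr_apply]
      · have h1 : (1 : ℤ) / 2 ^ t = 0 := Int.ediv_eq_zero_of_lt (by norm_num)
          (one_lt_pow₀ (by norm_num) h0.ne')
        simp [hσ₂, setArr_apply, h0.ne', h1, arr1 3 (by decide)]
  refine Run.comp (run_layers (N := N) (R := R) (S' := S') (q := n * Nat.clog 2 c.u)
    (g := fun j l => G j (c.p l)) (Y := ((A * 2 ^ (ℓ * (n + 2)) : ℕ) : ℤ)) hc2 hB hn hent
    (fun j l _ => hG j _) hX0 (fun j hj l _ => hG0 j hj _)
    (fun j hj l hl => hltX _ (hG0 j hj _) (hGA j hj l hl).1) (fun j hj l hl => hdX' _ (hGA j hj l hl).2)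
    (fun j hj l hl => hfloor _ (hG0 j hj _) (hGA j hj l hl).1) (by positivity)
    (by exact_mod_cast lt_of_le_of_lt (Nat.mul_le_mul_right _ hnA) hpow) hbl.zero hbl.last
    (by omega) ?_ huK hS' hN hR) ?_ (t := t' + (c.K * 7 + 8)) (by rw [← ht]; omega)
  · rw [mul_comm n, pow_mul]
    exact Nat.pow_le_pow_left (Nat.le_pow_clog (by norm_num) _) n
  rintro σ₃ f₃ ⟨s, S, val, wt, he, hsR, hSS, hA⟩
  have hc3 : Ctx c σ₃ := hc2.of_agree f₃ (by decide) (by decide)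
  have hbK := hfloor b hb hbn
  have hb0 : 0 ≤ ⌊b / c.X * 2 ^ c.K⌋ := Int.floor_nonneg.2 (by positivity)
  have hpow' : (A : ℤ) * (A * 2 ^ (ℓ * (n + 2)) : ℕ) < 2 ^ c.K := by exact_mod_cast hpow
  have hAA : ((A * 2 ^ (ℓ * (n + 2)) : ℕ) : ℤ) ≤ (A : ℤ) * (A * 2 ^ (ℓ * (n + 2)) : ℕ) :=
    le_mul_of_one_le_left (by positivity) (by exact_mod_cast (by omega : 1 ≤ A))
  have hnY : (n : ℤ) * (A * 2 ^ (ℓ * (n + 2)) : ℕ) ≤ (A : ℤ) * (A * 2 ^ (ℓ * (n + 2)) : ℕ) :=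
    mul_le_mul_of_nonneg_right (by exact_mod_cast hnA) (by positivity)
  refine Run.comp (run_finalSum (z := ⌊b / c.X * 2 ^ c.K⌋) hc3 hB he hsR ?_ hb0
    (by linarith) (fun k hk => ⟨hA.val_nonneg k hk, ?_⟩) ?_) ?_ (t := c.K * 7 + 8) ?_
  · rw [f₃.2 9 (by decide), g2.2 9 (by decide)]
    exact p9
  · have := hA.val_le k hk
    linarith
  · refine rep_zero fun i _ _ => ?_
    rw [f₃.2 10 (by decide), g2.2 10 (by decide), arr1 10 (by decide)]
  swap
  · rw [ht']
    gcongr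
  intro σ₄ f₄ p10
  have hc4 : Ctx c σ₄ := hc3.of_agree f₄ (by decide) (by decide)
  have hV0 : 0 ≤ stepFun S val wt ⌊b / c.X * 2 ^ c.K⌋ := Finset.sum_nonneg fun k hk => by
    have := hA.wt_pos k (Finset.mem_range.1 hk)
    split_ifs <;> omega
  have hVu := stepFun_le_sum (val := val) hA.wt_pos ⌊b / c.X * 2 ^ c.K⌋
  rw [hA.wt_sum] at hVu
  obtain ⟨V, hV⟩ := Int.eq_ofNat_of_zero_le hV0
  rw [hV] at p10 hVu
  refine Run.mono (run_output hc4 hB p10 (lt_of_le_of_lt (by exact_mod_cast hVu) huK)) le_rfl ?_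
  rintro τ - ⟨k, e, hk, he', h3, h4⟩
  refine ⟨k, e, hk, he', hA.output_bounds (G := G) (b := b) hbl hmono ?_ hV.symm h3 h4⟩
  simp only [hscale]
  exact blockCnt_eq_blockCnt_floor hnA hbd (fun j hj l hl => (hGA j hj l hl).2) hAℓ


/-- All four quantities are positive, so every monomial that occurs is dominated by `n * S * m * K`.
-/
theorem total_time_le {n S m K Λ : ℕ} (hn : 0 < n) (hS : 0 < S) (hm : 0 < m) (hΛK : Λ ≤ K)
    (hΛ : 0 < Λ) :
    11 + (m * 9 + 3) + (n * (m * 10 + 4) + Λ * 3 + 19) +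
      (K * 16 + 17 + S * (K * 34 + 21) + 4 + (n * (m * (K * 9 + 8) + K * (S * m * 20 + 8) +
        S * m * (K * 119 + 91) + K * 4 + 16 + 2) + 2)) ≤ 500 * (n * S * m * K) := by
  have hK : 0 < K := hΛ.trans_le hΛK
  have key : ∀ a b c d : ℕ, a ≤ n → b ≤ S → c ≤ m → d ≤ K → a * b * c * d ≤ n * S * m * K :=
    fun a b c d h1 h2 h3 h4 => by gcongr
  have q0 := key 1 1 1 1 hn hS hm hK
  have q1 := key 1 1 m 1 hn hS le_rfl hK
  have q2 := key n 1 m 1 le_rfl hS le_rfl hK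
  have q3 := key n 1 1 1 le_rfl hS hm hK
  have q4 := key 1 1 1 K hn hS hm le_rfl
  have q5 := key 1 S 1 K hn le_rfl hm le_rfl
  have q6 := key 1 S 1 1 hn le_rfl hm hK
  have q7 := key n 1 m K le_rfl hS le_rfl le_rfl
  have q8 := key n 1 1 K le_rfl hS hm le_rfl
  have q9 := key n S m 1 le_rfl le_rfl le_rfl hK
  linarith

/-- The main part of the program, for nonnegative `b`. -/
def main : Prog :=
  .seq consts <|
  .seq points <|
  .seq sizes
  solve

theorem run_main {σ : State} {u E m M Λ S' : ℕ} {b δ : ℚ} {G : ℕ → ℕ → ℚ}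
    (h0 : σ.var 0 = n) (h1 : σ.var 1 = u) (h2 : σ.var 2 = b) (h3 : σ.var 3 = δ) (h4 : σ.var 4 = 0)
    (harr : σ.arr = fun _ _ => 0) (hn : 1 ≤ n) (hu : 2 ≤ u) (hb : 0 ≤ b) (hδ : 0 < δ)
    (hG : ∀ (j : Fin n) (x : ℕ), f j (x : ℝ) = (G j x : ℝ)) (hG0 : ∀ j < n, ∀ x, 0 ≤ G j x)
    (hmono : ∀ j < n, Monotone (G j)) (hE : (E : ℤ) = ⌊6 * n / min δ 1⌋ + 1)
    (hm0 : 0 < m) (hm : blockPoint E u m = u) (hlt : ∀ k < m, blockPoint E u k < u)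
    (hS' : S' = E * (n * Nat.clog 2 u) + 1)
    (hnum : ∀ j < n, ∀ x < u, (G j x).num.natAbs ≤ M) (hden : ∀ j < n, ∀ x < u, (G j x).den ≤ M)
    (hbn : b.num.natAbs ≤ M) (hbd : b.den ≤ M) (hnM : n ≤ M) (huM : u ≤ M) (hΛ : 2 * M ≤ 2 ^ Λ)
    (hN : (S' * m + 1) * ((n + 4) * Λ + 1) ≤ Ω) (hR : ((n + 1) * S' + 1) * ((n + 4) * Λ + 1) ≤ Ω)
    (hEΩ : 4 * (2 * E + 1) ≤ Ω) (hMΩ : 16 * M ^ 3 ≤ Ω) (hδΩ : 6 * (n * (min δ 1).den) ≤ Ω)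
    (huΩ : 4 * (u + 2) ≤ Ω) :
    Run f Ω main σ (500 * (n * S' * m * ((n + 4) * Λ))) (fun τ => ∃ k e : ℕ,
      τ.var 0 = k ∧ τ.var 1 = e ∧ blockCnt u (fun _ => 1) G n b ≤ (k * 2 ^ e : ℕ) ∧
      (E : ℤ) ^ (2 * n + 1) * (k * 2 ^ e : ℕ) ≤
        (E + 1) ^ (2 * n + 1) * blockCnt u (fun _ => 1) G n b) := by
  have hE0 : 0 < E := by
    have : 0 ≤ ⌊6 * (n : ℚ) / min δ 1⌋ :=
      Int.floor_nonneg.2 (div_nonneg (by positivity) (le_min hδ.le zero_le_one))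
    omega
  have hbl := blocks_blockPoint hm hlt
  have hM2 : 2 ≤ M := hu.trans huM
  have hM3 : 4 * M ^ 2 ≤ Ω := by
    refine le_trans ?_ hMΩ
    rw [pow_succ M 2, ← mul_assoc, mul_right_comm]
    refine Nat.mul_le_mul_right _ ?_
    omega
  have hΛ0 : 0 < Λ := by
    rcases Nat.eq_zero_or_pos Λ with rfl | h
    · omega
    · exact h
  have hS0 : 0 < S' := by omega
  set K₁ : ℕ := (n + 4) * Λ with hK₁
  have hK0 : 0 < K₁ := by positivity
  have hΩ1 : 1 ≤ Ω := by omega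
  have hmΩ : (m + 1) * (K₁ + 1) ≤ Ω := le_trans
    (Nat.mul_le_mul_right _ (Nat.succ_le_succ (Nat.le_mul_of_pos_left m hS0))) hN
  have hKΩ : K₁ ≤ Ω :=
    (Nat.le_succ _).trans ((Nat.le_mul_of_pos_left _ (Nat.succ_pos m)).trans hmΩ)
  have hmΩ' : m ≤ Ω :=
    (Nat.le_succ _).trans ((Nat.le_mul_of_pos_right _ (Nat.succ_pos K₁)).trans hmΩ)
  have hden0 := (min δ 1).den_pos
  have hnΩ : 6 * n ≤ Ω :=
    le_trans (Nat.mul_le_mul_left _ (Nat.le_mul_of_pos_right _ hden0)) hδΩ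
  have hdΩ : (min δ 1).den ≤ Ω :=
    le_trans ((Nat.le_mul_of_pos_left _ hn).trans (Nat.le_mul_of_pos_left _ (by norm_num))) hδΩ
  have hT : 11 + (m * 9 + 3) + (n * (m * 10 + 4) + Λ * 3 + 19) +
      (K₁ * 16 + 17 + S' * (K₁ * 34 + 21) + 4 + (n * (m * (K₁ * 9 + 8) + K₁ * (S' * m * 20 + 8) +
        S' * m * (K₁ * 119 + 91) + K₁ * 4 + 16 + 2) + 2)) ≤ 500 * (n * S' * m * K₁) := by
    exact total_time_le hn hS0 hm0 (Nat.le_mul_of_pos_left _ (by omega)) hΛ0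
  obtain ⟨t₂, ht₂⟩ : ∃ t, t = n * (m * 10 + 4) + Λ * 3 + 19 := ⟨_, rfl⟩
  obtain ⟨t₃, ht₃⟩ : ∃ t, t = K₁ * 16 + 17 + S' * (K₁ * 34 + 21) + 4 + (n * (m * (K₁ * 9 + 8) +
    K₁ * (S' * m * 20 + 8) + S' * m * (K₁ * 119 + 91) + K₁ * 4 + 16 + 2) + 2) := ⟨_, rfl⟩
  rw [← ht₂, ← ht₃] at hT
  refine Run.comp (run_consts h0 h4 h3 hδ hE (by omega) hδΩ
    ((num_le_den (min_le_right _ _)).trans (by exact_mod_cast hdΩ)) (by omega) hnΩ) ?_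
    (t := m * 9 + 3 + t₂ + t₃) (by omega)
  rintro σ₁ f₁ ⟨a5, a6, a7, a8, a9⟩
  refine Run.comp (run_points (E := E) (u := u) (m := m) (by rw [f₁.1 1 (by decide), h1])
    (by rw [f₁.1 4 (by decide), h4]) a5 a7 (by rw [f₁.2 0 (by decide), harr]) hE0 (by omega) hm hlt
    (by omega) hmΩ') ?_ (t := t₂ + t₃) (by omega)
  rintro σ₂ f₂ ⟨b10, bp⟩
  have e0 : σ₂.var 0 = n := by rw [f₂.1 0 (by decide), f₁.1 0 (by decide), h0]
  have e4 : σ₂.var 4 = 0 := by rw [f₂.1 4 (by decide), f₁.1 4 (by decide), h4]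
  have e5 : σ₂.var 5 = 1 := by rw [f₂.1 5 (by decide), a5]
  have e6 : σ₂.var 6 = 2 := by rw [f₂.1 6 (by decide), a6]
  have e2 : σ₂.var 2 = b := by rw [f₂.1 2 (by decide), f₁.1 2 (by decide), h2]
  refine Run.comp (run_sizes (u := u) (m := m) (M := M) (Λ := Λ) (b := b) (p := blockPoint E u)
    (g := fun j l => G j (blockPoint E u l)) e0
    (by rw [f₂.1 1 (by decide), f₁.1 1 (by decide), h1]) e2 e4 e5 e6 b10 bp
    (fun k _ => (blockPoint_le E u k).trans (by omega)) (fun j l _ => hG j _)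
    (fun j hj l _ => hG0 j hj _) (fun j hj l hl => hnum j hj _ (hlt l hl))
    (fun j hj l hl => hden j hj _ (hlt l hl)) hb hbn hbd hnM huM
    hmΩ' hM3 hKΩ (by omega) hΛ) ?_ (t := t₃) (by rw [← ht₂])
  rintro σ₃ f₃ ⟨A, ℓ, hnA, huA, hbnA, hbdA, hgA, hAℓ, hℓM, c13, c14⟩
  set c : Params := ⟨n, u, E, m, (n + 4) * ℓ, (2 ^ ℓ) ^ 2, blockPoint E u⟩ with hcdef
  have hℓΛ : ℓ ≤ Λ := (Nat.pow_le_pow_iff_right (by norm_num)).1 (hℓM.trans hΛ)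
  have hKK : c.K ≤ K₁ := Nat.mul_le_mul_left _ hℓΛ
  have hX : 0 < c.X := by positivity
  have hXM : c.X ≤ 4 * M ^ 2 := (Nat.pow_le_pow_left hℓM 2).trans (by ring_nf; exact le_rfl)
  have hAX : A ≤ c.X := hAℓ.le.trans (Nat.le_self_pow two_ne_zero _)
  have hc : Ctx c σ₃ := by
    constructor
    · rw [f₃.1 0 (by decide), e0]
    · rw [f₃.1 4 (by decide), e4]
    · rw [f₃.1 5 (by decide), e5]
    · rw [f₃.1 6 (by decide), e6]
    · rw [f₃.1 7 (by decide), f₂.1 7 (by decide), a7]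
    · rw [f₃.1 8 (by decide), f₂.1 8 (by decide), a8]
    · rw [f₃.1 9 (by decide), f₂.1 9 (by decide), a9]
    · rw [f₃.1 10 (by decide), b10]
    · exact c13
    · exact c14
    · rw [f₃.2 0 (by decide)]
      exact bp
  have hB : Bounds c (S' * m) ((n + 1) * S') Ω := by
    constructor
    · exact le_trans (Nat.mul_le_mul_left _ (by omega)) hN
    · exact le_trans (Nat.mul_le_mul_left _ (by omega)) hR
    · exact le_trans (Nat.mul_le_mul_left _ (by omega)) hmΩ
    · exact hEΩ
    · exact huΩ
    · show n ≤ Ω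
      omega
    · exact hE0
    · exact hm0
    · exact hbl.lt
    · exact fun k _ => blockPoint_le E u k
  have d2 : σ₃.var 2 = b := by rw [f₃.1 2 (by decide), e2]
  have arr0 : ∀ a, a ∉ [0] → σ₃.arr a = fun _ => 0 := by
    intro a ha
    have h1 : a ∉ sizes.warrs := by simp [show sizes.warrs = [] from rfl]
    rw [f₃.2 a h1, f₂.2 a ha, f₁.2 a (by simp [show consts.warrs = [] from rfl]), harr]
  refine Run.mono (run_solve (N := S' * m) (R := (n + 1) * S') (S' := S') (b := b) (G := G) hc hB rfl
    hn hu hbl rfl rfl d2 arr0 hb hG hG0 hmono hnA huA hbnA hbdA hgA hAℓ ?_ hS' le_rfl le_rfl) ?_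
    (fun _ _ h => h)
  · calc 2 * (A * c.X) ≤ 2 * (2 * M * (4 * M ^ 2)) := by
          have : A ≤ 2 * M := hAℓ.le.trans hℓM
          gcongr
      _ = 16 * M ^ 3 := by ring
      _ ≤ Ω := hMΩ
  · rw [ht₃]
    gcongr

end RatRAM

/-! ### Encoding lengths and numerical estimates. -/

theorem num_le_two_pow_encLen (r : ℚ) : r.num.natAbs ≤ 2 ^ encLen r :=
  calc r.num.natAbs ≤ 2 ^ Nat.clog 2 (r.num.natAbs + 1) :=
        (Nat.le_succ _).trans (Nat.le_pow_clog (by norm_num) _)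
    _ ≤ _ := Nat.pow_le_pow_right (by norm_num) (Nat.le_add_right _ _)

theorem den_le_two_pow_encLen (r : ℚ) : r.den ≤ 2 ^ encLen r :=
  calc r.den ≤ 2 ^ Nat.clog 2 (r.den + 1) :=
        (Nat.le_succ _).trans (Nat.le_pow_clog (by norm_num) _)
    _ ≤ _ := Nat.pow_le_pow_right (by norm_num) (Nat.le_add_left _ _)

theorem one_le_encLen (r : ℚ) : 1 ≤ encLen r := by
  have : 0 < Nat.clog 2 (r.den + 1) := Nat.clog_pos (by norm_num) (by have := r.den_pos; omega)
  unfold encLen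
  omega

/-- The summand 1 is the encoding length of the denominator 1. -/
theorem encLen_natCast_le {x u : ℕ} (h : x < u) : encLen (x : ℚ) ≤ Nat.clog 2 u + 1 := by
  have h1 : Nat.clog 2 (x + 1) ≤ Nat.clog 2 u := Nat.clog_mono_right 2 h
  have h2 : Nat.clog 2 2 = 1 := by decide
  simp only [encLen, Rat.num_natCast, Rat.den_natCast, Int.natAbs_natCast, h2, Nat.reduceAdd]
  omega

theorem clog_le_logb_add_one {n : ℕ} (hn : 1 ≤ n) :
    (Nat.clog 2 n : ℝ) ≤ Real.logb 2 n + 1 := by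
  have h := Real.natCeil_logb_natCast 2 n
  have h1 := (Nat.ceil_lt_add_one (a := Real.logb (2 : ℕ) n)
    (Real.logb_nonneg (by norm_num) (by exact_mod_cast hn))).le
  rw [h] at h1
  exact_mod_cast h1

/-- The relative error of the algorithm is at most `δ`. -/
theorem one_add_inv_pow_le {n E : ℕ} {δ : ℝ} (hn : 1 ≤ n) (hδ : 0 < δ) (hδ1 : δ ≤ 1)
    (hE : 6 * n / δ ≤ E) : (1 + 1 / (E : ℝ)) ^ (2 * n + 1) ≤ 1 + δ := by
  have hn' : (1 : ℝ) ≤ n := by exact_mod_cast hn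
  have hE0 : (0 : ℝ) < E := lt_of_lt_of_le (by positivity) hE
  rw [div_le_iff₀ hδ] at hE
  set x : ℝ := (2 * n + 1) / E with hx
  have hx0 : 0 ≤ x := by positivity
  -- Here `2 * n + 1 ≤ 3 * n`, and `E ≥ 6 * n / δ`; this is where the constant 6 comes from.
  have hx2 : x ≤ δ / 2 := by
    rw [hx, div_le_iff₀ hE0]
    linarith
  have h1 : (1 + 1 / (E : ℝ)) ^ (2 * n + 1) ≤ Real.exp x := by
    have h2 : 1 + 1 / (E : ℝ) ≤ Real.exp (1 / E) := by
      rw [add_comm]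
      exact Real.add_one_le_exp _
    calc (1 + 1 / (E : ℝ)) ^ (2 * n + 1) ≤ Real.exp (1 / E) ^ (2 * n + 1) := by gcongr
      _ = Real.exp x := by
        rw [← Real.exp_nat_mul, hx]
        push_cast
        ring_nf
  -- With `exp x ≤ 1 + x + x ^ 2` and `x ≤ δ / 2`, `δ ≤ 1`, the error is at most `δ / 2 + δ ^ 2 / 4
  -- ≤ δ`.
  have h3 := (abs_le.1 (Real.abs_exp_sub_one_sub_id_le
    (abs_le.2 ⟨by linarith, by linarith⟩ : |x| ≤ 1))).2
  nlinarith

theorem add_one_le_pow_succ {a k Y : ℕ} (hY : 2 ≤ Y) (h : a ≤ Y ^ k) : a + 1 ≤ Y ^ (k + 1) := by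
  have : 1 ≤ Y ^ k := Nat.one_le_pow _ _ (by omega)
  rw [pow_succ]
  nlinarith

/-- Every number in a run is polynomially bounded in `Y = 2 ^ Λ`, so its length is a constant times
`Λ`. The degree only affects that constant; 14 comes from the cells for all digits of all pairs,
estimated by `Y ^ 10 * Y ^ 4`. -/
theorem capacity_bounds {n u E m M S' D l Λ Y : ℕ} (hY : 8 ≤ Y) (hn : n ≤ Y) (hu : u ≤ Y)
    (hD : n * D ≤ Y) (hl : l ≤ Y) (hΛ : Λ ≤ Y) (hM : M ≤ Y) (hE : E ≤ 8 * Y)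
    (hm : m ≤ E * l + 1) (hS' : S' = E * (n * l) + 1) :
    (S' * m + 1) * ((n + 4) * Λ + 1) ≤ Y ^ 14 ∧
    ((n + 1) * S' + 1) * ((n + 4) * Λ + 1) ≤ Y ^ 14 ∧ 4 * (2 * E + 1) ≤ Y ^ 14 ∧
    16 * M ^ 3 ≤ Y ^ 14 ∧ 6 * (n * D) ≤ Y ^ 14 ∧ 4 * (u + 2) ≤ Y ^ 14 := by
  have hY1 : 1 ≤ Y := by omega
  have hY2 : 2 ≤ Y := by omega
  have hp : ∀ k ≤ 14, Y ^ k ≤ Y ^ 14 := fun k hk => Nat.pow_le_pow_right hY1 hk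
  have hYY : 8 * Y ≤ Y ^ 2 := by rw [pow_two]; gcongr
  have hE2 : E ≤ Y ^ 2 := hE.trans hYY
  have hm4 : m ≤ Y ^ 4 := hm.trans (add_one_le_pow_succ hY2 (by rw [pow_succ]; gcongr))
  have hS5 : S' ≤ Y ^ 5 := by
    rw [hS']
    refine add_one_le_pow_succ hY2 ?_
    calc E * (n * l) ≤ Y ^ 2 * (Y * Y) := by gcongr
      _ = Y ^ 4 := by ring
  have hn2 : n + 4 ≤ Y ^ 2 := by omega
  have hK : (n + 4) * Λ + 1 ≤ Y ^ 4 :=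
    add_one_le_pow_succ hY2 (by rw [pow_succ]; gcongr)
  have hSm : S' * m + 1 ≤ Y ^ 10 := add_one_le_pow_succ hY2
    ((Nat.mul_le_mul hS5 hm4).trans (by rw [← pow_add]))
  have hnS : (n + 1) * S' + 1 ≤ Y ^ 8 := add_one_le_pow_succ hY2
    ((Nat.mul_le_mul (by omega : n + 1 ≤ Y ^ 2) hS5).trans (by rw [← pow_add]))
  refine ⟨?_, ?_, ?_, ?_, ?_, ?_⟩
  · exact (Nat.mul_le_mul hSm hK).trans (by rw [← pow_add])
  · exact (Nat.mul_le_mul hnS hK).trans (by rw [← pow_add]; exact hp _ (by norm_num))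
  · refine le_trans ?_ (hp 4 (by norm_num))
    rw [pow_succ, pow_succ]
    nlinarith
  · refine le_trans ?_ (hp 5 (by norm_num))
    calc 16 * M ^ 3 ≤ Y ^ 2 * Y ^ 3 := by
          gcongr
          nlinarith
      _ = Y ^ 5 := by ring
  · exact le_trans (by nlinarith) (hp 2 (by norm_num))
  · exact le_trans (by nlinarith) (hp 2 (by norm_num))

/-- A bound on the number of operations. -/
theorem time_le {n E m S' L l Λ : ℕ} {δ lu ln : ℝ} (hn : 1 ≤ n) (hδ : 0 < δ) (hδ1 : δ ≤ 1)
    (hlu : 1 ≤ lu) (hln : 0 ≤ ln) (hL : 1 ≤ L) (hE : E * δ ≤ 7 * n) (hl : l ≤ 2 * lu)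
    (hΛ : Λ ≤ 6 * (L * lu + ln)) (hm : m ≤ E * l + 1) (hS' : S' = E * (n * l) + 1) :
    ((500 * (n * S' * m * ((n + 4) * Λ)) + 1 : ℕ) : ℝ) ≤
      4000000 * ((n : ℝ) ^ 5 * lu ^ 3 * (L + ln) / δ ^ 2) := by
  have hn' : (1 : ℝ) ≤ n := by exact_mod_cast hn
  have hL' : (1 : ℝ) ≤ L := by exact_mod_cast hL
  have hnlu : 1 ≤ n * lu := one_le_mul_of_one_le_of_one_le hn' hlu
  have hEl : E * δ * l ≤ 7 * n * (2 * lu) := by gcongr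
  -- The product `7 * 2` comes from `E * δ * l`, and the additional 1 absorbs the `+ 1` in the
  -- number of blocks.
  have hm' : m * δ ≤ 15 * (n * lu) := by
    have : (m : ℝ) ≤ E * l + 1 := by exact_mod_cast hm
    nlinarith
  have hS : S' * δ ≤ 15 * (n ^ 2 * lu) := by
    have h1 : (n : ℝ) * (E * δ * l) ≤ n * (7 * n * (2 * lu)) := by gcongr
    have h2 : 1 * 1 ≤ (n : ℝ) * (n * lu) := by gcongr
    rw [hS']
    push_cast
    nlinarith
  have hΛ' : (Λ : ℝ) ≤ 6 * (lu * (L + ln)) := by nlinarith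
  have hn4 : (n : ℝ) + 4 ≤ 5 * n := by linarith
  have h1 : 1 * 1 * (1 : ℝ) ≤ (n : ℝ) ^ 5 * lu ^ 3 * (L + ln) := by
    gcongr
    · exact one_le_pow₀ hn'
    · exact one_le_pow₀ hlu
    · linarith
  rw [← mul_div_assoc, le_div_iff₀ (by positivity)]
  push_cast
  calc (500 * ((n : ℝ) * S' * m * ((n + 4) * Λ)) + 1) * δ ^ 2
      = 500 * (n * (S' * δ) * (m * δ) * ((n + 4) * Λ)) + δ ^ 2 := by ring
    _ ≤ 500 * (n * (15 * (n ^ 2 * lu)) * (15 * (n * lu)) * (5 * n * (6 * (lu * (L + ln))))) + 1 := by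
      gcongr
      exact pow_le_one₀ hδ.le hδ1
    _ = 3375000 * ((n : ℝ) ^ 5 * lu ^ 3 * (L + ln)) + 1 := by ring
    _ ≤ _ := by linarith

/-! ### Assembly of the theorem. -/

namespace RatRAM

/-- The program. -/
def program : Prog :=
  .ite (.lt 2 4) (.seq (.const 0 0) (.const 1 0)) main

end RatRAM

/-- Passes from the integer form of the error estimate, cleared of denominators, to the form with
`δ`. -/
theorem le_of_pow_mul_le {E n Z : ℕ} {cnt : ℤ} {δ : ℝ} (hE0 : 0 < E) (hcnt : 0 ≤ cnt)
    (hE : (1 + 1 / (E : ℝ)) ^ (2 * n + 1) ≤ 1 + δ)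
    (h : (E : ℤ) ^ (2 * n + 1) * (Z : ℤ) ≤ (E + 1) ^ (2 * n + 1) * cnt) :
    (Z : ℝ) ≤ (1 + δ) * cnt := by
  have hE0' : (0 : ℝ) < E := by exact_mod_cast hE0
  have h' : (E : ℝ) ^ (2 * n + 1) * Z ≤ (E + 1) ^ (2 * n + 1) * cnt := by exact_mod_cast h
  have h1 : ((E : ℝ) + 1) ^ (2 * n + 1) = E ^ (2 * n + 1) * (1 + 1 / (E : ℝ)) ^ (2 * n + 1) := by
    rw [← mul_pow]
    congr 1
    field_simp
  rw [h1, mul_assoc] at h'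
  have hc : (0 : ℝ) ≤ cnt := by exact_mod_cast hcnt
  exact (le_of_mul_le_mul_left h' (by positivity)).trans (by gcongr)

namespace RatRAM
variable {n : ℕ} {f : Fin n → ℝ → ℝ} {Ω : ℕ}

/-- Here the analysis parameters are fixed in terms of `L`. A point below `u` has encoding length at
most `l + 1`, so values have length at most `L * (l + 1) ≤ 2 * (L * l)`; together with `n` this
gives `M`, and the extra bit in `Λ` gives `2 * M = 2 ^ Λ`. -/
theorem exec_main {u L : ℕ} {b δ : ℚ} (hn : 1 ≤ n) (hu : 2 ≤ u) (hδ : 0 < δ)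
    (hf0 : ∀ j x, 0 ≤ f j x) (hmono : ∀ j, Monotone (f j))
    (hrat : ∀ j (q : ℚ), ∃ r : ℚ, f j (q : ℝ) = (r : ℝ)) (hbL : encLen b ≤ L) (hδL : encLen δ ≤ L)
    (hfL : ∀ j (x : ℕ) (r : ℚ), x < u → f j (x : ℝ) = (r : ℝ) → encLen r ≤ L * encLen (x : ℚ))
    (hb : 0 ≤ b) {l Λ : ℕ} (hl : l = Nat.clog 2 u) (hΛ : Λ = Nat.clog 2 n + 2 * (L * l) + 1) :
    ∃ E m S' : ℕ, ((E : ℝ) * (min (δ : ℝ) 1) ≤ 7 * n) ∧ m ≤ E * l + 1 ∧ S' = E * (n * l) + 1 ∧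
      Run f (2 ^ (14 * Λ)) main (initial n u b δ) (500 * (n * S' * m * ((n + 4) * Λ))) (fun τ =>
        ∃ k e : ℕ, τ.var 0 = k ∧ τ.var 1 = e ∧
          ((solutionSet f b u).ncard : ℝ) ≤ (k * 2 ^ e : ℕ) ∧
          ((k * 2 ^ e : ℕ) : ℝ) ≤ (1 + min (δ : ℝ) 1) * (solutionSet f b u).ncard) := by
  choose r hr using hrat
  -- The values are indexed by all of `ℕ`, with 0 beyond `n`, so that the recursion on coordinates
  -- needs no dependent indices.
  set G : ℕ → ℕ → ℚ := fun j x => if h : j < n then r ⟨j, h⟩ x else 0 with hGdef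
  have hG : ∀ (j : Fin n) (x : ℕ), f j (x : ℝ) = (G j x : ℝ) := by
    intro j x
    have := hr j x
    simpa [hGdef] using this
  have hGj : ∀ j (hj : j < n) (x : ℕ), f ⟨j, hj⟩ (x : ℝ) = (G j x : ℝ) := fun j hj x => hG ⟨j, hj⟩ x
  have hG0 : ∀ j < n, ∀ x, 0 ≤ G j x := by
    intro j hj x
    have := hf0 ⟨j, hj⟩ x
    rw [hGj] at this
    exact_mod_cast this
  have hGm : ∀ j < n, Monotone (G j) := by
    intro j hj x x' hx
    have := hmono ⟨j, hj⟩ (Nat.cast_le.2 hx : (x : ℝ) ≤ x')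
    rw [hGj, hGj] at this
    exact_mod_cast this
  have hl0 : 0 < l := hl ▸ Nat.clog_pos (by norm_num) hu
  have hL0 : 1 ≤ L := (one_le_encLen b).trans hbL
  have hLl : L ≤ L * l := Nat.le_mul_of_pos_right L hl0
  have hlL : l ≤ L * l := Nat.le_mul_of_pos_left l hL0
  set M : ℕ := 2 ^ (Nat.clog 2 n + 2 * (L * l)) with hM
  have hpow : ∀ k, k ≤ Nat.clog 2 n + 2 * (L * l) → 2 ^ k ≤ M := fun k hk =>
    Nat.pow_le_pow_right (by norm_num) hk
  have hMY : 2 * M = 2 ^ Λ := by rw [hΛ, pow_succ, mul_comm]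
  have henc : ∀ j < n, ∀ x < u, encLen (G j x) ≤ 2 * (L * l) := by
    intro j hj x hx
    refine (hfL ⟨j, hj⟩ x _ hx (hGj j hj x)).trans ?_
    calc L * encLen (x : ℚ) ≤ L * (l + 1) := by
          rw [hl]
          exact Nat.mul_le_mul_left _ (encLen_natCast_le hx)
      _ ≤ _ := by rw [mul_add]; omega
  have hnl : n ≤ 2 ^ Nat.clog 2 n := Nat.le_pow_clog (by norm_num) n
  have hul : u ≤ 2 ^ l := hl ▸ Nat.le_pow_clog (by norm_num) u
  set δ' : ℚ := min δ 1 with hδ'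
  have hδ0 : 0 < δ' := lt_min hδ one_pos
  have hden : δ'.den ≤ 2 ^ L := by
    rcases min_choice δ 1 with h | h
    · rw [hδ', h]
      exact (den_le_two_pow_encLen δ).trans (Nat.pow_le_pow_right (by norm_num) hδL)
    · rw [hδ', h]
      exact Nat.one_le_two_pow
  have hfl0 : 0 ≤ ⌊6 * (n : ℚ) / δ'⌋ := Int.floor_nonneg.2 (by positivity)
  obtain ⟨E, hE⟩ : ∃ E : ℕ, (E : ℤ) = ⌊6 * (n : ℚ) / δ'⌋ + 1 :=
    ⟨(⌊6 * (n : ℚ) / δ'⌋ + 1).toNat, Int.toNat_of_nonneg (by omega)⟩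
  have hE0 : 0 < E := by omega
  have hEq : (E : ℚ) = (⌊6 * (n : ℚ) / δ'⌋ : ℤ) + 1 := by exact_mod_cast hE
  have hE1 : 6 * n / δ' ≤ (E : ℚ) := by
    rw [hEq]
    exact (Int.lt_floor_add_one _).le
  have hn' : (1 : ℚ) ≤ n := by exact_mod_cast hn
  have hE2 : (E : ℚ) * δ' ≤ 7 * n := by
    have h1 := Int.floor_le (6 * (n : ℚ) / δ')
    rw [le_div_iff₀ hδ0] at h1
    rw [hEq, add_mul, one_mul]
    have : δ' ≤ 1 := min_le_right _ _
    linarith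
  -- The numerator of `δ'` is at least 1, so `1 / δ'` is at most its denominator.
  have hEN : E ≤ 7 * (n * δ'.den) := by
    have h1 := Rat.mul_den_eq_num δ'
    have h2 : (1 : ℚ) ≤ δ'.num := by exact_mod_cast Rat.num_pos.2 hδ0
    have h3 : (E : ℚ) * 1 ≤ E * δ'.num := by gcongr
    rw [← h1] at h3
    have h4 : (E : ℚ) * δ' * δ'.den ≤ 7 * n * δ'.den := by gcongr
    have h5 : (E : ℚ) ≤ 7 * (n * δ'.den) := by linarith
    exact_mod_cast h5
  have hnD : n * δ'.den ≤ M := by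
    calc n * δ'.den ≤ 2 ^ Nat.clog 2 n * 2 ^ L := by gcongr
      _ = 2 ^ (Nat.clog 2 n + L) := by rw [pow_add]
      _ ≤ M := hpow _ (by omega)
  obtain ⟨m, hm0, hm, hlt⟩ := exists_blockPoint_eq E (by omega : 0 < u)
  have hml : m ≤ E * l + 1 := hl ▸ card_blocks_le hE0 hlt
  have hδc : ((δ' : ℚ) : ℝ) = min (δ : ℝ) 1 := by rw [hδ']; push_cast; rfl
  refine ⟨E, m, E * (n * l) + 1, ?_, hml, rfl, ?_⟩
  · rw [← hδc]
    exact_mod_cast hE2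
  have hM8 : 4 ≤ M := hpow 2 (by omega)
  have hΛY : Λ ≤ 2 ^ Λ := Nat.lt_two_pow_self.le
  obtain ⟨c1, c2, c3, c4, c5, c6⟩ := capacity_bounds (n := n) (u := u) (M := M) (D := δ'.den)
    (Λ := Λ) (Y := 2 ^ Λ) (by omega)
    (by have := hpow (Nat.clog 2 n) (by omega); omega)
    (by have := hpow l (by omega); omega) (by omega) (by omega) hΛY (by omega) (by omega) hml rfl
  rw [show (2 ^ Λ) ^ 14 = 2 ^ (14 * Λ) by rw [← pow_mul, mul_comm]] at c1 c2 c3 c4 c5 c6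
  refine Run.mono (run_main (δ := δ) (M := M) (G := G) (E := E) (m := m)
    (S' := E * (n * l) + 1) (by simp [initial]) (by simp [initial])
    (by simp [initial]) (by simp [initial]) (by simp [initial]) rfl hn hu hb hδ hG hG0 hGm
    hE hm0 hm hlt (by rw [hl]) ?_ ?_ ?_ ?_ ?_ ?_ hMY.le c1 c2 c3 c4 c5 c6) le_rfl ?_
  · exact fun j hj x hx => (num_le_two_pow_encLen _).trans
      (hpow _ ((henc j hj x hx).trans (by omega)))
  · exact fun j hj x hx => (den_le_two_pow_encLen _).trans
      (hpow _ ((henc j hj x hx).trans (by omega)))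
  · exact (num_le_two_pow_encLen _).trans (hpow _ (by omega))
  · exact (den_le_two_pow_encLen _).trans (hpow _ (by omega))
  · exact hnl.trans (hpow _ (by omega))
  · exact hul.trans (hpow _ (by omega))
  · rintro τ - ⟨k, e, h0, h1, h2, h3⟩
    have hcnt := ncard_solutionSet (b := b) (u := u) hG
    refine ⟨k, e, h0, h1, ?_, ?_⟩
    · rw [← hcnt] at h2
      exact_mod_cast h2
    · have := le_of_pow_mul_le (δ := δ') hE0 (by rw [← hcnt]; positivity) ?_ h3
      · rw [← hcnt, hδc] at this
        exact_mod_cast this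
      · exact one_add_inv_pow_le hn (by exact_mod_cast hδ0) (by exact_mod_cast min_le_right _ _)
          (by exact_mod_cast hE1)

end RatRAM

theorem solutionSet_eq_empty {n u : ℕ} {f : Fin n → ℝ → ℝ} {b : ℚ} (hf0 : ∀ j x, 0 ≤ f j x)
    (hb : b < 0) : solutionSet f b u = ∅ := by
  refine Set.eq_empty_of_forall_notMem fun x hx => ?_
  have h1 : ∑ j, f j (((x j : ℕ) : ℝ)) ≤ (b : ℝ) := hx
  have h2 : (0 : ℝ) ≤ ∑ j, f j (((x j : ℕ) : ℝ)) := Finset.sum_nonneg fun j _ => hf0 j _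
  have h3 : (b : ℝ) < 0 := by exact_mod_cast hb
  linarith

theorem mainTheorem6 :
    ∃ (P : RatRAM.Prog) (C : ℝ), 0 < C ∧
      ∀ (n u L : ℕ) (f : Fin n → ℝ → ℝ) (b δ : ℚ),
        1 ≤ n → 2 ≤ u → 0 < δ →
        (∀ j x, 0 ≤ f j x) →
        (∀ j, Monotone (f j)) →
        (∀ j (q : ℚ), ∃ r : ℚ, f j (q : ℝ) = (r : ℝ)) →
        encLen b ≤ L → encLen δ ≤ L →
        (∀ j (x : ℕ) (r : ℚ), x < u → f j (x : ℝ) = (r : ℝ) → encLen r ≤ L * encLen (x : ℚ)) →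
        ∃ (τ : RatRAM.State) (t : ℕ) (Z' : ℝ),
          RatRAM.Exec f (C * (L * Real.logb 2 u + Real.logb 2 n)) P
            (RatRAM.initial n u b δ) τ t ∧
          (t : ℝ) ≤ C * ((n : ℝ) ^ 5 * (Real.logb 2 u) ^ 3 * (L + Real.logb 2 n)
            / (min (δ : ℝ) 1) ^ 2) ∧
          RatRAM.Outputs τ Z' ∧
          ((solutionSet f b u).ncard : ℝ) ≤ Z' ∧
          Z' ≤ (1 + (δ : ℝ)) * ((solutionSet f b u).ncard : ℝ) := by
  -- The constant is dictated by `time_le`; the word length needs far less.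
  refine ⟨RatRAM.program, 4000000, by norm_num, ?_⟩
  intro n u L f b δ hn hu hδ hf0 hmono hrat hbL hδL hfL
  have hL : 1 ≤ L := (one_le_encLen b).trans hbL
  have hL' : (1 : ℝ) ≤ L := by exact_mod_cast hL
  have hln : 0 ≤ Real.logb 2 n := Real.logb_nonneg (by norm_num) (by exact_mod_cast hn)
  have hlu : 1 ≤ Real.logb 2 u := by
    rw [Real.le_logb_iff_rpow_le (by norm_num) (by exact_mod_cast (by omega : 0 < u))]
    simpa using (by exact_mod_cast hu : (2 : ℝ) ≤ u)
  have hLlu : 1 * 1 ≤ L * Real.logb 2 u := by gcongr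
  have hn' : (1 : ℝ) ≤ n := by exact_mod_cast hn
  have hδ' : (0 : ℝ) < δ := by exact_mod_cast hδ
  have hm0 : 0 < min (δ : ℝ) 1 := lt_min hδ' one_pos
  have hm1 : min (δ : ℝ) 1 ≤ 1 := min_le_right _ _
  -- For negative `b` no point qualifies and the program outputs 0 at once; the main part relies on
  -- `0 ≤ b` for the digits of `b`.
  by_cases hb : b < 0
  · have h0 : encLen 0 = 1 := by decide
    have hB : (encLen 0 : ℝ) ≤ 4000000 * (L * Real.logb 2 u + Real.logb 2 n) := by
      rw [h0]
      push_cast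
      linarith
    refine ⟨_, _, 0, .ite_true ?_ (.seq (.const _ 0 0 hB) (.const _ 1 0 hB)), ?_, ?_, ?_, ?_⟩
    · simpa [RatRAM.Test.Holds, RatRAM.initial] using hb
    · have h1 : 1 * 1 * (1 : ℝ) ≤ (n : ℝ) ^ 5 * Real.logb 2 u ^ 3 * (L + Real.logb 2 n) := by
        gcongr
        · exact one_le_pow₀ hn'
        · exact one_le_pow₀ hlu
        · linarith
      rw [← mul_div_assoc, le_div_iff₀ (by positivity)]
      have := pow_le_one₀ (n := 2) hm0.le hm1
      push_cast
      linarith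
    · exact ⟨0, 0, by simp, by simp, by simp⟩
    · simp [solutionSet_eq_empty hf0 hb]
    · simp [solutionSet_eq_empty hf0 hb]
  · obtain ⟨E, m, S', hE, hm, hS', τ, t, hex, ht, k, e, h0, h1, h2, h3⟩ :=
      RatRAM.exec_main hn hu hδ hf0 hmono hrat hbL hδL hfL (not_lt.1 hb) rfl rfl
    have hcn := clog_le_logb_add_one hn
    have hcu := clog_le_logb_add_one (by omega : 1 ≤ u)
    have hcu2 : (Nat.clog 2 u : ℝ) ≤ 2 * Real.logb 2 u := by linarith
    set Λ : ℕ := Nat.clog 2 n + 2 * (L * Nat.clog 2 u) + 1 with hΛ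
    have hΛr : (Λ : ℝ) ≤ 6 * (L * Real.logb 2 u + Real.logb 2 n) := by
      have : (L : ℝ) * Nat.clog 2 u ≤ L * (2 * Real.logb 2 u) := by gcongr
      rw [hΛ]
      push_cast
      linarith
    refine ⟨τ, t + 1, (k * 2 ^ e : ℕ), .ite_false ?_ (RatRAM.Exec.mono ?_ hex), ?_, ?_, h2, ?_⟩
    · simpa [RatRAM.Test.Holds, RatRAM.initial] using hb
    · have hclog : Nat.clog 2 (2 ^ (14 * Λ) + 1) ≤ 14 * Λ + 1 := by
        refine Nat.clog_le_of_le_pow ?_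
        have := Nat.one_le_two_pow (n := 14 * Λ)
        rw [pow_succ]
        omega
      -- Numerator and denominator each take at most `14 * Λ + 1` bits, and `Λ ≥ 1`.
      have : 2 * Nat.clog 2 (2 ^ (14 * Λ) + 1) ≤ 30 * Λ := by omega
      calc ((2 * Nat.clog 2 (2 ^ (14 * Λ) + 1) : ℕ) : ℝ) ≤ (30 * Λ : ℕ) := Nat.cast_le.2 this
        _ ≤ _ := by
          push_cast
          linarith
    · refine le_trans (Nat.cast_le.2 (Nat.succ_le_succ ht)) ?_
      exact time_le hn hm0 hm1 hlu hln hL hE hcu2 hΛr hm hS'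
    · exact ⟨k, e, by simpa using h0, by simpa using h1, by push_cast; rfl⟩
    · refine h3.trans ?_
      gcongr
      exact min_le_left _ _
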